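/- A set $\mathcal L$ of equiangular lines in a finite-dimensional unitary (complex inner product) space $V$ is a set of $1$-spaces that spans $V$ such that the angle between any two different members is the same. Two line sets are equivalent if a unitary transformation between their spaces sends one to the other. Explicit line sets, for a sign $\varepsilon=\pm1$: (A) (orthogonal, $m>1$) Let $E_0=\mathbb F_2^{2m+1}$ with the nondegenerate quadratic form $\sum_{i=1}^m x_iy_i+t^2$. Let $\mathcal M_\varepsilon$ be the set of hyperplanes of $E_0$ of type $\mathrm O^{\varepsilon}(2m,2)$, and for $M\in\mathcal M_\varepsilon$ let $\lambda_M\colon E_0\to\{\pm1\}$ be the character with kernel $M$. In $\mathbb C^{\mathcal M_\varepsilon}$ with its standard orthonormal basis $(v_M)$ take the set of the lines $\big\langle\sum_{M}\lambda_M(e)v_M\big\rangle$, $e\in E_0$. (B) (Weil, $p$ an odd prime, $m\ge1$) Let $W$ be the unitary space of functions $f\colon\mathbb F_p^m\to\mathbb C$ and $\zeta=e^{2\pi i/p}$. Let $E_0\le\mathrm U(W)$ be the extraspecial group of order $p^{1+2m}$ and exponent $p$ of the operators $f(x)\mapsto\zeta^{c+b\cdot x}f(x+a)$. Let $S_0\cong\mathrm{Sp}(2m,p)$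 be the image of the Weil representation, generated by the operators $f(x)\mapsto\left(\frac{\det A}{p}\right)f(Ax)$ for $A\in\mathrm{GL}(m,p)$, $f(x)\mapsto\zeta^{x\cdot Bx/2}f(x)$ for symmetric $B$, and $f(x)\mapsto\gamma\sum_y\zeta^{x\cdot y}f(y)$, where $\gamma=p^{-m}\sum_y\zeta^{y\cdot y/2}$; it normalizes $E_0$. Let $U=\{f\in W: f(-x)=\varepsilon f(x)\}$, which is an eigenspace of the central involution of $S_0$, let $E_0S_0$ act on $U^*$ through $E_0S_0/E_0\cong S_0$, and let $v_0=\sum_i u_i\otimes u_i^*\in U\otimes U^*\subseteq W\otimes U^*$ for an orthonormal basis $(u_i)$ of $U$ with dual basis $(u_i^*)$. In $W\otimes U^*$ take the orbit of the line $\langle v_0\rangle$ under $E_0S_0$. **Lemma.** Let $p$ be a prime and let $\mathcal L$ be a set of $n=p^{2m}$ equiangular lines in a unitary space $V$ of dimension $d$ with $1<d\le n/2$. Let $G$ be a group of unitary transformations of $V$ that send $\mathcal L$ to itself, such that $G$ acts $2$-transitively on $\mathcal L$. Assume that $G\cong E\rtimes S$ with $S\cong\mathrm{Sp}(2m,p)$,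 where $E$ is elementary abelian of order $2^{1+2m}$ if $p=2$, and extraspecial of order $p^{1+2m}$ if $p>2$. Then either $p=2$, $m>1$ and $\mathcal L$ is equivalent to one of the line sets (A), or $p>2$, $m\geq 1$ and $\mathcal L$ is equivalent to one of the line sets (B). -/

import Mathlib

set_option maxSynthPendingDepth 3

open scoped TensorProduct

/-! ### Sets of equiangular lines in unitary spaces -/

section Lines

variable {V V' : Type*} [NormedAddCommGroup V] [InnerProductSpace ℂ V]
  [NormedAddCommGroup V'] [InnerProductSpace ℂ V']

/-- A set of equiangular lines: a set of `1`-spaces that generates the unitary space `V`, such that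
the angle between any two different members is constant. -/
structure IsEquiangularLineSet (L : Set (Submodule ℂ V)) : Prop where
  finrank_eq_one : ∀ l ∈ L, Module.finrank ℂ l = 1
  span_eq_top : sSup L = ⊤
  equiangular : ∃ c : ℝ, ∀ l ∈ L, ∀ l' ∈ L, l ≠ l' →
    ∀ u ∈ l, ∀ v ∈ l', ‖u‖ = 1 → ‖v‖ = 1 → ‖inner ℂ u v‖ = c

/-- Image of a subspace under a unitary transformation. -/
def moveLine (g : V ≃ₗᵢ[ℂ] V') (l : Submodule ℂ V) : Submodule ℂ V' :=
  l.map (g.toLinearEquiv : V →ₗ[ℂ] V')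

/-- Two line sets are equivalent if a unitary transformation sends one to the other. -/
def LineSetEquivalent (L : Set (Submodule ℂ V)) (L' : Set (Submodule ℂ V')) : Prop :=
  ∃ g : V ≃ₗᵢ[ℂ] V', moveLine g '' L = L'

/-- `G` consists of unitary automorphisms of `L`, that is, unitary transformations sending `L` to
itself. -/
def ActsByAutomorphisms (G : Subgroup (V ≃ₗᵢ[ℂ] V)) (L : Set (Submodule ℂ V)) : Prop :=
  ∀ g ∈ G, moveLine g '' L = L

/-- `G` is transitive on the ordered pairs of different members of `L`. -/
def IsTwoTransitiveOn (G : Subgroup (V ≃ₗᵢ[ℂ] V)) (L : Set (Submodule ℂ V)) : Prop :=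
  ∀ k ∈ L, ∀ l ∈ L, ∀ k' ∈ L, ∀ l' ∈ L, k ≠ l → k' ≠ l' →
    ∃ g ∈ G, moveLine g k = k' ∧ moveLine g l = l'

end Lines

/-! ### Groups -/

/-- The symplectic group `Sp(2m, p)`. -/
abbrev Sp (m p : ℕ) : Type := Matrix.symplecticGroup (Fin m) (ZMod p)

/-- Elementary abelian `p`-groups (`p` prime). -/
def IsElementaryAbelian (p : ℕ) (E : Type*) [Group E] : Prop :=
  (∀ x y : E, x * y = y * x) ∧ ∀ x : E, x ^ p = 1

/-- Extraspecial `p`-groups: `p`-groups `E` with `E' = Z(E)` of order `p` and `E / Z(E)` elementary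
abelian. No condition on the exponent of `E` is imposed. -/
structure IsExtraspecial (p : ℕ) (E : Type*) [Group E] : Prop where
  isPGroup : IsPGroup p E
  card_center : Nat.card (Subgroup.center E) = p
  commutator_eq_center : commutator E = Subgroup.center E
  elementaryAbelian_quotient : IsElementaryAbelian p (E ⧸ Subgroup.center E)

/-! ### The orthogonal examples -/

section Orthogonal

/-- The vector space `𝔽₂^(2m+1)`, with coordinates `(x₁, …, xₘ, y₁, …, yₘ, t)`. -/
abbrev OrthSpace (m : ℕ) : Type := (Fin m → ZMod 2) × (Fin m → ZMod 2) × ZMod 2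

/-- The nondegenerate quadratic form `∑ xᵢ yᵢ + t ^ 2` on `𝔽₂^(2m+1)`, which turns this space into
an `O(2m+1, 2)`-space. The radical of its polar form is spanned by `(0, 0, 1)`. -/
def orthForm (m : ℕ) : QuadraticForm (ZMod 2) (OrthSpace m) :=
  (∑ i : Fin m, QuadraticMap.linMulLin
      (LinearMap.proj i ∘ₗ LinearMap.fst (ZMod 2) _ _)
      (LinearMap.proj i ∘ₗ LinearMap.fst (ZMod 2) _ _ ∘ₗ LinearMap.snd (ZMod 2) _ _)) +
    QuadraticMap.linMulLin
      (LinearMap.snd (ZMod 2) _ _ ∘ₗ LinearMap.snd (ZMod 2) _ _)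
      (LinearMap.snd (ZMod 2) _ _ ∘ₗ LinearMap.snd (ZMod 2) _ _)

/-- `M` is a hyperplane of type `O⁺(2m, 2)` (for `ε = 1`) or `O⁻(2m, 2)` (for `ε = -1`): the polar
form is nondegenerate on `M`, and `M` contains (respectively, does not contain) a totally singular
subspace of dimension `m`. -/
structure IsHyperplaneOfType (m : ℕ) (ε : ℤˣ) (M : Submodule (ZMod 2) (OrthSpace m)) : Prop where
  finrank_eq : Module.finrank (ZMod 2) M = 2 * m
  nondegenerate : ∀ x ∈ M, (∀ y ∈ M, QuadraticMap.polar (orthForm m) x y = 0) → x = 0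
  type_eq : ε = 1 ↔ ∃ T : Submodule (ZMod 2) (OrthSpace m),
    T ≤ M ∧ Module.finrank (ZMod 2) T = m ∧ ∀ x ∈ T, orthForm m x = 0

/-- The set of hyperplanes of type `O^ε(2m, 2)`. -/
abbrev OrthHyperplane (m : ℕ) (ε : ℤˣ) : Type :=
  {M : Submodule (ZMod 2) (OrthSpace m) // IsHyperplaneOfType m ε M}

noncomputable instance (m : ℕ) (ε : ℤˣ) : Fintype (OrthHyperplane m ε) := Fintype.ofFinite _

open Classical in
/-- The vector `v̄ e = ∑ λ_M(e) v_M`, where `(v_M)` is the standard basis and `λ_M` is the character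
`E → {±1}` with kernel `M`. -/
noncomputable def orthVector (m : ℕ) (ε : ℤˣ) (e : OrthSpace m) :
    EuclideanSpace ℂ (OrthHyperplane m ε) :=
  ∑ M : OrthHyperplane m ε, (if e ∈ M.1 then (1 : ℂ) else -1) • EuclideanSpace.single M (1 : ℂ)

/-- The line set `⟨v̄⟩E` of the orthogonal example of type `ε`. -/
def orthLines (m : ℕ) (ε : ℤˣ) : Set (Submodule ℂ (EuclideanSpace ℂ (OrthHyperplane m ε))) :=
  Set.range fun e : OrthSpace m => Submodule.span ℂ {orthVector m ε e}

end Orthogonal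

/-! ### The Weil examples -/

section Dual

/-- The dual of a finite-dimensional unitary space is a unitary space: by the Riesz isomorphism,
`⟨⟨u, ·⟩, ⟨v, ·⟩⟩ = ⟨v, u⟩`. The norm is the operator norm. -/
noncomputable instance dualInnerProductSpace (H : Type*) [NormedAddCommGroup H]
    [InnerProductSpace ℂ H] [CompleteSpace H] : InnerProductSpace ℂ (StrongDual ℂ H) where
  inner φ χ := inner ℂ ((InnerProductSpace.toDual ℂ H).symm χ)
    ((InnerProductSpace.toDual ℂ H).symm φ)
  norm_sq_eq_re_inner φ := by
    rw [← norm_sq_eq_re_inner, LinearIsometryEquiv.norm_map]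
  conj_inner_symm φ χ := inner_conj_symm _ _
  add_left φ χ ρ := by rw [map_add, inner_add_right]
  smul_left φ χ r := by rw [map_smulₛₗ, inner_smul_right]

end Dual

section Weil

variable (p m : ℕ) [Fact p.Prime]

/-- The unitary space `W` of dimension `p ^ m`: complex functions on `𝔽_p^m`. -/
abbrev WeilSpace : Type := EuclideanSpace ℂ (Fin m → ZMod p)

/-- The extraspecial group `E ≤ U(W)` of order `p ^ (1 + 2m)` and exponent `p` (for `p` odd), in its
Schrödinger representation `f(x) ↦ ζ ^ (c + b ⬝ x) f(x + a)` with `ζ = exp (2πi / p)`. -/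
noncomputable def heisenbergGroup : Subgroup (WeilSpace p m ≃ₗᵢ[ℂ] WeilSpace p m) :=
  Subgroup.closure {g | ∃ (a b : Fin m → ZMod p) (c : ZMod p), ∀ f x,
    g f x = ZMod.stdAddChar (c + b ⬝ᵥ x) * f (x + a)}

/-- The complement `S ≅ Sp(2m, p)` of `E` in `ES ≤ U(W)` (for `p` odd), which normalizes `E` and
induces `Sp(2m, p)` on `E / Z(E)`: the image of the Weil representation. It is generated by the
standard operators
* `f(x) ↦ (det A / p) f(A x)` for invertible `A`, with the Legendre symbol,
* `f(x) ↦ ζ ^ (x ⬝ B x / 2) f(x)` for symmetric `B`,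
* the Fourier transform `f(x) ↦ γ ∑ y, ζ ^ (x ⬝ y) f(y)`, normalized by the quadratic Gauss sum
  `γ = p ^ (-m) ∑ y, ζ ^ (y ⬝ y / 2)`. -/
noncomputable def weilGroup : Subgroup (WeilSpace p m ≃ₗᵢ[ℂ] WeilSpace p m) :=
  Subgroup.closure
    ({g | ∃ A : Matrix (Fin m) (Fin m) (ZMod p), IsUnit A.det ∧ ∀ f x,
        g f x = (quadraticChar (ZMod p) A.det : ℂ) * f (A.mulVec x)} ∪
     {g | ∃ B : Matrix (Fin m) (Fin m) (ZMod p), B.IsSymm ∧ ∀ f x,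
        g f x = ZMod.stdAddChar (2⁻¹ * (x ⬝ᵥ B.mulVec x)) * f x} ∪
     {g | ∀ f x, g f x = ((p : ℂ) ^ m)⁻¹ * (∑ y : Fin m → ZMod p,
        ZMod.stdAddChar (2⁻¹ * (y ⬝ᵥ y))) *
          ∑ y : Fin m → ZMod p, ZMod.stdAddChar (x ⬝ᵥ y) * f y})

/-- The operator `f(x) ↦ f(-x)`. Up to sign, it is the central involution of `S`. -/
noncomputable def weilInvolution : WeilSpace p m ≃ₗᵢ[ℂ] WeilSpace p m :=
  LinearIsometryEquiv.piLpCongrLeft 2 ℂ ℂ (Equiv.neg (Fin m → ZMod p))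

variable {p m} in
theorem weilInvolution_apply (f : WeilSpace p m) (x : Fin m → ZMod p) :
    weilInvolution p m f x = f (-x) := by
  simp [weilInvolution, LinearIsometryEquiv.piLpCongrLeft_apply, Equiv.piCongrLeft']

/-- The eigenspace `W_ε = {f | f(-x) = ε f(x)}` of the central involution, a Weil module. It has
dimension `(p ^ m + ε) / 2`. -/
noncomputable def weilModule (ε : ℤˣ) : Submodule ℂ (WeilSpace p m) :=
  Module.End.eigenspace (weilInvolution p m).toLinearEquiv.toLinearMap ((ε : ℤ) : ℂ)

variable {p m}

theorem weilGroup_le_centralizer :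
    weilGroup p m ≤ Subgroup.centralizer {weilInvolution p m} := by
  rw [weilGroup, Subgroup.closure_le]
  intro g hg
  rw [SetLike.mem_coe, Subgroup.mem_centralizer_iff]
  rintro _ rfl
  ext f x
  change weilInvolution p m (g f) x = g (weilInvolution p m f) x
  rw [weilInvolution_apply]
  rcases hg with (⟨A, -, h⟩ | ⟨B, -, h⟩) | h
  · simp only [h, weilInvolution_apply, Matrix.mulVec_neg]
  · simp only [h, weilInvolution_apply, Matrix.mulVec_neg, neg_dotProduct_neg]
  · rw [h, h, ← Equiv.sum_comp (Equiv.neg (Fin m → ZMod p)) fun y =>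
      ZMod.stdAddChar (-x ⬝ᵥ y) * f y]
    simp only [weilInvolution_apply, Equiv.neg_apply, neg_dotProduct_neg]

theorem weilGroup_mapsTo (ε : ℤˣ) (s : weilGroup p m) :
    ∀ f ∈ weilModule p m ε, s.1 f ∈ weilModule p m ε := by
  intro f hf
  have hs := Subgroup.mem_centralizer_iff.1 (weilGroup_le_centralizer s.2) _ rfl
  have h := congrArg (fun g : WeilSpace p m ≃ₗᵢ[ℂ] WeilSpace p m => g f) hs
  simp only [LinearIsometryEquiv.coe_mul, Function.comp_apply] at h
  rw [weilModule, Module.End.mem_eigenspace_iff] at hf ⊢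
  change weilInvolution p m f = _ at hf
  change weilInvolution p m (s.1 f) = _
  rw [h, hf, map_smul]

/-- The action of `S` on the Weil module `U = W_ε`. -/
noncomputable def weilAction (ε : ℤˣ) (s : weilGroup p m) :
    weilModule p m ε →L[ℂ] weilModule p m ε :=
  LinearMap.toContinuousLinearMap
    (s.1.toLinearEquiv.toLinearMap.restrict (weilGroup_mapsTo ε s))

/-- The action `φ ↦ φ ∘ s⁻¹` of `S` on the dual `U*` of the Weil module `U = W_ε`. -/
noncomputable def weilDualAction (ε : ℤˣ) (s : weilGroup p m) :
    StrongDual ℂ (weilModule p m ε) →ₗ[ℂ] StrongDual ℂ (weilModule p m ε) where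
  toFun φ := φ.comp (weilAction ε s⁻¹)
  map_add' _ _ := rfl
  map_smul' _ _ := rfl

variable (p m)

/-- The space `V = W ⊗ U*` for the Weil module `U = W_ε`. -/
abbrev WeilTensor (ε : ℤˣ) : Type := WeilSpace p m ⊗[ℂ] StrongDual ℂ (weilModule p m ε)

/-- The `S`-invariant vector `v₀ = ∑ uᵢ ⊗ uᵢ*` of `U ⊗ U* ⊆ V`, where `(uᵢ)` is an orthonormal
basis of `U = W_ε` and `(uᵢ*)` is the dual basis. It does not depend on the basis. -/
noncomputable def weilVector (ε : ℤˣ) : WeilTensor p m ε :=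
  ∑ i, (stdOrthonormalBasis ℂ (weilModule p m ε) i : WeilSpace p m) ⊗ₜ[ℂ]
    innerSL ℂ (stdOrthonormalBasis ℂ (weilModule p m ε) i)

/-- The orbit of the line `⟨v₀⟩` under the group `ES`, which acts on `W` in the given way, and on
`U*` through `ES / E ≅ S`. -/
def weilLines (ε : ℤˣ) : Set (Submodule ℂ (WeilTensor p m ε)) :=
  {l | ∃ e ∈ heisenbergGroup p m, ∃ s : weilGroup p m,
    l = Submodule.span ℂ {TensorProduct.map (e * s.1).toLinearEquiv.toLinearMap
      (weilDualAction ε s) (weilVector p m ε)}}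

end Weil

/-! The lines are pinned down by a single Gram matrix. The group `E` is normal in the 2-transitive
group `G` and does not consist of scalars, so it is transitive on the lines; by orders, a line
stabilizer in `E` is a group `Z` of `p` scalars (`exists_isLineConfiguration`). If `⟨v⟩` is a line,
2-transitivity makes its stabilizer in `ES` transitive on the nontrivial elements of `E/Z`. Hence `e
↦ ⟨v, ev⟩` has constant modulus off `Z`, and only its phases have to be found. Once the Gram matrix
is known to be `(1 - s)I + sK` with `K² = p^(2m) I`, the linear dependence of `p^(2m) > d` vectors
leaves two values of `s`, one for each sign `ε` (`exists_sign_of_gram`). The explicit line sets have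
the same Gram matrices up to a positive factor, and this gives the equivalence
(`lineSetEquivalent_of_gram`).

For `p` odd, commutators make `E/Z` a symplectic space. The isomorphism of `S` with `Sp(2m, p)` says
nothing about the action on this space, but transitivity forces the central involution `z` of `S` to
act as `-1` (`map_neg_one`). The elements of `E` inverted by `z` form a section of `E → E/Z` that
satisfies the Weyl relations (`exists_inverted_section`). As the number of lines is odd, `z` fixes
some `⟨v⟩`, and the stabilizer of `⟨v⟩` respects the section, so that the inner products themselves,
not only their moduli, are constant (`exists_weyl_system`).

For `p = 2` there is no such section. The inner products are real and equal to `±c` off `Z`, and up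
to a factor they form a convolution idempotent on `E` (`IsSignFunction`, `exists_isSignFunction`).
The point is that the signs are given by a quadratic form. For `m ≥ 3` the action of `S` on `E/Z` is
shown to be the natural one (`exists_equivariant_equiv`), and transvections then determine the polar
form (`exists_exponent_of_equivariant`). For `m = 2` the action may be twisted by the outer
automorphism of `Sp(4, 2)`; there integrality gives `d = 6` and `c = 1/3`, and sums over subspaces
of order 8 do the rest. The case `m = 1` is numerically impossible. Symplectic coordinates turn the
form into `∑ xᵢ yᵢ` (`exists_coordinates`).

The tool behind both identifications of the action is `exists_isotropic`: a subgroup of `Sp(2m, p)`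
of index prime to `p` is everything or stabilizes a nonzero isotropic subspace. It applies to vector
stabilizers in any transitive action, as their index is `p^(2m) - 1`. -/

/-! ### Symplectic spaces -/

namespace SymplecticSpace

/-! ### Transvections and the generation of symplectic groups -/

section Basic

variable {K N : Type*} [Field K] [AddCommGroup N] [Module K N]

/-- The group of linear isometries of a bilinear form. -/
def isometryGroup (B : LinearMap.BilinForm K N) : Subgroup (N ≃ₗ[K] N) where
  carrier := {g | ∀ x y, B (g x) (g y) = B x y}
  mul_mem' {g h} hg hh x y := by
    simp only [Set.mem_ofPred_eq] at hg hh
    simp [LinearEquiv.mul_apply, hg, hh]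
  one_mem' x y := rfl
  inv_mem' {g} hg x y := by
    simp only [Set.mem_ofPred_eq] at hg
    rw [← hg]
    simp

theorem mem_isometryGroup {B : LinearMap.BilinForm K N} {g : N ≃ₗ[K] N} :
    g ∈ isometryGroup B ↔ ∀ x y, B (g x) (g y) = B x y := Iff.rfl

variable {B : LinearMap.BilinForm K N} (hB : B.IsAlt)

theorem neg_swap (hB : B.IsAlt) (x y : N) : -B x y = B y x := LinearMap.IsAlt.neg hB x y

/-- The symplectic transvection `x ↦ x + c B(x, d) d`. -/
def transvection (hB : B.IsAlt) (d : N) (c : K) : N ≃ₗ[K] N where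
  toFun x := x + (c * B x d) • d
  map_add' x y := by simp [mul_add, add_smul]; abel
  map_smul' k x := by simp [smul_smul]; ring_nf
  invFun x := x + (-c * B x d) • d
  left_inv x := by simp [hB d]
  right_inv x := by simp [hB d]

theorem transvection_apply (d : N) (c : K) (x : N) :
    transvection hB d c x = x + (c * B x d) • d := rfl

theorem transvection_apply_of_ortho {d x : N} (c : K) (h : B x d = 0) :
    transvection hB d c x = x := by simp [transvection_apply, h]

theorem transvection_mem (d : N) (c : K) : transvection hB d c ∈ isometryGroup B := by
  intro x y
  have h1 : B d y = - B y d := (neg_swap hB y d).symm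
  simp only [transvection_apply, map_add, LinearMap.add_apply, map_smul, LinearMap.smul_apply,
    smul_eq_mul, hB d, h1]
  ring

theorem transvection_smul (d : N) (k c : K) :
    transvection hB (k • d) c = transvection hB d (c * k ^ 2) := by
  ext x
  simp only [transvection_apply, map_smul, smul_eq_mul, smul_smul]
  ring_nf

theorem conj_transvection {g : N ≃ₗ[K] N} (hg : g ∈ isometryGroup B) (d : N) (c : K) :
    g * transvection hB d c * g⁻¹ = transvection hB (g d) c := by
  ext x
  have : B (g⁻¹ x) d = B x (g d) := by
    rw [← hg (g⁻¹ x) d]; simp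
  simp only [LinearEquiv.mul_apply, transvection_apply, map_add, map_smul, this]
  simp

theorem exists_transvection_map {u w : N} (h : B u w ≠ 0) :
    ∃ c, transvection hB (u - w) c u = w := by
  refine ⟨(B u w)⁻¹, ?_⟩
  simp [transvection_apply, hB u, h]

/-- The subspace of fixed points. -/
def fixedSpace (g : N ≃ₗ[K] N) : Submodule K N :=
  LinearMap.eqLocus (g : N →ₗ[K] N) LinearMap.id

theorem mem_fixedSpace {g : N ≃ₗ[K] N} {x : N} : x ∈ fixedSpace g ↔ g x = x := Iff.rfl

include hB in
/-- Symplectic groups are generated by transvections. -/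
theorem mem_of_transvection_mem [FiniteDimensional K N] (hN : B.Nondegenerate)
    (H : Subgroup (N ≃ₗ[K] N)) (hH : ∀ d c, transvection hB d c ∈ H) :
    ∀ g ∈ isometryGroup B, g ∈ H := by
  -- Induction on the codimension of the fixed space of `g`.
  suffices ∀ n : ℕ, ∀ g ∈ isometryGroup B,
      Module.finrank K N ≤ Module.finrank K (fixedSpace g) + n → g ∈ H from
    fun g hg => this _ g hg (Nat.le_add_left _ _)
  intro n
  induction n with
  | zero =>
    intro g _ h
    have : fixedSpace g = ⊤ := Submodule.eq_top_of_finrank_eq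
      (le_antisymm (Submodule.finrank_le _) (by simpa using h))
    have : g = 1 := by
      ext x
      exact mem_fixedSpace.1 (this ▸ Submodule.mem_top : x ∈ fixedSpace g)
    rw [this]; exact H.one_mem
  | succ n ih =>
    intro g hg h
    -- It suffices to undo `g` at one moved point without disturbing its fixed points: then `t * g`
    -- has a larger fixed space.
    have key : ∀ (x : N) (t : N ≃ₗ[K] N), g x ≠ x → t ∈ H → t ∈ isometryGroup B → t (g x) = x →
        (∀ y, g y = y → t y = y) → g ∈ H := by
      intro x t hx htH ht htx hty
      have hlt : fixedSpace g < fixedSpace (t * g) := by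
        refine lt_of_le_of_ne (fun y hy => ?_) (fun he => hx ?_)
        · rw [mem_fixedSpace] at hy ⊢
          rw [LinearEquiv.mul_apply, hy, hty y hy]
        · rw [← mem_fixedSpace, he, mem_fixedSpace, LinearEquiv.mul_apply, htx]
      have := ih (t * g) (mul_mem ht hg) (by have := Submodule.finrank_lt_finrank_of_lt hlt; omega)
      have h2 := H.mul_mem (H.inv_mem htH) this
      rwa [inv_mul_cancel_left] at h2
    by_cases h1 : g = 1
    · rw [h1]; exact H.one_mem
    by_cases h2 : ∃ x, B (g x) x ≠ 0
    · obtain ⟨x, hx⟩ := h2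
      obtain ⟨c, hc⟩ := exists_transvection_map hB hx
      refine key x _ (fun he => hx (by rw [he, hB x])) (hH _ c) (transvection_mem hB _ _) hc ?_
      -- Fixed points of `g` are orthogonal to `g x - x`, because `B y (g x) = B (g y) (g x) = B y
      -- x`.
      intro y hy
      apply transvection_apply_of_ortho
      rw [map_sub, sub_eq_zero, ← hg y x, hy]
    · push Not at h2
      obtain ⟨x, hx⟩ : ∃ x, g x ≠ x := by
        by_contra! hcon
        exact h1 (by ext x; exact hcon x)
      obtain ⟨u, hu⟩ : ∃ u, B (g x - x) u ≠ 0 := by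
        by_contra! hcon
        exact sub_ne_zero.2 hx (hN.1 _ hcon)
      have e1 : B (g x) (g u) = B x u := hg x u
      have e2 : B (g x) u + B (g u) x = 0 := by
        have := h2 (x + u)
        simp only [map_add, LinearMap.add_apply, h2 x, h2 u] at this
        linear_combination this
      have e3 : B x (g u) = - B (g u) x := (neg_swap hB _ _).symm
      have e4 : B (g x) x = 0 := h2 x
      -- Now `g x` and `x` are orthogonal, so no single transvection joins them. The detour through
      -- `w` works because `g u - u` is also orthogonal to the fixed space.
      set w := x + (g u - u) with hw
      have hw1 : B (g x) w ≠ 0 := by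
        intro h0
        apply hu
        simp only [hw, map_add, map_sub, LinearMap.sub_apply] at h0 ⊢
        linear_combination -h0 + e1 + e4
      have hw2 : B w x ≠ 0 := by
        intro h0
        apply hu
        have := neg_swap hB w x
        rw [h0] at this
        simp only [hw, map_add, map_sub, LinearMap.sub_apply, hB x] at this ⊢
        linear_combination -this + e2 - e3
      obtain ⟨c, hc⟩ := exists_transvection_map hB hw1
      obtain ⟨c', hc'⟩ := exists_transvection_map hB hw2
      refine key x (transvection hB (w - x) c' * transvection hB (g x - w) c) hx
        (H.mul_mem (hH _ _) (hH _ _))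
        (mul_mem (transvection_mem hB _ _) (transvection_mem hB _ _))
        (by rw [LinearEquiv.mul_apply, hc, hc']) ?_
      intro y hy
      have hy1 : B y (g u) = B y u := by rw [← hg y u, hy]
      have hy2 : B y (g x) = B y x := by rw [← hg y x, hy]
      rw [LinearEquiv.mul_apply, transvection_apply_of_ortho, transvection_apply_of_ortho]
      · simp [hw, hy1, hy2]
      · rw [transvection_apply_of_ortho]
        · simp [hw, hy1]
        · simp [hw, hy1, hy2]

end Basic

/-! ### Lagrangian subspaces and their unipotent radicals -/

section Lagrangian

variable {K N : Type*} [Field K] [AddCommGroup N] [Module K N] {B : LinearMap.BilinForm K N}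

/-- A subspace is Lagrangian if it is equal to its orthogonal complement. -/
def IsLagrangian (B : LinearMap.BilinForm K N) (A : Submodule K N) : Prop :=
  ∀ x, x ∈ A ↔ ∀ a ∈ A, B a x = 0

theorem IsLagrangian.map {A : Submodule K N} (hA : IsLagrangian B A) {g : N ≃ₗ[K] N}
    (hg : g ∈ isometryGroup B) : IsLagrangian B (A.map (g : N →ₗ[K] N)) := by
  intro x
  obtain ⟨y, rfl⟩ := g.surjective x
  have : g y ∈ A.map (g : N →ₗ[K] N) ↔ y ∈ A := by
    simp
  rw [this, hA y]
  constructor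
  · rintro h _ ⟨a, ha, rfl⟩
    exact (hg a y).trans (h a ha)
  · intro h a ha
    exact (hg a y).symm.trans (h _ ⟨a, ha, rfl⟩)

/-- A set of vectors that is closed under its transvections and contains a Lagrangian subspace
is a subspace. -/
theorem exists_submodule_of_transvection_closed (hB : B.IsAlt) {A : Submodule K N}
    (hA : IsLagrangian B A) (D : Set N) (hAD : (A : Set N) ⊆ D)
    (hsmul : ∀ (k : K), ∀ d ∈ D, k • d ∈ D)
    (htr : ∀ d ∈ D, ∀ d' ∈ D, ∀ c, transvection hB d c d' ∈ D) :
    ∃ D' : Submodule K N, (D' : Set N) = D := by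
  -- The transvection along `y`, scaled by `(B x y)⁻¹`, adds `y` to `x`. Orthogonal pairs need a
  -- detour through a vector of `A`, which exists because `A` is its own complement.
  have hadd0 : ∀ x ∈ D, ∀ y ∈ D, B x y ≠ 0 → x + y ∈ D := by
    intro x hx y hy h
    have := htr y hy x hx (B x y)⁻¹
    rwa [transvection_apply, inv_mul_cancel₀ h, one_smul] at this
  have hex : ∀ x ∉ A, ∃ a ∈ A, B x a ≠ 0 := by
    intro x hx
    by_contra! hcon
    exact hx ((hA x).2 fun a ha => by rw [← neg_swap hB, hcon a ha, neg_zero])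
  have hadd1 : ∀ x ∈ D, x ∉ A → ∀ a ∈ A, x + a ∈ D := by
    intro x hx hxA a ha
    by_cases h : B x a = 0
    · obtain ⟨b, hb, hxb⟩ := hex x hxA
      have h1 := hadd0 x hx b (hAD hb) hxb
      have h2 := hadd0 _ h1 (a - b) (hAD (sub_mem ha hb)) (by
        simp only [map_add, map_sub, LinearMap.add_apply, h, (hA a).1 ha b hb, hB b]
        simpa using hxb)
      convert h2 using 1; abel
    · exact hadd0 x hx a (hAD ha) h
  have hadd2 : ∀ x ∈ D, x ∉ A → ∀ y ∈ D, x + y ∈ D := by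
    intro x hx hxA y hy
    by_cases hyA : y ∈ A
    · exact hadd1 x hx hxA y hyA
    by_cases h : B x y = 0
    -- Replacing `x` by `x + a` destroys the orthogonality to `y`; afterwards `a` is subtracted
    -- again.
    · obtain ⟨a, ha, hya⟩ := hex y hyA
      have h1 := hadd0 _ (hadd1 x hx hxA a ha) y hy (by
        simp only [map_add, LinearMap.add_apply, h, zero_add, ← neg_swap hB y a]
        simpa using hya)
      by_cases h2 : x + a + y ∈ A
      · apply hAD
        have := sub_mem h2 ha
        rwa [show x + a + y - a = x + y by abel] at this
      · have := hadd1 _ h1 h2 (-a) (neg_mem ha)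
        convert this using 1; abel
    · exact hadd0 x hx y hy h
  refine ⟨⟨⟨⟨D, ?_⟩, hAD A.zero_mem⟩, fun k x hx => hsmul k x hx⟩, rfl⟩
  intro x y hx hy
  by_cases hxA : x ∈ A
  · by_cases hyA : y ∈ A
    · exact hAD (add_mem hxA hyA)
    · rw [add_comm]; exact hadd2 y hy hyA x hx
  · exact hadd2 x hx hxA y hy

/-- The unipotent radical of the stabilizer of `A`. -/
def unipotentRadical (B : LinearMap.BilinForm K N) (A : Submodule K N) :
    Subgroup (isometryGroup B) where
  carrier := {g | (∀ x, g.1 x - x ∈ A) ∧ ∀ x ∈ A, g.1 x = x}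
  mul_mem' {g h} hg hh := by
    refine ⟨fun x => ?_, fun x hx => ?_⟩
    · have := add_mem (hg.1 (h.1 x)) (hh.1 x)
      simpa [LinearEquiv.mul_apply] using this
    · simp [LinearEquiv.mul_apply, hh.2 x hx, hg.2 x hx]
  one_mem' := by simp
  inv_mem' {g} hg := by
    have h0 : ∀ x, g.1 (g.1⁻¹ x) = x := fun x => by simp
    have h2 : ∀ x ∈ A, g.1⁻¹ x = x := by
      intro x hx
      apply g.1.injective
      rw [h0, hg.2 x hx]
    refine ⟨fun x => ?_, h2⟩
    have h1 := hg.1 (g.1⁻¹ x)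
    rw [h0] at h1
    have := neg_mem h1
    simpa using this

theorem transvection_mem_unipotentRadical (hB : B.IsAlt) {A : Submodule K N}
    (hA : IsLagrangian B A) {a : N} (ha : a ∈ A) (c : K) :
    (⟨transvection hB a c, transvection_mem hB a c⟩ : isometryGroup B) ∈ unipotentRadical B A := by
  refine ⟨fun x => ?_, fun x hx => transvection_apply_of_ortho hB c ((hA a).1 ha x hx)⟩
  simp only [transvection_apply, add_sub_cancel_left]
  exact A.smul_mem _ ha

/-- Elements of the radical satisfy `(g - 1)² = 0`, hence `g ^ n = 1 + n (g - 1)`, which is trivial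
for `n = p`. -/
theorem isPGroup_unipotentRadical (p : ℕ) [CharP K p] (B : LinearMap.BilinForm K N)
    (A : Submodule K N) : IsPGroup p (unipotentRadical B A) := by
  intro g
  refine ⟨1, ?_⟩
  have key : ∀ (n : ℕ) (x : N), (g.1.1 ^ n) x = x + (n : K) • (g.1.1 x - x) := by
    intro n
    induction n with
    | zero => simp
    | succ n ih =>
      intro x
      have h1 := g.2.2 _ (g.2.1 x)
      rw [pow_succ', LinearEquiv.mul_apply, ih, map_add, map_smul, h1]
      push_cast
      rw [add_smul, one_smul]; abel
  ext x
  have := key p x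
  simpa using this

end Lagrangian

/-! ### The standard symplectic space and the classification of alternating forms -/

section Standard

variable (K : Type*) [Field K] (m : ℕ)

/-- The underlying space of the standard symplectic space of dimension `2m`. -/
abbrev Std : Type _ := (Fin m → K) × (Fin m → K)

/-- The standard symplectic form. -/
def stdForm : LinearMap.BilinForm K (Std K m) :=
  LinearMap.mk₂ K (fun x y => x.1 ⬝ᵥ y.2 - x.2 ⬝ᵥ y.1)
    (fun x x' y => by simp [add_dotProduct]; ring)
    (fun k x y => by simp [smul_dotProduct]; ring)
    (fun x y y' => by simp [dotProduct_add]; ring)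
    (fun k x y => by simp [dotProduct_smul]; ring)

variable {K m}

theorem stdForm_apply (x y : Std K m) : stdForm K m x y = x.1 ⬝ᵥ y.2 - x.2 ⬝ᵥ y.1 := rfl

theorem stdForm_isAlt : (stdForm K m).IsAlt := fun x => by
  simp [stdForm_apply, dotProduct_comm x.1 x.2]

theorem eq_zero_of_stdForm_eq_zero {x : Std K m} (h : ∀ y, stdForm K m x y = 0) : x = 0 := by
  ext i
  · have := h (0, Pi.single i 1)
    simpa [stdForm_apply] using this
  · have := h (Pi.single i 1, 0)
    simpa [stdForm_apply] using this

theorem nondegenerate_of_isAlt {N : Type*} [AddCommGroup N] [Module K N]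
    {B : LinearMap.BilinForm K N} (hB : B.IsAlt) (h : ∀ x, (∀ y, B x y = 0) → x = 0) :
    B.Nondegenerate :=
  ⟨h, fun y hy => h y fun x => by rw [← neg_swap hB, hy x, neg_zero]⟩

theorem stdForm_nondegenerate : (stdForm K m).Nondegenerate :=
  nondegenerate_of_isAlt stdForm_isAlt fun _ => eq_zero_of_stdForm_eq_zero

/-- The Lagrangian subspace given by the first coordinates. -/
def stdLagrangian (K : Type*) [Field K] (m : ℕ) : Submodule K (Std K m) :=
  LinearMap.ker (LinearMap.snd K (Fin m → K) (Fin m → K))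

theorem mem_stdLagrangian {x : Std K m} : x ∈ stdLagrangian K m ↔ x.2 = 0 := Iff.rfl

theorem isLagrangian_stdLagrangian : IsLagrangian (stdForm K m) (stdLagrangian K m) := by
  intro x
  rw [mem_stdLagrangian]
  constructor
  · intro hx a ha
    rw [mem_stdLagrangian] at ha
    simp [stdForm_apply, hx, ha]
  · intro h
    ext i
    have := h (Pi.single i 1, 0) rfl
    simpa [stdForm_apply] using this

/-- A hyperbolic plane `⟨x, y⟩` splits off, and the induction continues in its orthogonal
complement. The rank is part of the conclusion, so that even dimension need not be known in advance.
-/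
theorem exists_std_isometry (n : ℕ) : ∀ (N : Type*) [AddCommGroup N] [Module K N]
    [FiniteDimensional K N] (B : LinearMap.BilinForm K N), B.IsAlt →
    (∀ x, (∀ y, B x y = 0) → x = 0) → Module.finrank K N = n →
    ∃ m, ∃ e : Std K m ≃ₗ[K] N, ∀ x y, B (e x) (e y) = stdForm K m x y := by
  induction n using Nat.strong_induction_on with
  | _ n ih =>
  intro N _ _ _ B hB hN hn
  by_cases h0 : ∀ x : N, x = 0
  · have : Subsingleton N := ⟨fun a b => (h0 a).trans (h0 b).symm⟩
    exact ⟨0, 0, fun x y => by simp [stdForm_apply]⟩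
  push Not at h0
  obtain ⟨x, hx⟩ := h0
  obtain ⟨y, hxy⟩ : ∃ y, B x y = 1 := by
    by_contra! hcon
    apply hx
    apply hN
    intro y
    by_contra hy
    exact hcon ((B x y)⁻¹ • y) (by simp [hy])
  have hyx : B y x = -1 := by rw [← neg_swap hB, hxy]
  let W : Submodule K N := LinearMap.ker (B x) ⊓ LinearMap.ker (B y)
  have hW : ∀ w ∈ W, B x w = 0 ∧ B y w = 0 ∧ B w x = 0 ∧ B w y = 0 := by
    intro w hw
    have h1 : B x w = 0 := hw.1
    have h2 : B y w = 0 := hw.2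
    exact ⟨h1, h2, by rw [← neg_swap hB, h1, neg_zero], by rw [← neg_swap hB, h2, neg_zero]⟩
  have hdec : ∀ z : N, z - B z y • x + B z x • y ∈ W := by
    intro z
    have e1 := neg_swap hB z x
    have e2 := neg_swap hB z y
    refine ⟨?_, ?_⟩
    · change B x (z - B z y • x + B z x • y) = 0
      simp only [map_add, map_sub, map_smul, smul_eq_mul, hB x, hxy]
      linear_combination -e1
    · change B y (z - B z y • x + B z x • y) = 0
      simp only [map_add, map_sub, map_smul, smul_eq_mul, hB y, hyx]
      linear_combination -e2
  have hlt : W < ⊤ := by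
    refine lt_top_iff_ne_top.2 fun h => ?_
    have : y ∈ W := h ▸ Submodule.mem_top
    have h1 := (hW y this).1
    rw [hxy] at h1
    exact one_ne_zero h1
  obtain ⟨m, e, he⟩ := ih (Module.finrank K W) (hn ▸ Submodule.finrank_lt hlt.ne) W
    (B.restrict W) (fun w => hB w) (by
      intro w hw
      apply Subtype.ext
      apply hN
      intro z
      have h1 := hw ⟨_, hdec z⟩
      obtain ⟨h2, h3, h4, h5⟩ := hW w w.2
      change B w (z - B z y • x + B z x • y) = 0 at h1
      simpa [h4, h5] using h1) rfl
  let F : Std K (m + 1) →ₗ[K] N :=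
    { toFun := fun u => u.1 0 • x + u.2 0 • y + (e (Fin.tail u.1, Fin.tail u.2) : N)
      map_add' := by
        intro u v
        have : ((Fin.tail (u + v).1, Fin.tail (u + v).2) : Std K m) =
          (Fin.tail u.1, Fin.tail u.2) + (Fin.tail v.1, Fin.tail v.2) := rfl
        rw [this, map_add]
        simp [add_smul]; abel
      map_smul' := by
        intro k u
        have : ((Fin.tail (k • u).1, Fin.tail (k • u).2) : Std K m) =
          k • (Fin.tail u.1, Fin.tail u.2) := rfl
        rw [this, map_smul]
        simp [smul_smul] }
  have hF : ∀ u v, B (F u) (F v) = stdForm K (m + 1) u v := by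
    intro u v
    obtain ⟨h2, h3, h4, h5⟩ := hW _ (e (Fin.tail u.1, Fin.tail u.2)).2
    obtain ⟨h2', h3', h4', h5'⟩ := hW _ (e (Fin.tail v.1, Fin.tail v.2)).2
    have h6 := he (Fin.tail u.1, Fin.tail u.2) (Fin.tail v.1, Fin.tail v.2)
    simp only [LinearMap.BilinForm.restrict_apply, LinearMap.domRestrict_apply] at h6
    simp only [F, LinearMap.coe_mk, AddHom.coe_mk, map_add, map_smul, LinearMap.add_apply,
      LinearMap.smul_apply, smul_eq_mul, hB x, hB y, hxy, hyx, h2', h3', h4, h5, h6,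
      stdForm_apply, dotProduct, Fin.sum_univ_succ, Fin.tail]
    ring
  refine ⟨m + 1, LinearEquiv.ofBijective F ⟨?_, ?_⟩, hF⟩
  · rw [injective_iff_map_eq_zero]
    intro u hu
    apply eq_zero_of_stdForm_eq_zero
    intro v
    rw [← hF, hu]; simp
  · intro z
    let w := e.symm ⟨_, hdec z⟩
    refine ⟨(Fin.cons (B z y) w.1, Fin.cons (-B z x) w.2), ?_⟩
    have : e (w.1, w.2) = ⟨_, hdec z⟩ := e.apply_symm_apply _
    simp only [F, LinearMap.coe_mk, AddHom.coe_mk, Fin.tail_cons, Fin.cons_zero, this]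
    rw [neg_smul]; abel

theorem finrank_std : Module.finrank K (Std K m) = 2 * m := by
  simp [two_mul]

end Standard

end SymplecticSpace

namespace SymplecticSpace

/-! ### Subgroups of symplectic groups of index prime to the characteristic -/

section Transvec

variable {K N : Type*} [Field K] [AddCommGroup N] [Module K N] {B : LinearMap.BilinForm K N}
  (hB : B.IsAlt)

/-- Transvections as elements of the isometry group. -/
def transvec (hB : B.IsAlt) (d : N) (c : K) : isometryGroup B :=
  ⟨transvection hB d c, transvection_mem hB d c⟩

theorem transvec_apply (d : N) (c : K) (x : N) :
    (transvec hB d c).1 x = x + (c * B x d) • d := rfl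

theorem conj_transvec (g : isometryGroup B) (d : N) (c : K) :
    g * transvec hB d c * g⁻¹ = transvec hB (g.1 d) c :=
  Subtype.ext (conj_transvection hB g.2 d c)

/-- Nonorthogonal vectors are joined by one transvection, and any two nonzero vectors have a common
vector orthogonal to neither, since a space is not the union of two proper subspaces. -/
theorem exists_isometry_map_eq (hN : ∀ x, (∀ y, B x y = 0) → x = 0) {x y : N} (hx : x ≠ 0)
    (hB : B.IsAlt) (hy : y ≠ 0) : ∃ g : isometryGroup B, g.1 x = y := by
  have key : ∀ u w : N, B u w ≠ 0 → ∃ g : isometryGroup B, g.1 u = w := by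
    intro u w h
    obtain ⟨c, hc⟩ := exists_transvection_map hB h
    exact ⟨transvec hB _ c, hc⟩
  suffices ∃ w, B x w ≠ 0 ∧ B w y ≠ 0 by
    obtain ⟨w, h1, h2⟩ := this
    obtain ⟨g, hg⟩ := key x w h1
    obtain ⟨g', hg'⟩ := key w y h2
    exact ⟨g' * g, by simp [LinearEquiv.mul_apply, hg, hg']⟩
  have hex : ∀ x : N, x ≠ 0 → ∃ w, B x w ≠ 0 := by
    intro x hx
    by_contra! hcon
    exact hx (hN x hcon)
  have hsw : ∀ u w, B u w ≠ 0 → B w u ≠ 0 := by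
    intro u w h
    rw [← neg_swap hB u w]
    exact neg_ne_zero.2 h
  obtain ⟨u, hu⟩ := hex x hx
  obtain ⟨v, hv⟩ := hex y hy
  by_cases h1 : B y u = 0
  · by_cases h2 : B x v = 0
    · exact ⟨u + v, by simpa [h2] using hu, hsw _ _ (by simpa [h1] using hv)⟩
    · exact ⟨v, h2, hsw _ _ hv⟩
  · exact ⟨u, hu, hsw _ _ h1⟩

theorem exists_ortho_and_not_ortho [FiniteDimensional K N] (hN : B.Nondegenerate) (hB : B.IsAlt)
    {W : Submodule K N} {y : N} (hy : y ∉ W) : ∃ d, (∀ x ∈ W, B x d = 0) ∧ B y d ≠ 0 := by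
  by_contra! hcon
  apply hy
  rw [← LinearMap.BilinForm.orthogonal_orthogonal hN hB.isRefl W]
  intro d hd
  change B d y = 0
  rw [← neg_swap hB, hcon d (fun x hx => hd x hx), neg_zero]

/-- A subgroup of index prime to the characteristic in a finite symplectic group defines the
subspace of all vectors whose transvections belong to the subgroup. It contains a Lagrangian
subspace. -/
theorem exists_transvection_subspace (p : ℕ) [Fact p.Prime] [CharP K p] [Finite N]
    {A : Submodule K N} (hA : IsLagrangian B A) (Q : Subgroup (isometryGroup B))
    (hQ : ¬ p ∣ Q.index) :
    ∃ D : Submodule K N, (∀ d, d ∈ D ↔ ∀ c, transvec hB d c ∈ Q) ∧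
      ∃ g : isometryGroup B, ∀ a ∈ A, g.1 a ∈ D := by
  have : Finite (N ≃ₗ[K] N) := DFunLike.finite _
  -- A `p`-group acting on a number of cosets prime to `p` fixes one of them, say `γQ`. Thus `Q`
  -- contains the unipotent radical of `γ⁻¹A`.
  obtain ⟨x, hx⟩ := (isPGroup_unipotentRadical p B A).nonempty_fixed_point_of_prime_not_dvd_card
    (isometryGroup B ⧸ Q) hQ
  obtain ⟨γ, rfl⟩ := QuotientGroup.mk_surjective x
  have hfix : ∀ a ∈ A, ∀ c, transvec hB ((γ⁻¹).1 a) c ∈ Q := by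
    intro a ha c
    have h1 := hx ⟨_, transvection_mem_unipotentRadical hB hA ha c⟩
    have h2 : ((transvec hB a c * γ : isometryGroup B) : isometryGroup B ⧸ Q) = γ := h1
    have h3 := QuotientGroup.eq.1 h2.symm
    have h4 := conj_transvec hB γ⁻¹ a c
    rw [inv_inv] at h4
    rwa [← h4, mul_assoc]
  obtain ⟨D, hD⟩ := exists_submodule_of_transvection_closed hB (hA.map (γ⁻¹).2)
    {d | ∀ c, transvec hB d c ∈ Q} (by
      rintro _ ⟨a, ha, rfl⟩
      exact hfix a ha) (by
      intro k d hd c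
      have : transvec hB (k • d) c = transvec hB d (c * k ^ 2) :=
        Subtype.ext (transvection_smul hB d k c)
      rw [this]
      exact hd _) (by
      intro d hd d' hd' c c'
      have := conj_transvec hB (transvec hB d c) d' c'
      change transvec hB ((transvec hB d c).1 d') c' ∈ Q
      rw [← this]
      exact Q.mul_mem (Q.mul_mem (hd c) (hd' c')) (Q.inv_mem (hd c)))
  have hD' : ∀ d, d ∈ D ↔ ∀ c, transvec hB d c ∈ Q := fun d => by
    rw [← SetLike.mem_coe, hD]; rfl
  exact ⟨D, hD', γ⁻¹, fun a ha => (hD' _).2 (hfix a ha)⟩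

include hB in
theorem eq_top_of_transvec_mem [FiniteDimensional K N] (hN : B.Nondegenerate)
    {Q : Subgroup (isometryGroup B)} (hQ : ∀ d c, transvec hB d c ∈ Q) : Q = ⊤ := by
  rw [eq_top_iff]
  intro g _
  have := mem_of_transvection_mem hB hN (Q.map (isometryGroup B).subtype)
    (fun d c => ⟨transvec hB d c, hQ d c, rfl⟩) g.1 g.2
  obtain ⟨g', hg', he⟩ := this
  rwa [Subtype.ext he] at hg'

/-- A subgroup of index prime to the characteristic in a finite symplectic group is the whole
group, or stabilizes a nonzero totally isotropic subspace: the orthogonal complement of the set of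
all vectors whose transvections belong to the subgroup. -/
theorem exists_isotropic (p : ℕ) [Fact p.Prime] [CharP K p] [Finite N] (hN : B.Nondegenerate)
    {A : Submodule K N} (hA : IsLagrangian B A) (Q : Subgroup (isometryGroup B))
    (hQ : ¬ p ∣ Q.index) :
    ∃ C : Submodule K N, (∀ d, (∀ x ∈ C, B x d = 0) ↔ ∀ c, transvec hB d c ∈ Q) ∧
      (∃ g : isometryGroup B, ∀ x ∈ C, ∃ a ∈ A, x = g.1 a) ∧ (Q = ⊤ ∨ C ≠ ⊥) ∧
      (∀ x ∈ C, ∀ y ∈ C, B x y = 0) ∧ ∀ g ∈ Q, ∀ x ∈ C, g.1 x ∈ C := by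
  have : FiniteDimensional K N := Module.Finite.of_finite
  obtain ⟨D, hD, g, hg⟩ := exists_transvection_subspace hB p hA Q hQ
  have hperp : B.orthogonal (B.orthogonal D) = D :=
    LinearMap.BilinForm.orthogonal_orthogonal hN hB.isRefl D
  -- The complement of a subspace that contains a Lagrangian subspace lies in that Lagrangian
  -- subspace.
  have hCA : ∀ x ∈ B.orthogonal D, ∃ a ∈ A, x = g.1 a := by
    intro x hx
    have : x ∈ A.map (g.1 : N →ₗ[K] N) := by
      rw [hA.map g.2 x]
      rintro _ ⟨a, ha, rfl⟩
      exact hx _ (hg a ha)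
    obtain ⟨a, ha, rfl⟩ := this
    exact ⟨a, ha, rfl⟩
  refine ⟨B.orthogonal D, fun d => ?_, ⟨g, hCA⟩, ?_, ?_, ?_⟩
  · rw [← hD]
    conv_rhs => rw [← hperp]
    exact Iff.rfl
  · by_cases h : B.orthogonal D = ⊥
    · left
      apply eq_top_of_transvec_mem hB hN
      intro d
      rw [← hD, ← hperp, h]
      simp
    · exact Or.inr h
  · intro x hx y hy
    obtain ⟨a, ha, rfl⟩ := hCA x hx
    exact hy _ (hg a ha)
  · intro h hh x hx d hd
    have h1 : (h⁻¹).1 d ∈ D := by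
      rw [hD]
      intro c
      rw [← conj_transvec]
      exact Q.mul_mem (Q.mul_mem (Q.inv_mem hh) ((hD d).1 hd c)) (Q.inv_mem (Q.inv_mem hh))
    have h2 := hx _ h1
    rw [← h.2] at h2
    rw [← h2]
    simp

end Transvec

/-! ### Transitive linear actions of the symplectic group -/

section Action

variable {p m : ℕ} [Fact p.Prime]

/-- The standard symplectic group over the prime field. -/
abbrev StdGroup (p m : ℕ) [Fact p.Prime] : Subgroup (Std (ZMod p) m ≃ₗ[ZMod p] Std (ZMod p) m) :=
  isometryGroup (stdForm (ZMod p) m)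

variable {M : Type*} [AddCommGroup M] [Module (ZMod p) M]

/-- The stabilizer of a vector with respect to a linear action. -/
def vectorStabilizer {Γ : Type*} [Group Γ] (f : Γ →* (M ≃ₗ[ZMod p] M)) (v : M) : Subgroup Γ where
  carrier := {g | f g v = v}
  mul_mem' {g h} hg hh := by
    change f (g * h) v = v
    rw [map_mul, LinearEquiv.mul_apply, hh, hg]
  one_mem' := by change f 1 v = v; simp
  inv_mem' {g} hg := by
    change f g⁻¹ v = v
    conv_lhs => rw [← show f g v = v from hg]
    rw [← LinearEquiv.mul_apply, ← map_mul]; simp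

theorem index_vectorStabilizer {Γ : Type*} [Group Γ] [Finite M] (f : Γ →* (M ≃ₗ[ZMod p] M))
    (htr : ∀ x y : M, x ≠ 0 → y ≠ 0 → ∃ g, f g x = y) {v : M} (hv : v ≠ 0) :
    (vectorStabilizer f v).index = Nat.card M - 1 := by
  let _ : MulAction Γ M := MulAction.compHom M f
  have h0 : vectorStabilizer f v = MulAction.stabilizer Γ v := rfl
  rw [h0, MulAction.index_stabilizer]
  have : MulAction.orbit Γ v = {0}ᶜ := by
    ext x
    simp only [Set.mem_compl_iff, Set.mem_singleton_iff]
    constructor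
    · rintro ⟨g, rfl⟩ h
      exact hv ((f g).map_eq_zero_iff.1 h)
    · intro hx
      obtain ⟨g, hg⟩ := htr v x hv hx
      exact ⟨g, hg⟩
  rw [this, Set.ncard_compl, Set.ncard_singleton]

/-- The index is the number `p^(2m) - 1` of nonzero vectors. This makes `exists_isotropic`
applicable to vector stabilizers without any knowledge of the action. -/
theorem not_dvd_index_vectorStabilizer {Γ : Type*} [Group Γ] (hm : 0 < m)
    (hM : Nat.card M = p ^ (2 * m)) (f : Γ →* (M ≃ₗ[ZMod p] M))
    (htr : ∀ x y : M, x ≠ 0 → y ≠ 0 → ∃ g, f g x = y) {v : M} (hv : v ≠ 0) :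
    ¬ p ∣ (vectorStabilizer f v).index ∧ vectorStabilizer f v ≠ ⊤ := by
  have hp := Fact.out (p := p.Prime)
  have hpos : 0 < p ^ (2 * m) := pow_pos hp.pos _
  have : Finite M := Nat.finite_of_card_ne_zero (by omega)
  have hi := index_vectorStabilizer f htr hv
  rw [hM] at hi
  constructor
  · rw [hi]
    intro h
    have h2 : p ∣ p ^ (2 * m) := dvd_pow_self p (by omega)
    have := (Nat.dvd_sub_iff_right hpos h2).1 h
    exact hp.one_lt.ne' (Nat.dvd_one.1 this)
  · intro h
    rw [h, Subgroup.index_top] at hi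
    have h4 : 2 ^ 2 ≤ p ^ (2 * m) :=
      (Nat.pow_le_pow_left hp.two_le 2).trans (Nat.pow_le_pow_right hp.pos (by omega))
    omega

/-- If `z` moves `u`, then `f z u - u` is a nonzero vector negated by `z`. Everything commutes with
`z`, and so transitivity carries this to all vectors. -/
theorem neg_one_unique {Γ : Type*} [Group Γ] {z : Γ} (hz : ∀ g, g * z = z * g)
    (hz2 : z * z = 1) (f : Γ →* (M ≃ₗ[ZMod p] M))
    (htr : ∀ x y : M, x ≠ 0 → y ≠ 0 → ∃ g, f g x = y) (hfz : f z ≠ 1) (x : M) : f z x = -x := by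
  obtain ⟨u, hu⟩ : ∃ u, f z u ≠ u := by
    by_contra! hcon
    exact hfz (LinearEquiv.ext hcon)
  by_cases hx : x = 0
  · simp [hx]
  obtain ⟨g, rfl⟩ := htr (f z u - u) x (sub_ne_zero.2 hu) hx
  rw [← LinearEquiv.mul_apply, ← map_mul, ← hz, map_mul, LinearEquiv.mul_apply, map_sub,
    ← LinearEquiv.mul_apply, ← map_mul, hz2, ← map_neg]
  simp

/-- A map that fixes all `1`-spaces is a scalar `a`, and preserving a nonzero value of the form
gives `a² = 1`. -/
theorem isometry_eq_one_or_neg {K N : Type*} [Field K] [AddCommGroup N] [Module K N]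
    {B : LinearMap.BilinForm K N} (hN : ∀ x, (∀ y, B x y = 0) → x = 0) (g : isometryGroup B)
    (h : ∀ x, g.1 x ∈ K ∙ x) : g = 1 ∨ ∀ x, g.1 x = -x := by
  obtain ⟨a, ha⟩ := LinearMap.exists_eq_smul_id_of_forall_notLinearIndependent
    (f := (g.1 : N →ₗ[K] N)) (fun v hv => by
      obtain ⟨c, hc⟩ := Submodule.mem_span_singleton.1 (h v)
      rw [LinearIndependent.pair_iff] at hv
      have := (hv (-c) 1 (by simp [hc])).2
      exact one_ne_zero this)
  have ha' : ∀ x, g.1 x = a • x := fun x => by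
    have := LinearMap.congr_fun ha x
    simpa using this
  by_cases h0 : ∀ x : N, x = 0
  · left
    ext x
    exact (h0 _).trans (h0 _).symm
  push Not at h0
  obtain ⟨x, hx⟩ := h0
  obtain ⟨y, hy⟩ : ∃ y, B x y ≠ 0 := by
    by_contra! hcon
    exact hx (hN x hcon)
  have h1 := g.2 x y
  rw [ha', ha'] at h1
  simp only [map_smul, LinearMap.smul_apply, smul_eq_mul] at h1
  have h2 : (a - 1) * (a + 1) = 0 := by
    have : ((a - 1) * (a + 1)) * B x y = 0 := by linear_combination h1
    exact (mul_eq_zero.1 this).resolve_right hy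
  rcases mul_eq_zero.1 h2 with h3 | h3
  · left
    ext x
    simp [ha', sub_eq_zero.1 h3]
  · right
    intro x
    rw [ha', eq_neg_of_add_eq_zero_left h3]; simp

theorem exists_basis_vector (hm : 0 < m) : ∃ v : Std (ZMod p) m, v ≠ 0 := by
  refine ⟨(Pi.single ⟨0, hm⟩ 1, 0), fun h => ?_⟩
  have := congrFun (congrArg Prod.fst h) ⟨0, hm⟩
  simp at this

theorem natCard_std : Nat.card (Std (ZMod p) m) = p ^ (2 * m) := by
  simp [two_mul, pow_add]

/-- The kernel of a transitive action of the symplectic group is contained in `{1, -1}`. -/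
theorem ker_eq_one_or_neg (hm : 0 < m) (f : StdGroup p m →* StdGroup p m)
    (htr : ∀ x y : Std (ZMod p) m, x ≠ 0 → y ≠ 0 → ∃ g, (f g).1 x = y) (g : StdGroup p m)
    (hg : f g = 1) : g = 1 ∨ ∀ x, g.1 x = -x := by
  have hB := stdForm_isAlt (K := ZMod p) (m := m)
  obtain ⟨v, hv⟩ := exists_basis_vector (p := p) hm
  obtain ⟨hi, hne⟩ := not_dvd_index_vectorStabilizer hm natCard_std
    ((isometryGroup (stdForm (ZMod p) m)).subtype.comp f) htr hv
  obtain ⟨C, -, -, hC, hiso, hst⟩ := exists_isotropic hB p stdForm_nondegenerate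
    isLagrangian_stdLagrangian _ hi
  replace hC := hC.resolve_left hne
  obtain ⟨a, haC, ha0⟩ := C.ne_bot_iff.1 hC
  -- The kernel is normal and contained in the vector stabilizer, so `g` leaves every translate `hC`
  -- invariant.
  have hk : ∀ h : StdGroup p m, ∀ x ∈ C, ∃ y ∈ C, g.1 (h.1 x) = h.1 y := by
    intro h x hx
    refine ⟨(h⁻¹ * g * h).1 x, hst _ ?_ x hx, ?_⟩
    · change ((f (h⁻¹ * g * h)).1) v = v
      simp [map_mul, hg]
    · simp [LinearEquiv.mul_apply]
  apply isometry_eq_one_or_neg (fun x => eq_zero_of_stdForm_eq_zero)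
  intro x
  by_cases hx : x = 0
  · simp [hx]
  by_contra hcon
  obtain ⟨h, rfl⟩ := exists_isometry_map_eq (fun x => eq_zero_of_stdForm_eq_zero) ha0 hB hx
  -- The transvection along `d` fixes `x`, so `g x` lies in `hC` and in its image under that
  -- transvection. Isotropy of `hC` then forces `B(g x, d) = 0`, against the choice of `d`.
  obtain ⟨d, hd1, hd2⟩ := exists_ortho_and_not_ortho stdForm_nondegenerate hB hcon
  have hd3 := hd1 _ (Submodule.mem_span_singleton_self _)
  obtain ⟨y, hyC, hy⟩ := hk h a haC
  obtain ⟨w, hwC, hw⟩ := hk (transvec hB d 1 * h) a haC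
  have e1 : (transvec hB d 1 * h).1 a = h.1 a := by
    simp [LinearEquiv.mul_apply, transvec_apply, hd3]
  have e2 : (transvec hB d 1 * h).1 w = h.1 w + stdForm (ZMod p) m (h.1 w) d • d := by
    simp [LinearEquiv.mul_apply, transvec_apply]
  rw [e1, e2] at hw
  have e3 : stdForm (ZMod p) m (h.1 w) (h.1 y) = 0 := by rw [h.2]; exact hiso w hwC y hyC
  have e4 : stdForm (ZMod p) m (g.1 (h.1 a)) d = stdForm (ZMod p) m (h.1 w) d := by
    rw [hw]; simp [hB d]
  have e5 : stdForm (ZMod p) m (g.1 (h.1 a)) (h.1 y) = 0 := by rw [hy, hB]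
  rw [hw] at e5
  simp only [map_add, LinearMap.add_apply, e3, map_smul, LinearMap.smul_apply, zero_add,
    smul_eq_mul, ← e4] at e5
  rw [hy] at hd2 e5
  have e6 := (mul_eq_zero.1 e5).resolve_left hd2
  rw [← neg_swap hB, e6] at hd2
  simp at hd2

/-- The image of `f` has index `|ker f| ≤ 2`, which is prime to `p`. Being transitive, the image
stabilizes no nonzero isotropic subspace, so it is everything. Hence `f` is injective and `z` acts
nontrivially. -/
theorem map_neg_one_aux (hp : p ≠ 2) (hm : 0 < m) (f : StdGroup p m →* StdGroup p m)
    (htr : ∀ x y : Std (ZMod p) m, x ≠ 0 → y ≠ 0 → ∃ g, (f g).1 x = y) (z : StdGroup p m)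
    (hz : ∀ x, z.1 x = -x) (x : Std (ZMod p) m) : (f z).1 x = -x := by
  have hB := stdForm_isAlt (K := ZMod p) (m := m)
  have hpp := Fact.out (p := p.Prime)
  obtain ⟨v, hv⟩ := exists_basis_vector (p := p) hm
  have : Finite (Std (ZMod p) m ≃ₗ[ZMod p] Std (ZMod p) m) := DFunLike.finite _
  have hz1 : z ≠ 1 := by
    intro h
    have h1 := hz v
    rw [h] at h1
    have h3 : v = -v := h1
    have h2 : (2 : ZMod p) • v = 0 := by
      rw [two_smul]; nth_rewrite 2 [h3]; simp
    rcases smul_eq_zero.1 h2 with h3 | h3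
    · have := (ZMod.natCast_eq_zero_iff 2 p).1 (by exact_mod_cast h3)
      have := Nat.le_of_dvd two_pos this
      have := hpp.two_le
      omega
    · exact hv h3
  have hker : Nat.card f.ker ≤ 2 := by
    have hsub : (f.ker : Set (StdGroup p m)) ⊆ {1, z} := by
      intro g hg
      rcases ker_eq_one_or_neg hm f htr g hg with h | h
      · exact Or.inl h
      · right
        apply Subtype.ext
        ext x : 1
        rw [h, hz]
    calc Nat.card f.ker = (f.ker : Set (StdGroup p m)).ncard := rfl
      _ ≤ ({1, z} : Set (StdGroup p m)).ncard := Set.ncard_le_ncard hsub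
      _ ≤ 2 := (Set.ncard_insert_le _ _).trans (by simp)
  have hidx : f.range.index = Nat.card f.ker := by
    have h1 := f.range.index_mul_card
    have h2 := f.ker.index_mul_card
    rw [Subgroup.index_ker, mul_comm] at h2
    have h3 : 0 < Nat.card f.range := Nat.card_pos
    exact Nat.eq_of_mul_eq_mul_right h3 (h1.trans h2.symm)
  obtain ⟨C, hC1, -, hC, hiso, hst⟩ := exists_isotropic hB p stdForm_nondegenerate
    isLagrangian_stdLagrangian f.range (by
      rw [hidx]
      intro h
      have := Nat.le_of_dvd Nat.card_pos h
      have := hpp.two_le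
      omega)
  have hne : f z ≠ 1 := by
    rcases hC with h | h
    · rw [h, Subgroup.index_top] at hidx
      have h1 := (Subgroup.card_eq_one).1 hidx.symm
      intro h2
      have h3 : z ∈ f.ker := h2
      rw [h1] at h3
      exact hz1 h3
    · exfalso
      -- Transitivity would move `a` out of the isotropic subspace `C`, to a vector not orthogonal
      -- to `a`.
      obtain ⟨a, haC, ha0⟩ := C.ne_bot_iff.1 h
      obtain ⟨y, hy⟩ : ∃ y, stdForm (ZMod p) m a y ≠ 0 := by
        by_contra! hcon
        exact ha0 (eq_zero_of_stdForm_eq_zero hcon)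
      obtain ⟨g, rfl⟩ := htr a y ha0 (by rintro rfl; simp at hy)
      exact hy (hiso _ haC _ (hst _ ⟨g, rfl⟩ _ haC))
  refine neg_one_unique (z := z) (fun g => ?_) ?_
    ((isometryGroup (stdForm (ZMod p) m)).subtype.comp f) htr ?_ x
  · apply Subtype.ext
    ext x : 1
    simp [LinearEquiv.mul_apply, hz]
  · apply Subtype.ext
    ext x : 1
    simp [LinearEquiv.mul_apply, hz]
  · exact fun h => hne (Subtype.ext h)

/-- If a symplectic group over a prime field of odd order acts on a symplectic space of the same
dimension, transitively on the nonzero vectors, then `-1` acts as `-1`. -/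
theorem map_neg_one (hp : p ≠ 2) (hm : 0 < m) (ω : LinearMap.BilinForm (ZMod p) M)
    (e : Std (ZMod p) m ≃ₗ[ZMod p] M) (he : ∀ x y, ω (e x) (e y) = stdForm (ZMod p) m x y)
    (f : StdGroup p m →* (M ≃ₗ[ZMod p] M)) (hf : ∀ g x y, ω (f g x) (f g y) = ω x y)
    (htr : ∀ x y : M, x ≠ 0 → y ≠ 0 → ∃ g, f g x = y) (z : StdGroup p m)
    (hz : ∀ x, z.1 x = -x) (x : M) : f z x = -x := by
  let f' : StdGroup p m →* StdGroup p m :=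
    { toFun := fun g => ⟨e.trans ((f g).trans e.symm), fun x y => by
        rw [← he]; simp [hf, he]⟩
      map_one' := by
        apply Subtype.ext; ext x : 1; simp
      map_mul' := fun g h => by
        apply Subtype.ext; ext x : 1; simp [LinearEquiv.mul_apply] }
  have hf' : ∀ g x, (f' g).1 x = e.symm (f g (e x)) := fun g x => rfl
  have := map_neg_one_aux hp hm f' (fun x y hx hy => by
    obtain ⟨g, hg⟩ := htr (e x) (e y) (by simpa using hx) (by simpa using hy)
    exact ⟨g, by rw [hf', hg]; simp⟩) z hz (e.symm x)
  rw [hf'] at this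
  apply e.symm.injective
  simpa using this

end Action

end SymplecticSpace

namespace SymplecticSpace

/-! ### Transitive actions in characteristic two -/

section CharTwo

variable {m : ℕ}

/-- The isometry `(x, y) ↦ (x, y + Bx)` given by a symmetric matrix. -/
def lowerUnipotent (B : Matrix (Fin m) (Fin m) (ZMod 2)) (hB : B.IsSymm) : StdGroup 2 m :=
  ⟨{ toFun := fun x => (x.1, x.2 + B.mulVec x.1)
     map_add' := fun x y => by
      ext i <;> simp [Matrix.mulVec_add]; abel
     map_smul' := fun k x => by
      ext i <;> simp [Matrix.mulVec_smul]
     invFun := fun x => (x.1, x.2 - B.mulVec x.1)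
     left_inv := fun x => by simp
     right_inv := fun x => by simp }, fun x y => by
      have : x.1 ⬝ᵥ B.mulVec y.1 = B.mulVec x.1 ⬝ᵥ y.1 := by
        rw [Matrix.dotProduct_mulVec, ← Matrix.mulVec_transpose, hB]
      simp only [stdForm_apply, LinearEquiv.coe_mk, LinearMap.coe_mk, AddHom.coe_mk,
        dotProduct_add, add_dotProduct, this]
      ring⟩

theorem lowerUnipotent_apply (B : Matrix (Fin m) (Fin m) (ZMod 2)) (hB : B.IsSymm)
    (x : Std (ZMod 2) m) : (lowerUnipotent B hB).1 x = (x.1, x.2 + B.mulVec x.1) := rfl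

theorem zmod_two_eq_one {c : ZMod 2} (h : c ≠ 0) : c = 1 := by
  revert c; decide

variable {M : Type*} [AddCommGroup M] [Module (ZMod 2) M]

-- Each of the four fibres of `d ↦ (B a d, B b d)` can be translated into the fibre over `(0, 1)`,
-- which is nonempty because `b ∉ ⟨a⟩`.
open Classical in
theorem four_pow_le_card_filter {a b : Std (ZMod 2) m} (hb : b ≠ 0) (hab : b ≠ a) :
    4 ^ m ≤ (Finset.univ.filter fun d : Std (ZMod 2) m =>
      stdForm (ZMod 2) m a d = 0 ∧ stdForm (ZMod 2) m b d = 1).card * 4 := by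
  have hB := stdForm_isAlt (K := ZMod 2) (m := m)
  obtain ⟨d0, h1, h2⟩ := exists_ortho_and_not_ortho stdForm_nondegenerate hB
    (W := Submodule.span (ZMod 2) {a}) (y := b) (by
      intro h
      obtain ⟨c, rfl⟩ := Submodule.mem_span_singleton.1 h
      by_cases hc : c = 0
      · simp [hc] at hb
      · simp [zmod_two_eq_one hc] at hab)
  replace h1 := h1 a (Submodule.mem_span_singleton_self a)
  replace h2 := zmod_two_eq_one h2
  have := Finset.card_le_mul_card_image_of_maps_to (s := (Finset.univ : Finset (Std (ZMod 2) m)))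
    (t := (Finset.univ : Finset (ZMod 2 × ZMod 2)))
    (f := fun d => (stdForm (ZMod 2) m a d, stdForm (ZMod 2) m b d)) (fun _ _ => Finset.mem_univ _)
    (Finset.univ.filter fun d : Std (ZMod 2) m =>
      stdForm (ZMod 2) m a d = 0 ∧ stdForm (ZMod 2) m b d = 1).card (by
      intro y _
      by_cases hy : ∃ u, (stdForm (ZMod 2) m a u, stdForm (ZMod 2) m b u) = y
      · obtain ⟨u, rfl⟩ := hy
        refine Finset.card_le_card_of_injOn (fun x => x - u + d0) ?_ ?_
        · intro x hx
          have hx' : (stdForm (ZMod 2) m a x, stdForm (ZMod 2) m b x) =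
            (stdForm (ZMod 2) m a u, stdForm (ZMod 2) m b u) := by simpa using hx
          rw [Prod.mk.injEq] at hx'
          simp [hx'.1, hx'.2, h1, h2]
        · intro x _ y _ h
          simpa using h
      · push Not at hy
        rw [Finset.filter_false_of_mem (fun x _ => hy x)]
        simp)
  have hc : (Finset.univ : Finset (Std (ZMod 2) m)).card = 4 ^ m := by
    rw [Finset.card_univ, ← Nat.card_eq_fintype_card, natCard_std, pow_mul]; rfl
  rw [hc] at this
  simpa using this

/-- The number of symmetric matrices is `2^(m(m+1)/2)`, and `m(m+1)/2 ≥ 2m` requires `m ≥ 3`. -/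
theorem four_pow_le_card_isSymm (hm : 3 ≤ m) :
    4 ^ m ≤ Nat.card {B : Matrix (Fin m) (Fin m) (ZMod 2) // B.IsSymm} := by
  let F : (Sym2 (Fin m) → ZMod 2) → {B : Matrix (Fin m) (Fin m) (ZMod 2) // B.IsSymm} :=
    fun s => ⟨Matrix.of fun i j => s s(i, j), by ext i j; simp [Sym2.eq_swap]⟩
  have hF : Function.Injective F := by
    intro s t h
    ext x
    induction x with
    | _ i j => exact congrFun (congrFun (congrArg Subtype.val h) i) j
  have h1 := Nat.card_le_card_of_injective F hF
  refine le_trans ?_ h1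
  rw [Nat.card_eq_fintype_card, Fintype.card_fun, Sym2.card, ZMod.card, Fintype.card_fin,
    show 4 ^ m = 2 ^ (2 * m) by rw [pow_mul]; rfl]
  apply Nat.pow_le_pow_right two_pos
  rw [Nat.choose_two_right, Nat.le_div_iff_mul_le two_pos]
  simp only [Nat.add_sub_cancel]
  nlinarith

/-- A transitive linear action of `Sp(2m, 2)`, `m ≥ 3`, of dimension `2m` is equivalent to the
standard one. -/
theorem exists_equivariant_equiv (hm : 3 ≤ m) (hM : Nat.card M = 2 ^ (2 * m))
    (f : StdGroup 2 m →* (M ≃ₗ[ZMod 2] M))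
    (htr : ∀ x y : M, x ≠ 0 → y ≠ 0 → ∃ g, f g x = y) :
    ∃ α : M ≃ₗ[ZMod 2] Std (ZMod 2) m, ∀ g x, α (f g x) = g.1 (α x) := by
  classical
  have hB := stdForm_isAlt (K := ZMod 2) (m := m)
  have hN := stdForm_nondegenerate (K := ZMod 2) (m := m)
  have hfinM : Finite M := Nat.finite_of_card_ne_zero (by rw [hM]; positivity)
  have : Fintype M := Fintype.ofFinite M
  -- Each `v ≠ 0` is assigned the isotropic subspace `C v` of its stabilizer. The aim is to show
  -- that `C v` has dimension one, so that its nonzero vector is the image of `v`. The value `⊥` at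
  -- `v = 0` is a dummy.
  have hex : ∀ v : M, ∃ C : Submodule (ZMod 2) (Std (ZMod 2) m), v ≠ 0 →
      (∀ d, (∀ x ∈ C, stdForm (ZMod 2) m x d = 0) ↔ f (transvec hB d 1) v = v) ∧
      (∃ g : StdGroup 2 m, ∀ x ∈ C, ∃ a ∈ stdLagrangian (ZMod 2) m, x = g.1 a) ∧ C ≠ ⊥ := by
    intro v
    by_cases hv : v = 0
    · exact ⟨⊥, fun h => absurd hv h⟩
    obtain ⟨hi, hne⟩ := not_dvd_index_vectorStabilizer (by omega) hM f htr hv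
    obtain ⟨C, h1, h2, h3, -, -⟩ := exists_isotropic hB 2 hN isLagrangian_stdLagrangian _ hi
    refine ⟨C, fun _ => ⟨fun d => (h1 d).trans ⟨fun h => h 1, fun h c => ?_⟩, h2,
      h3.resolve_left hne⟩⟩
    by_cases hc : c = 0
    · have : transvec hB d c = 1 := by
        apply Subtype.ext; ext x : 1; simp [transvec_apply, hc]
      rw [this]; exact Subgroup.one_mem _
    · rw [zmod_two_eq_one hc]; exact h
  choose C hC using hex
  have memC : ∀ v ≠ 0, ∀ x, x ∈ C v ↔
      ∀ d, f (transvec hB d 1) v = v → stdForm (ZMod 2) m x d = 0 := by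
    intro v hv x
    constructor
    · intro hx d hd
      exact ((hC v hv).1 d).2 hd x hx
    · intro h
      by_contra hcon
      obtain ⟨d, hd1, hd2⟩ := exists_ortho_and_not_ortho hN hB hcon
      exact hd2 (h d (((hC v hv).1 d).1 hd1))
  have fne : ∀ g, ∀ v : M, v ≠ 0 → f g v ≠ 0 := fun g v hv h => hv ((f g).map_eq_zero_iff.1 h)
  have equiC : ∀ g, ∀ v ≠ 0, ∀ x ∈ C v, g.1 x ∈ C (f g v) := by
    intro g v hv x hx
    rw [memC _ (fne g v hv)]
    intro d hd
    have h1 : f (transvec hB ((g⁻¹).1 d) 1) v = v := by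
      rw [← conj_transvec, inv_inv, map_mul, map_mul, LinearEquiv.mul_apply, LinearEquiv.mul_apply,
        hd, ← LinearEquiv.mul_apply, ← map_mul]
      simp
    have h2 := (memC v hv x).1 hx _ h1
    rw [← g.2] at h2
    simpa using h2
  have cardle : ∀ v ≠ 0, ∀ w ≠ 0, Nat.card (C v) ≤ Nat.card (C w) := by
    intro v hv w hw
    obtain ⟨g, rfl⟩ := htr v w hv hw
    exact Nat.card_le_card_of_injective
      (fun x : C v => (⟨g.1 x, equiC g v hv x x.2⟩ : C (f g v))) (fun x y h => by
        have := congrArg Subtype.val h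
        exact Subtype.ext (g.1.injective this))
  have hcardM : 1 < Nat.card M := by
    rw [hM]; exact Nat.one_lt_two_pow (by omega)
  obtain ⟨v1, hv1⟩ : ∃ v : M, v ≠ 0 := by
    have := Finite.one_lt_card_iff_nontrivial.1 hcardM
    exact exists_ne 0
  obtain ⟨q, hq⟩ : ∃ q, ∀ v ≠ 0, Nat.card (C v) = q :=
    ⟨Nat.card (C v1), fun v hv => le_antisymm (cardle v hv v1 hv1) (cardle v1 hv1 v hv)⟩
  obtain ⟨k, hk⟩ : ∃ k, q = 2 ^ k := by
    refine ⟨Module.finrank (ZMod 2) (C v1), ?_⟩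
    rw [← hq v1 hv1, Module.natCard_eq_pow_finrank (K := ZMod 2), Nat.card_zmod]
  have hfcard : ∀ v ≠ 0, (Finset.univ.filter (· ∈ C v)).card = q := by
    intro v hv
    rw [← hq v hv, Nat.card_eq_fintype_card, Fintype.card_subtype]
  have hcardA : Nat.card (stdLagrangian (ZMod 2) m) = 2 ^ m := by
    let e : stdLagrangian (ZMod 2) m ≃ (Fin m → ZMod 2) :=
      { toFun := fun x => x.1.1
        invFun := fun y => ⟨(y, 0), rfl⟩
        left_inv := fun x => Subtype.ext (Prod.ext rfl x.2.symm)
        right_inv := fun y => rfl }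
    rw [Nat.card_congr e]
    simp
  obtain ⟨g1, hg1⟩ := (hC v1 hv1).2.1
  let v0 := f g1⁻¹ v1
  have hv0 : v0 ≠ 0 := fne _ _ hv1
  have hCv0 : C v0 ≤ stdLagrangian (ZMod 2) m := by
    intro x hx
    have h1 := equiC g1 v0 hv0 x hx
    have h2 : f g1 v0 = v1 := by
      simp only [v0]
      rw [← LinearEquiv.mul_apply, ← map_mul]; simp
    rw [h2] at h1
    obtain ⟨a, ha, he⟩ := hg1 _ h1
    rwa [g1.1.injective he]
  have hkm : k ≤ m := by
    have := Submodule.finrank_mono hCv0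
    have h1 := hq v0 hv0
    rw [Module.natCard_eq_pow_finrank (K := ZMod 2), Nat.card_zmod] at h1 hcardA
    rw [Nat.pow_right_injective le_rfl hcardA, Nat.pow_right_injective le_rfl (h1.trans hk)] at this
    exact this
  have hq2 : 2 ≤ q := by
    rw [← hq v1 hv1]
    have := (Submodule.nontrivial_iff_ne_bot).2 (hC v1 hv1).2.2
    exact Finite.one_lt_card
  -- the dimension is less than `m`
  have hkm' : k ≠ m := by
    intro hkm
    have hCA : C v0 = stdLagrangian (ZMod 2) m := by
      apply SetLike.coe_injective
      apply Set.eq_of_subset_of_ncard_le hCv0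
      change Nat.card (stdLagrangian (ZMod 2) m) ≤ Nat.card (C v0)
      rw [hcardA, hq v0 hv0, hk, hkm]
    -- If `C v0` were Lagrangian, the graphs of the symmetric matrices would be different spaces `C
    -- v`, and together with `0` there would be more than `4 ^ m` vectors in `M`.
    let F : Option {B : Matrix (Fin m) (Fin m) (ZMod 2) // B.IsSymm} → M := fun o =>
      o.elim 0 fun B => f (lowerUnipotent B.1 B.2) v0
    have hF : Function.Injective F := by
      rintro (_ | B) (_ | B') h
      · rfl
      · exact absurd h.symm (fne _ _ hv0)
      · exact absurd h (fne _ _ hv0)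
      · congr 1
        apply Subtype.ext
        have h' : f (lowerUnipotent B.1 B.2) v0 = f (lowerUnipotent B'.1 B'.2) v0 := h
        have h2 : f ((lowerUnipotent B'.1 B'.2)⁻¹ * lowerUnipotent B.1 B.2) v0 = v0 := by
          rw [map_mul, LinearEquiv.mul_apply, h', ← LinearEquiv.mul_apply, ← map_mul]
          simp
        have h3 : ∀ x, B.1.mulVec x = B'.1.mulVec x := by
          intro x
          have h4 := equiC ((lowerUnipotent B'.1 B'.2)⁻¹ * lowerUnipotent B.1 B.2) v0 hv0 (x, 0)
            (by rw [hCA]; rfl)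
          rw [h2, hCA] at h4
          obtain ⟨y, hy, he⟩ : ∃ y ∈ stdLagrangian (ZMod 2) m,
              (lowerUnipotent B.1 B.2).1 (x, 0) = (lowerUnipotent B'.1 B'.2).1 y := by
            refine ⟨_, h4, ?_⟩
            rw [← LinearEquiv.mul_apply, ← Subgroup.coe_mul, mul_inv_cancel_left]
          rw [lowerUnipotent_apply, lowerUnipotent_apply, mem_stdLagrangian.1 hy,
            Prod.mk.injEq] at he
          simpa [← he.1] using he.2
        exact Matrix.mulVec_injective (funext h3)
    have h1 := Nat.card_le_card_of_injective F hF
    rw [Finite.card_option, hM, pow_mul] at h1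
    have h2 := four_pow_le_card_isSymm hm
    rw [show 2 ^ 2 = 4 from rfl] at h1
    omega
  -- double counting
  let R : Std (ZMod 2) m → Finset M := fun a => Finset.univ.filter fun v => v ≠ 0 ∧ a ∈ C v
  have hRle : ∀ a ≠ 0, ∀ b ≠ 0, (R a).card ≤ (R b).card := by
    intro a ha b hb
    obtain ⟨g, rfl⟩ := exists_isometry_map_eq (fun x => eq_zero_of_stdForm_eq_zero) ha hB hb
    refine Finset.card_le_card_of_injOn (f g) ?_ (f g).injective.injOn
    intro v hv
    have hv' : v ≠ 0 ∧ a ∈ C v := by simpa [R] using hv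
    have : f g v ≠ 0 ∧ g.1 a ∈ C (f g v) := ⟨fne g v hv'.1, equiC g v hv'.1 a hv'.2⟩
    simpa [R] using this
  obtain ⟨a1, ha1⟩ := exists_basis_vector (p := 2) (m := m) (by omega)
  -- The incidence relation `a ∈ C v` is regular on both sides, and both sides have `4 ^ m - 1`
  -- elements.
  have hRcard : ∀ a ≠ 0, (R a).card = q - 1 := by
    intro a ha
    have h1 := Finset.sum_card_bipartiteAbove_eq_sum_card_bipartiteBelow
      (s := (Finset.univ.filter fun a : Std (ZMod 2) m => a ≠ 0))
      (t := (Finset.univ.filter fun v : M => v ≠ 0)) (fun a v => a ∈ C v)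
    have h2 : ∀ b ∈ (Finset.univ.filter fun a : Std (ZMod 2) m => a ≠ 0),
        (Finset.bipartiteAbove (fun a v => a ∈ C v) (Finset.univ.filter fun v : M => v ≠ 0) b).card
          = (R a).card := by
      intro b hb
      have hb' : b ≠ 0 := by simpa using hb
      rw [← le_antisymm (hRle b hb' a ha) (hRle a ha b hb')]
      congr 1
      ext v; simp [R, Finset.mem_bipartiteAbove]
    have h3 : ∀ v ∈ (Finset.univ.filter fun v : M => v ≠ 0),
        (Finset.bipartiteBelow (fun a v => a ∈ C v)
          (Finset.univ.filter fun a : Std (ZMod 2) m => a ≠ 0) v).card = q - 1 := by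
      intro v hv
      have hv' : v ≠ 0 := by simpa using hv
      rw [← hfcard v hv', ← Finset.card_erase_of_mem (a := (0 : Std (ZMod 2) m)) (by simp)]
      congr 1
      ext x; simp [Finset.mem_bipartiteBelow]
    rw [Finset.sum_congr rfl h2, Finset.sum_congr rfl h3, Finset.sum_const, Finset.sum_const] at h1
    have h4 : (Finset.univ.filter fun a : Std (ZMod 2) m => a ≠ 0).card =
        (Finset.univ.filter fun v : M => v ≠ 0).card := by
      rw [Finset.filter_ne', Finset.filter_ne', Finset.card_erase_of_mem (Finset.mem_univ _),
        Finset.card_erase_of_mem (Finset.mem_univ _), Finset.card_univ, Finset.card_univ,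
        ← Nat.card_eq_fintype_card, ← Nat.card_eq_fintype_card, natCard_std, hM]
    rw [h4, smul_eq_mul, smul_eq_mul] at h1
    refine Nat.eq_of_mul_eq_mul_left (Finset.card_pos.2 ⟨v1, by simpa using hv1⟩) h1
  -- the dimension is one
  have hk1 : q = 2 := by
    by_contra hk1
    have hk2 : 2 ≤ k := by
      rcases k with _ | _ | k
      · simp at hk; omega
      · simp at hk; omega
      · omega
    obtain ⟨a, haC, ha0⟩ := (C v1).ne_bot_iff.1 (hC v1 hv1).2.2
    have hq4 : 4 ≤ q := by
      rw [hk]; exact Nat.pow_le_pow_right two_pos hk2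
    obtain ⟨b, hb⟩ : ∃ b, b ∈ ((Finset.univ.filter (· ∈ C v1)).erase 0).erase a := by
      apply Finset.card_pos.1
      rw [Finset.card_erase_of_mem (by simp [ha0, haC]), Finset.card_erase_of_mem (by simp),
        hfcard v1 hv1]
      omega
    simp only [Finset.mem_erase, Finset.mem_filter, Finset.mem_univ, true_and] at hb
    obtain ⟨hba, hb0, hbC⟩ := hb
    -- A transvection along `d` with `B a d = 0`, `B b d = 1` carries `C v1` to a space `C v` that
    -- contains `a` and `b + d`. So at least `4^(m-1)` vectors lie in the spaces through `a`, which
    -- cover at most `(q - 1)(q - 2)` vectors other than `0` and `a`; but `q ≤ 2^(m-1)`.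
    have h1 := four_pow_le_card_filter hb0 hba
    have h2 : (Finset.univ.filter fun d : Std (ZMod 2) m =>
        stdForm (ZMod 2) m a d = 0 ∧ stdForm (ZMod 2) m b d = 1).card ≤
        ((R a).biUnion fun v => ((Finset.univ.filter (· ∈ C v)).erase 0).erase a).card := by
      refine Finset.card_le_card_of_injOn (fun d => b + d) ?_ (fun x _ y _ h => by simpa using h)
      intro d hd
      have hd' : stdForm (ZMod 2) m a d = 0 ∧ stdForm (ZMod 2) m b d = 1 := by simpa using hd
      have e1 := equiC (transvec hB d 1) v1 hv1 a haC
      have e2 := equiC (transvec hB d 1) v1 hv1 b hbC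
      simp only [transvec_apply, hd'.1, hd'.2, mul_zero, zero_smul, add_zero, mul_one,
        one_smul] at e1 e2
      simp only [Finset.coe_biUnion, Set.mem_iUnion, R]
      refine ⟨f (transvec hB d 1) v1, by simpa using ⟨hv1, e1⟩, ?_⟩
      simp only [Finset.mem_coe, Finset.mem_erase, Finset.mem_filter, Finset.mem_univ, true_and]
      refine ⟨?_, ?_, e2⟩
      · intro h
        have h3 : stdForm (ZMod 2) m (b + d) d = 0 := by rw [h]; exact hd'.1
        simp [hd'.2, hB d] at h3
      · intro h
        have h3 : stdForm (ZMod 2) m (b + d) d = 0 := by rw [h]; simp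
        simp [hd'.2, hB d] at h3
    have h3 := Finset.card_biUnion_le_card_mul (R a)
      (fun v => ((Finset.univ.filter (· ∈ C v)).erase 0).erase a) (q - 2) (by
        intro v hv
        have hv' : v ≠ 0 ∧ a ∈ C v := by simpa [R] using hv
        rw [Finset.card_erase_of_mem (by simp [ha0, hv'.2]), Finset.card_erase_of_mem (by simp),
          hfcard v hv'.1]
        omega)
    rw [hRcard a ha0] at h3
    have h4 : 2 * q ≤ 2 ^ m := by
      rw [hk, ← pow_succ']
      exact Nat.pow_le_pow_right two_pos (by omega)
    have h5 : 4 ^ m = 2 ^ m * 2 ^ m := by rw [← mul_pow]; rfl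
    have h6 : (q - 1) * (q - 2) < q * q :=
      Nat.mul_lt_mul_of_lt_of_le (by omega) (by omega) (by omega)
    have h7 : (2 * q) * (2 * q) ≤ 2 ^ m * 2 ^ m := Nat.mul_le_mul h4 h4
    have h8 := h2.trans h3
    nlinarith
  -- the equivariant map
  have hα : ∀ v, ∃ a : Std (ZMod 2) m, (v = 0 → a = 0) ∧
      (v ≠ 0 → a ≠ 0 ∧ ∀ x, x ∈ C v ↔ x = 0 ∨ x = a) := by
    intro v
    by_cases hv : v = 0
    · exact ⟨0, fun _ => rfl, fun h => absurd hv h⟩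
    obtain ⟨a, haC, ha0⟩ := (C v).ne_bot_iff.1 (hC v hv).2.2
    refine ⟨a, fun h => absurd h hv, fun _ => ⟨ha0, fun x => ?_⟩⟩
    have h1 : ({0, a} : Finset (Std (ZMod 2) m)) = Finset.univ.filter (· ∈ C v) := by
      apply Finset.eq_of_subset_of_card_le
      · intro x hx
        simp only [Finset.mem_insert, Finset.mem_singleton] at hx
        rcases hx with rfl | rfl <;> simp [haC]
      · rw [hfcard v hv, hk1, Finset.card_pair ha0.symm]
    have h2 := Finset.ext_iff.1 h1 x
    simp only [Finset.mem_insert, Finset.mem_singleton, Finset.mem_filter, Finset.mem_univ,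
      true_and] at h2
    exact h2.symm
  choose α hα0 hα using hα
  have αmem : ∀ v ≠ 0, α v ∈ C v := fun v hv => ((hα v hv).2 _).2 (Or.inr rfl)
  have αequi : ∀ g v, α (f g v) = g.1 (α v) := by
    intro g v
    by_cases hv : v = 0
    · simp [hv, hα0]
    have h1 := ((hα _ (fne g v hv)).2 _).1 (equiC g v hv _ (αmem v hv))
    rcases h1 with h1 | h1
    · exact absurd (g.1.map_eq_zero_iff.1 h1) (hα v hv).1
    · exact h1.symm
  have αinj : Function.Injective α := by
    intro v w h
    by_cases hv : v = 0
    · by_contra hvw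
      have hw : w ≠ 0 := by rintro rfl; exact hvw hv
      exact (hα w hw).1 (by rw [← h, hα0 v hv])
    by_cases hw : w = 0
    · exact absurd (by rw [h, hα0 w hw]) (hα v hv).1
    -- For `q = 2` each nonzero vector lies in exactly one `C v`.
    have h1 := hRcard _ (hα v hv).1
    rw [hk1] at h1
    refine Finset.card_le_one.1 (le_of_eq h1) v ?_ w ?_
    · simpa [R, hv] using αmem v hv
    · have := αmem w hw
      rw [← h] at this
      simpa [R, hw] using this
  have αadd : ∀ v w, α (v + w) = α v + α w := by
    intro v w
    by_cases hv : v = 0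
    · simp [hv, hα0]
    by_cases hw : w = 0
    · simp [hw, hα0]
    by_cases hvw : v + w = 0
    · have : v = w := by
        rw [eq_neg_of_add_eq_zero_left hvw]
        have h2 : (2 : ZMod 2) • w = 0 := by
          rw [show (2 : ZMod 2) = 0 from rfl, zero_smul]
        rw [two_smul] at h2
        exact (eq_neg_of_add_eq_zero_left h2).symm
      rw [hvw, hα0 _ rfl, this]
      ext i <;> simp [CharTwo.add_self_eq_zero]
    -- A transvection along a vector orthogonal to `α v` and `α w` fixes `v` and `w`, hence `v + w`.
    -- By injectivity the only possible nonzero combination is the sum.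
    have h1 : α (v + w) ∈ Submodule.span (ZMod 2) {α v, α w} := by
      by_contra hcon
      obtain ⟨d, hd1, hd2⟩ := exists_ortho_and_not_ortho hN hB hcon
      apply hd2
      refine (memC _ hvw _).1 (αmem _ hvw) d ?_
      have : ∀ u : M, u ≠ 0 → stdForm (ZMod 2) m (α u) d = 0 → f (transvec hB d 1) u = u := by
        intro u hu h
        rw [← (hC u hu).1]
        intro x hx
        rcases ((hα u hu).2 x).1 hx with rfl | rfl
        · simp
        · exact h
      rw [map_add, this v hv (hd1 _ (Submodule.subset_span (by simp))),
        this w hw (hd1 _ (Submodule.subset_span (by simp)))]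
    obtain ⟨c, c', hcc⟩ := Submodule.mem_span_pair.1 h1
    by_cases hc : c = 0
    · by_cases hc' : c' = 0
      · rw [hc, hc'] at hcc
        exact absurd (by simpa using hcc.symm) (hα _ hvw).1
      · rw [hc, zmod_two_eq_one hc'] at hcc
        have := αinj (by simpa using hcc : α w = α (v + w))
        simp [hv] at this
    · by_cases hc' : c' = 0
      · rw [hc', zmod_two_eq_one hc] at hcc
        have := αinj (by simpa using hcc : α v = α (v + w))
        simp [hw] at this
      · rw [← hcc, zmod_two_eq_one hc, zmod_two_eq_one hc']; simp
  let αl : M →+ Std (ZMod 2) m := ⟨⟨α, hα0 0 rfl⟩, αadd⟩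
  refine ⟨LinearEquiv.ofBijective (αl.toZModLinearMap 2) ?_, αequi⟩
  exact Function.Injective.bijective_of_nat_card_le αinj (by rw [hM, natCard_std])

end CharTwo

end SymplecticSpace

/-! ### Lines -/

/-! ### Gram matrices and unitary equivalence -/

section Gram

variable {V V' : Type*} [NormedAddCommGroup V] [InnerProductSpace ℂ V]
  [NormedAddCommGroup V'] [InnerProductSpace ℂ V']

/-- Two spanning families with the same Gram matrix are related by a unitary transformation. -/
theorem exists_isometry_of_inner_eq {ι : Type*} [Finite ι] (v : ι → V) (w : ι → V')
    (h : ∀ i j, inner ℂ (v i) (v j) = inner ℂ (w i) (w j))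
    (hv : Submodule.span ℂ (Set.range v) = ⊤) (hw : Submodule.span ℂ (Set.range w) = ⊤) :
    ∃ g : V ≃ₗᵢ[ℂ] V', ∀ i, g (v i) = w i := by
  classical
  have := Fintype.ofFinite ι
  let T := Fintype.linearCombination ℂ v
  let T' := Fintype.linearCombination ℂ w
  have hT : Function.Surjective T := by
    rw [← LinearMap.range_eq_top, Fintype.range_linearCombination, hv]
  have hT' : Function.Surjective T' := by
    rw [← LinearMap.range_eq_top, Fintype.range_linearCombination, hw]
  have hnorm : ∀ a, ‖T a‖ = ‖T' a‖ := by
    intro a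
    have : inner ℂ (T a) (T a) = inner ℂ (T' a) (T' a) := by
      simp only [T, T', Fintype.linearCombination_apply, sum_inner, inner_sum, inner_smul_left,
        inner_smul_right, h]
    rw [inner_self_eq_norm_sq_to_K, inner_self_eq_norm_sq_to_K] at this
    have h2 : ‖T a‖ ^ 2 = ‖T' a‖ ^ 2 := by exact_mod_cast this
    exact (sq_eq_sq₀ (norm_nonneg _) (norm_nonneg _)).1 h2
  have hker : LinearMap.ker T = LinearMap.ker T' := by
    ext a
    rw [LinearMap.mem_ker, LinearMap.mem_ker, ← norm_eq_zero, hnorm, norm_eq_zero]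
  let e : V ≃ₗ[ℂ] V' := (T.quotKerEquivOfSurjective hT).symm ≪≫ₗ
    (Submodule.quotEquivOfEq _ _ hker) ≪≫ₗ (T'.quotKerEquivOfSurjective hT')
  have he : ∀ a, e (T a) = T' a := by
    intro a
    have : (T.quotKerEquivOfSurjective hT).symm (T a) = Submodule.Quotient.mk a := by
      rw [LinearEquiv.symm_apply_eq]; rfl
    simp only [e, LinearEquiv.trans_apply, this, Submodule.quotEquivOfEq_mk]
    rfl
  refine ⟨⟨e, fun x => ?_⟩, fun i => ?_⟩
  · obtain ⟨a, rfl⟩ := hT x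
    rw [he, hnorm]
  · have := he (Pi.single i 1)
    simpa [T, T', Fintype.linearCombination_apply_single] using this

end Gram

/-! ### Group actions on sets of equiangular lines -/

section LineSets

variable {V : Type*} [NormedAddCommGroup V] [InnerProductSpace ℂ V]

theorem moveLine_mul (g h : V ≃ₗᵢ[ℂ] V) (l : Submodule ℂ V) :
    moveLine (g * h) l = moveLine g (moveLine h l) := by
  ext x
  simp only [moveLine, Submodule.mem_map]
  constructor
  · rintro ⟨y, hy, rfl⟩
    exact ⟨h y, ⟨y, hy, rfl⟩, rfl⟩
  · rintro ⟨_, ⟨y, hy, rfl⟩, rfl⟩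
    exact ⟨y, hy, rfl⟩

theorem moveLine_one (l : Submodule ℂ V) : moveLine (1 : V ≃ₗᵢ[ℂ] V) l = l := by
  ext x
  simp only [moveLine, Submodule.mem_map]
  exact ⟨by rintro ⟨y, hy, rfl⟩; exact hy, fun h => ⟨x, h, rfl⟩⟩

theorem moveLine_span {V' : Type*} [NormedAddCommGroup V'] [InnerProductSpace ℂ V']
    (g : V ≃ₗᵢ[ℂ] V') (v : V) :
    moveLine g (Submodule.span ℂ {v}) = Submodule.span ℂ {g v} := by
  rw [moveLine, Submodule.map_span, Set.image_singleton]
  rfl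

theorem IsEquiangularLineSet.exists_unit {L : Set (Submodule ℂ V)} (hL : IsEquiangularLineSet L)
    {l : Submodule ℂ V} (hl : l ∈ L) : ∃ u : V, ‖u‖ = 1 ∧ l = Submodule.span ℂ {u} := by
  obtain ⟨w, hw, hspan⟩ := finrank_eq_one_iff'.1 (hL.finrank_eq_one l hl)
  have hw0 : (w : V) ≠ 0 := fun h => hw (Subtype.ext h)
  have hn : (‖(w : V)‖ : ℂ) ≠ 0 := by simpa using hw0
  refine ⟨(‖(w : V)‖ : ℂ)⁻¹ • (w : V), ?_, ?_⟩
  · rw [norm_smul]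
    simp [hw0]
  · rw [Submodule.span_singleton_smul_eq (IsUnit.mk0 _ (inv_ne_zero hn))]
    apply le_antisymm
    · intro x hx
      obtain ⟨c, hc⟩ := hspan ⟨x, hx⟩
      exact Submodule.mem_span_singleton.2 ⟨c, congrArg Subtype.val hc⟩
    · rw [Submodule.span_singleton_le_iff_mem]
      exact w.2

/-- A unitary transformation that fixes more lines than the dimension is a scalar. -/
theorem IsEquiangularLineSet.exists_scalar [FiniteDimensional ℂ V] {L : Set (Submodule ℂ V)}
    (hL : IsEquiangularLineSet L) (hcard : Module.finrank ℂ V < L.ncard) (g : V ≃ₗᵢ[ℂ] V)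
    (hg : ∀ l ∈ L, moveLine g l = l) : ∃ c : ℂ, ∀ x, g x = c • x := by
  have hfin : L.Finite := Set.finite_of_ncard_pos (by omega)
  obtain ⟨c, hc⟩ := hL.equiangular
  have hu : ∀ l : L, ∃ u : V, ‖u‖ = 1 ∧ l.1 = Submodule.span ℂ {u} := fun l => hL.exists_unit l.2
  choose u hu1 hu2 using hu
  have hmem : ∀ l : L, u l ∈ l.1 := fun l => by
    have := Submodule.mem_span_singleton_self (R := ℂ) (u l)
    rwa [← hu2 l] at this
  have hinner : ∀ k l : L, k ≠ l → ‖inner ℂ (u k) (u l)‖ = c := fun k l hkl =>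
    hc k k.2 l l.2 (fun h => hkl (Subtype.ext h)) _ (hmem k) _ (hmem l) (hu1 k) (hu1 l)
  -- There are too many lines for all of them to be orthogonal. Therefore no inner product vanishes,
  -- and all eigenvalues coincide.
  have hc0 : c ≠ 0 := by
    rintro rfl
    have hon : Orthonormal ℂ u := ⟨hu1, fun k l hkl => by simpa using hinner k l hkl⟩
    have : Fintype L := hfin.fintype
    have h1 := hon.linearIndependent.fintype_card_le_finrank
    rw [← Nat.card_eq_fintype_card] at h1
    exact absurd hcard (not_lt.2 h1)
  have hχ : ∀ l : L, ∃ χ : ℂ, g (u l) = χ • u l := by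
    intro l
    have h1 := hg l l.2
    rw [hu2 l, moveLine_span] at h1
    have h2 : g (u l) ∈ Submodule.span ℂ {u l} := h1 ▸ Submodule.mem_span_singleton_self _
    obtain ⟨χ, h⟩ := Submodule.mem_span_singleton.1 h2
    exact ⟨χ, h.symm⟩
  choose χ hχ using hχ
  have hχ1 : ∀ l, ‖χ l‖ = 1 := by
    intro l
    have := g.norm_map (u l)
    rwa [hχ, norm_smul, hu1, mul_one] at this
  have heq : ∀ k l, χ k = χ l := by
    intro k l
    by_cases hkl : k = l
    · rw [hkl]
    have h1 : inner ℂ (u k) (u l) ≠ 0 := by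
      intro h0
      have := hinner k l hkl
      rw [h0, norm_zero] at this
      exact hc0 this.symm
    have h2 := g.inner_map_map (u k) (u l)
    rw [hχ, hχ, inner_smul_left, inner_smul_right, ← mul_assoc] at h2
    have h3 : (starRingEnd ℂ) (χ k) * χ l = 1 := mul_right_cancel₀ h1 (by rw [h2, one_mul])
    have h4 : χ k * (starRingEnd ℂ) (χ k) = 1 := by
      rw [Complex.mul_conj, Complex.normSq_eq_norm_sq, hχ1]; simp
    calc χ k = χ k * ((starRingEnd ℂ) (χ k) * χ l) := by rw [h3, mul_one]
      _ = χ l := by rw [← mul_assoc, h4, one_mul]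
  obtain ⟨l0, hl0⟩ : L.Nonempty := by
    rw [Set.nonempty_iff_ne_empty]
    rintro rfl
    simp at hcard
  refine ⟨χ ⟨l0, hl0⟩, fun x => ?_⟩
  let T : V →ₗ[ℂ] V := (g.toLinearEquiv : V →ₗ[ℂ] V) - χ ⟨l0, hl0⟩ • LinearMap.id
  have hT : sSup L ≤ LinearMap.ker T := by
    refine sSup_le fun l hl => ?_
    refine (hu2 ⟨l, hl⟩).le.trans ?_
    rw [Submodule.span_singleton_le_iff_mem, LinearMap.mem_ker]
    change g (u ⟨l, hl⟩) - χ ⟨l0, hl0⟩ • u ⟨l, hl⟩ = 0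
    rw [hχ, heq ⟨l, hl⟩ ⟨l0, hl0⟩, sub_self]
  rw [hL.span_eq_top] at hT
  have : g x - χ ⟨l0, hl0⟩ • x = 0 := hT (Submodule.mem_top : x ∈ ⊤)
  exact sub_eq_zero.1 this

/-- The stabilizer of a line. -/
def lineStabilizer {E : Type*} [Group E] (ρ : E →* (V ≃ₗᵢ[ℂ] V)) (l : Submodule ℂ V) :
    Subgroup E where
  carrier := {e | moveLine (ρ e) l = l}
  mul_mem' {a b} ha hb := by
    change moveLine (ρ (a * b)) l = l
    rw [map_mul, moveLine_mul, hb, ha]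
  one_mem' := by
    change moveLine (ρ 1) l = l
    rw [map_one, moveLine_one]
  inv_mem' {a} ha := by
    change moveLine (ρ a⁻¹) l = l
    conv_lhs => rw [← show moveLine (ρ a) l = l from ha]
    rw [← moveLine_mul, ← map_mul, inv_mul_cancel, map_one, moveLine_one]

theorem card_lineStabilizer_mul {E : Type*} [Group E] (ρ : E →* (V ≃ₗᵢ[ℂ] V))
    {L : Set (Submodule ℂ V)} {l : Submodule ℂ V}
    (hL : ∀ e, moveLine (ρ e) l ∈ L) (htr : ∀ l' ∈ L, ∃ e, moveLine (ρ e) l = l') :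
    Nat.card (lineStabilizer ρ l) * L.ncard = Nat.card E := by
  let _ : MulAction E (Submodule ℂ V) :=
    { smul := fun e k => moveLine (ρ e) k
      one_smul := fun k => by
        change moveLine (ρ 1) k = k
        rw [map_one, moveLine_one]
      mul_smul := fun a b k => by
        change moveLine (ρ (a * b)) k = moveLine (ρ a) (moveLine (ρ b) k)
        rw [map_mul, moveLine_mul] }
  have h0 : lineStabilizer ρ l = MulAction.stabilizer E l := rfl
  have h1 : MulAction.orbit E l = L := by
    ext k
    constructor
    · rintro ⟨e, rfl⟩
      exact hL e
    · intro hk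
      obtain ⟨e, he⟩ := htr k hk
      exact ⟨e, he⟩
  rw [← h1, ← MulAction.index_stabilizer, h0]
  exact Subgroup.card_mul_index _

/-- This is the transitivity of a nontrivial normal subgroup of a 2-transitive group: an element
carrying the pair `(k, ek)` to `(l, l')` conjugates `e` to an element that moves `l` to `l'`. -/
theorem transitive_of_moves {E : Type*} [Group E] {G : Subgroup (V ≃ₗᵢ[ℂ] V)}
    {L : Set (Submodule ℂ V)} (hG2 : IsTwoTransitiveOn G L) (ρ : E →* (V ≃ₗᵢ[ℂ] V))
    (hconj : ∀ g ∈ G, ∀ e, ∃ e', ρ e' = g * ρ e * g⁻¹) {e : E} {k : Submodule ℂ V} (hk : k ∈ L)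
    (hek : moveLine (ρ e) k ∈ L) (hne : moveLine (ρ e) k ≠ k) {l l' : Submodule ℂ V} (hl : l ∈ L)
    (hl' : l' ∈ L) : ∃ e, moveLine (ρ e) l = l' := by
  by_cases h : l = l'
  · exact ⟨1, by rw [map_one, moveLine_one, h]⟩
  obtain ⟨g, hg, h1, h2⟩ := hG2 k hk _ hek l hl l' hl' hne.symm h
  obtain ⟨e', he'⟩ := hconj g hg e
  refine ⟨e', ?_⟩
  rw [he', moveLine_mul, ← h1, ← moveLine_mul g⁻¹, inv_mul_cancel, moveLine_one, moveLine_mul, h2]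

theorem moveLine_span_eq_iff {g : V ≃ₗᵢ[ℂ] V} {v : V} :
    moveLine g (Submodule.span ℂ {v}) = Submodule.span ℂ {v} ↔ ∃ c : ℂ, g v = c • v := by
  rw [moveLine_span]
  constructor
  · intro h
    have : g v ∈ Submodule.span ℂ {v} := h ▸ Submodule.mem_span_singleton_self _
    obtain ⟨c, hc⟩ := Submodule.mem_span_singleton.1 this
    exact ⟨c, hc.symm⟩
  · rintro ⟨c, hc⟩
    by_cases hv : v = 0
    · simp [hv]
    have hc0 : c ≠ 0 := by
      rintro rfl
      rw [zero_smul] at hc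
      exact hv (g.map_eq_zero_iff.1 hc)
    rw [hc, Submodule.span_singleton_smul_eq (IsUnit.mk0 _ hc0)]

/-- A set of lines, an operation of a group `E` by unitary transformations that is transitive on the
lines, with a subgroup `Z` of scalars as stabilizers of the lines, and an operation of a group `S`
that normalizes `E`, such that `E S` is transitive on the pairs of different lines. -/
structure IsLineConfiguration {E S : Type*} [Group E] [Group S] (p : ℕ)
    (L : Set (Submodule ℂ V)) (ρ : E →* (V ≃ₗᵢ[ℂ] V)) (σ : S →* (V ≃ₗᵢ[ℂ] V))
    (φ : S →* MulAut E) (Z : Subgroup E) : Prop where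
  card_eq : Nat.card Z = p
  mem_iff : ∀ e, e ∈ Z ↔ ∃ c : ℂ, ∀ x, ρ e x = c • x
  conj_eq : ∀ s e, ρ (φ s e) = σ s * ρ e * (σ s)⁻¹
  injective : Function.Injective ρ
  lines_eq : ∀ v, Submodule.span ℂ {v} ∈ L → L = Set.range fun e => Submodule.span ℂ {ρ e v}
  stabilizer : ∀ v, Submodule.span ℂ {v} ∈ L → ∀ e, (∃ c : ℂ, ρ e v = c • v) → e ∈ Z
  exists_lift : ∀ v, Submodule.span ℂ {v} ∈ L → ∀ s, ∃ e, ∃ c : ℂ, ρ e (σ s v) = c • v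
  transitive : ∀ v, Submodule.span ℂ {v} ∈ L → ∀ x ∉ Z, ∀ y ∉ Z,
    ∃ e s, (∃ c : ℂ, ρ e (σ s v) = c • v) ∧ y⁻¹ * (e * φ s x * e⁻¹) ∈ Z
  map_mem : ∀ s, ∀ l ∈ L, moveLine (σ s) l ∈ L

/-- There are more lines than dimensions, so fixing all lines means being scalar. A nonscalar
element makes `E` transitive, and counting gives line stabilizers of order `p`; these turn out to be
the scalars in `E`. Two-transitivity becomes transitivity on the nontrivial cosets of `Z`. -/
theorem exists_isLineConfiguration [FiniteDimensional ℂ V] {p m : ℕ} (hp : 1 < p) (hm : 0 < m)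
    {L : Set (Submodule ℂ V)} (hL : IsEquiangularLineSet L) (hn : L.ncard = p ^ (2 * m))
    (hd2 : 2 * Module.finrank ℂ V ≤ p ^ (2 * m))
    {G : Subgroup (V ≃ₗᵢ[ℂ] V)} (hGL : ActsByAutomorphisms G L) (hG2 : IsTwoTransitiveOn G L)
    {E S : Type*} [Group E] [Group S] {φ : S →* MulAut E} (hcard : Nat.card E = p ^ (1 + 2 * m))
    (ρ : E →* (V ≃ₗᵢ[ℂ] V)) (σ : S →* (V ≃ₗᵢ[ℂ] V))
    (hconj : ∀ s e, ρ (φ s e) = σ s * ρ e * (σ s)⁻¹) (hinj : Function.Injective ρ)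
    (hG : ∀ g, g ∈ G ↔ ∃ e s, g = ρ e * σ s)
    (hns : ∃ e, ¬ ∃ c : ℂ, ∀ x, ρ e x = c • x)
    (hE : (∀ x y : E, x * y = y * x) ∨ Nat.card (Subgroup.center E) = p) :
    ∃ Z : Subgroup E, IsLineConfiguration p L ρ σ φ Z ∧
      (Nat.card (Subgroup.center E) = p → Z = Subgroup.center E) := by
  have hpos : 0 < p ^ (2 * m) := pow_pos (by omega) _
  have hfin : L.Finite := Set.finite_of_ncard_pos (by omega)
  have hfinE : Finite E := Nat.finite_of_card_ne_zero (by rw [hcard]; exact (pow_pos (by omega) _).ne')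
  have hcardL : Module.finrank ℂ V < L.ncard := by omega
  have hmove : ∀ g ∈ G, ∀ l ∈ L, moveLine g l ∈ L := fun g hg l hl => by
    rw [← hGL g hg]; exact ⟨l, hl, rfl⟩
  have hρG : ∀ e, ρ e ∈ G := fun e => (hG _).2 ⟨e, 1, by simp⟩
  have hσG : ∀ s, σ s ∈ G := fun s => (hG _).2 ⟨1, s, by simp⟩
  have hconjG : ∀ e s x, (ρ e * σ s) * ρ x * (ρ e * σ s)⁻¹ = ρ (e * φ s x * e⁻¹) := by
    intro e s x
    rw [map_mul, map_mul, hconj, map_inv]; group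
  have htr : ∀ l ∈ L, ∀ l' ∈ L, ∃ e, moveLine (ρ e) l = l' := by
    obtain ⟨e, he⟩ := hns
    obtain ⟨k, hk, hke⟩ : ∃ k ∈ L, moveLine (ρ e) k ≠ k := by
      by_contra! hcon
      exact he (hL.exists_scalar hcardL (ρ e) hcon)
    intro l hl l' hl'
    refine transitive_of_moves hG2 ρ (fun g hg x => ?_) hk (hmove _ (hρG e) _ hk) hke hl hl'
    obtain ⟨e', s, rfl⟩ := (hG g).1 hg
    exact ⟨_, (hconjG e' s x).symm⟩
  have hcardst : ∀ l ∈ L, Nat.card (lineStabilizer ρ l) = p := by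
    intro l hl
    have := card_lineStabilizer_mul ρ (fun e => hmove _ (hρG e) l hl) (htr l hl)
    rw [hn, hcard, pow_add, pow_one] at this
    exact Nat.eq_of_mul_eq_mul_right hpos this
  have hscal_fix : ∀ e, (∃ c : ℂ, ∀ x, ρ e x = c • x) → ∀ l ∈ L, e ∈ lineStabilizer ρ l := by
    rintro e ⟨c, hc⟩ l hl
    obtain ⟨u, -, rfl⟩ := hL.exists_unit hl
    exact moveLine_span_eq_iff.2 ⟨c, hc u⟩
  -- A nonscalar central element would make the center, of order `p`, transitive on `p^(2m)` lines.
  have hcenter : Nat.card (Subgroup.center E) = p → ∀ e ∈ Subgroup.center E,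
      ∃ c : ℂ, ∀ x, ρ e x = c • x := by
    intro hc e he
    by_contra hcon
    obtain ⟨k, hk, hke⟩ : ∃ k ∈ L, moveLine (ρ e) k ≠ k := by
      by_contra! hcon'
      exact hcon (hL.exists_scalar hcardL (ρ e) hcon')
    have htrc : ∀ l' ∈ L, ∃ e : Subgroup.center E,
        moveLine ((ρ.comp (Subgroup.center E).subtype) e) k = l' := by
      intro l' hl'
      refine transitive_of_moves hG2 _ (fun g hg x => ?_) (e := ⟨e, he⟩) hk
        (hmove _ (hρG e) _ hk) hke hk hl'
      obtain ⟨e', s, rfl⟩ := (hG g).1 hg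
      refine ⟨⟨φ s x, ?_⟩, ?_⟩
      · rw [Subgroup.mem_center_iff]
        intro y
        obtain ⟨y, rfl⟩ := (φ s).surjective y
        rw [← map_mul, ← map_mul, Subgroup.mem_center_iff.1 x.2]
      · have h1 : φ s x ∈ Subgroup.center E := by
          rw [Subgroup.mem_center_iff]
          intro y
          obtain ⟨y, rfl⟩ := (φ s).surjective y
          rw [← map_mul, ← map_mul, Subgroup.mem_center_iff.1 x.2]
        simp only [MonoidHom.comp_apply, Subgroup.subtype_apply]
        rw [hconjG, Subgroup.mem_center_iff.1 h1, mul_inv_cancel_right]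
    have h1 := card_lineStabilizer_mul (ρ.comp (Subgroup.center E).subtype)
      (fun e => hmove _ (hρG e) k hk) htrc
    rw [hn, hc] at h1
    have h2 : p ^ (2 * m) ∣ p := ⟨_, h1.symm.trans (mul_comm _ _)⟩
    have h3 := Nat.le_of_dvd (by omega) h2
    have h4 : p ^ 2 ≤ p ^ (2 * m) := Nat.pow_le_pow_right (by omega) (by omega)
    nlinarith
  -- In a transitive abelian group, an element fixing one line fixes all. In the other case the
  -- center lies in the stabilizer and has the same order.
  have hst : ∀ l ∈ L, ∀ e ∈ lineStabilizer ρ l, ∃ c : ℂ, ∀ x, ρ e x = c • x := by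
    intro l hl e he
    rcases hE with hE | hE
    · refine hL.exists_scalar hcardL _ fun l' hl' => ?_
      obtain ⟨y, rfl⟩ := htr l hl l' hl'
      rw [← moveLine_mul, ← map_mul, hE, map_mul, moveLine_mul,
        show moveLine (ρ e) l = l from he]
    · have h1 : Subgroup.center E ≤ lineStabilizer ρ l := fun c hc =>
        hscal_fix c (hcenter hE c hc) l hl
      have h2 : Subgroup.center E = lineStabilizer ρ l :=
        Subgroup.eq_of_le_of_card_ge h1 (by rw [hcardst l hl, hE])
      exact hcenter hE e (h2 ▸ he)
  obtain ⟨l0, hl0⟩ : L.Nonempty := by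
    rw [Set.nonempty_iff_ne_empty]
    rintro rfl
    simp at hcardL
  have hmem : ∀ e, e ∈ lineStabilizer ρ l0 ↔ ∃ c : ℂ, ∀ x, ρ e x = c • x := fun e =>
    ⟨hst l0 hl0 e, fun h => hscal_fix e h l0 hl0⟩
  refine ⟨lineStabilizer ρ l0, ⟨hcardst l0 hl0, hmem, hconj, hinj, ?_, ?_, ?_, ?_,
    fun s l hl => hmove _ (hσG s) l hl⟩, ?_⟩
  · intro v hv
    ext l
    constructor
    · intro hl
      obtain ⟨e, rfl⟩ := htr _ hv l hl
      exact ⟨e, (moveLine_span _ _).symm⟩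
    · rintro ⟨e, rfl⟩
      have := hmove _ (hρG e) _ hv
      rwa [moveLine_span] at this
  · intro v hv e he
    rw [hmem]
    exact hst _ hv e (moveLine_span_eq_iff.2 he)
  · intro v hv s
    obtain ⟨e, he⟩ := htr _ (hmove _ (hσG s) _ hv) _ hv
    rw [← moveLine_mul, moveLine_span_eq_iff] at he
    exact ⟨e, he⟩
  · intro v hv x hx y hy
    have hne : ∀ x, x ∉ lineStabilizer ρ l0 →
        Submodule.span ℂ {v} ≠ moveLine (ρ x) (Submodule.span ℂ {v}) := by
      intro x hx h
      exact hx ((hmem x).2 (hst _ hv x h.symm))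
    obtain ⟨g, hg, h1, h2⟩ := hG2 _ hv _ (hmove _ (hρG x) _ hv) _ hv _ (hmove _ (hρG y) _ hv)
      (hne x hx) (hne y hy)
    obtain ⟨e, s, rfl⟩ := (hG g).1 hg
    refine ⟨e, s, moveLine_span_eq_iff.1 h1, (hmem _).2 (hst _ hv _ ?_)⟩
    change moveLine _ _ = _
    -- The group element fixes `⟨v⟩` and takes `x⟨v⟩` to `y⟨v⟩`, so the conjugate of `x` agrees with
    -- `y` on `⟨v⟩`, hence modulo `Z`.
    have h3 : moveLine (ρ (e * φ s x * e⁻¹)) (Submodule.span ℂ {v}) =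
        moveLine (ρ y) (Submodule.span ℂ {v}) := by
      rw [← hconjG, ← h2]
      nth_rewrite 1 [← h1]
      simp only [← moveLine_mul]
      congr 1; group
    rw [map_mul, moveLine_mul, h3, ← moveLine_mul, ← map_mul, inv_mul_cancel, map_one,
      moveLine_one]
  · intro hc
    exact (Subgroup.eq_of_le_of_card_ge (fun c hc' => (hmem c).2 (hcenter hc c hc'))
      (by rw [hcardst l0 hl0, hc])).symm

end LineSets

namespace SymplecticSpace

/-! ### Symplectic matrices and linear isometries -/

section MatrixGroup

variable {p m : ℕ} [Fact p.Prime]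

/-- Pairs of vectors as vectors indexed by a sum. -/
def sumEquiv (p m : ℕ) [Fact p.Prime] :
    (Fin m ⊕ Fin m → ZMod p) ≃ₗ[ZMod p] Std (ZMod p) m :=
  LinearEquiv.sumArrowLequivProdArrow (Fin m) (Fin m) (ZMod p) (ZMod p)

theorem stdForm_sumEquiv (x y : Fin m ⊕ Fin m → ZMod p) :
    stdForm (ZMod p) m (sumEquiv p m x) (sumEquiv p m y) =
      -(x ⬝ᵥ (Matrix.J (Fin m) (ZMod p)).mulVec y) := by
  obtain ⟨⟨a, b⟩, rfl⟩ := (sumEquiv p m).symm.surjective x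
  obtain ⟨⟨a', b'⟩, rfl⟩ := (sumEquiv p m).symm.surjective y
  simp only [LinearEquiv.apply_symm_apply, stdForm_apply]
  have h : ∀ a b : Fin m → ZMod p, (sumEquiv p m).symm (a, b) = Sum.elim a b := fun a b => rfl
  rw [h, h, Matrix.J, Matrix.fromBlocks_mulVec]
  have h1 : (-1 : Matrix (Fin m) (Fin m) (ZMod p)).mulVec b' = -b' := by
    rw [Matrix.neg_mulVec, Matrix.one_mulVec]
  simp [h1]
  ring

theorem mem_symplecticGroup_iff_forall (A : Matrix (Fin m ⊕ Fin m) (Fin m ⊕ Fin m) (ZMod p)) :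
    A ∈ Matrix.symplecticGroup (Fin m) (ZMod p) ↔
      ∀ x y, stdForm (ZMod p) m (sumEquiv p m (A.mulVec x)) (sumEquiv p m (A.mulVec y)) =
        stdForm (ZMod p) m (sumEquiv p m x) (sumEquiv p m y) := by
  have h : ∀ x y, A.mulVec x ⬝ᵥ (Matrix.J (Fin m) (ZMod p)).mulVec (A.mulVec y) =
      x ⬝ᵥ (A.transpose * Matrix.J (Fin m) (ZMod p) * A).mulVec y := by
    intro x y
    rw [← Matrix.mulVec_mulVec, ← Matrix.mulVec_mulVec, Matrix.dotProduct_mulVec x,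
      Matrix.vecMul_transpose]
  rw [SymplecticGroup.mem_iff']
  simp only [stdForm_sumEquiv, h, neg_inj]
  constructor
  · intro h x y
    rw [h]
  · intro h
    apply Matrix.mulVec_injective
    funext y
    exact dotProduct_eq _ _ fun x => by rw [dotProduct_comm, h, dotProduct_comm]

/-- The matrix of a linear isometry. -/
def toSp (p m : ℕ) [Fact p.Prime] : StdGroup p m →* Sp m p where
  toFun g := ⟨LinearMap.toMatrix'
    ((sumEquiv p m).symm.toLinearMap ∘ₗ g.1.toLinearMap ∘ₗ (sumEquiv p m).toLinearMap), by
      rw [mem_symplecticGroup_iff_forall]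
      intro x y
      rw [← Matrix.toLin'_apply, ← Matrix.toLin'_apply, Matrix.toLin'_toMatrix']
      simp [mem_isometryGroup.1 g.2]⟩
  map_one' := by
    apply Subtype.ext
    change LinearMap.toMatrix' _ = _
    refine Eq.trans ?_ LinearMap.toMatrix'_one
    congr 1
    refine LinearMap.ext fun x => ?_
    simp
  map_mul' g h := by
    apply Subtype.ext
    change LinearMap.toMatrix' _ = LinearMap.toMatrix' _ * LinearMap.toMatrix' _
    rw [← LinearMap.toMatrix'_mul]
    congr 1

theorem toSp_surjective : Function.Surjective (toSp p m) := by
  intro A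
  have h1 : A.1 * (A⁻¹).1 = 1 := congrArg Subtype.val (mul_inv_cancel A)
  have h2 : (A⁻¹).1 * A.1 = 1 := congrArg Subtype.val (inv_mul_cancel A)
  let e : (Fin m ⊕ Fin m → ZMod p) ≃ₗ[ZMod p] (Fin m ⊕ Fin m → ZMod p) :=
    { Matrix.toLin' A.1 with
      invFun := fun x => (A⁻¹).1.mulVec x
      left_inv := fun x => by simp [h2]
      right_inv := fun x => by simp [h1] }
  have he : ∀ x, e x = A.1.mulVec x := fun x => rfl
  refine ⟨⟨(sumEquiv p m).symm.trans (e.trans (sumEquiv p m)), ?_⟩, ?_⟩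
  · intro x y
    have := (mem_symplecticGroup_iff_forall A.1).1 A.2 ((sumEquiv p m).symm x)
      ((sumEquiv p m).symm y)
    simpa [he] using this
  · apply Subtype.ext
    change LinearMap.toMatrix' _ = _
    refine Eq.trans ?_ (LinearMap.toMatrix'_toLin' A.1)
    congr 1
    refine LinearMap.ext fun x => ?_
    simp [he]

/-- The scalar `-1`. -/
def negOne (p m : ℕ) [Fact p.Prime] : StdGroup p m :=
  ⟨LinearEquiv.neg (ZMod p), fun x y => by simp⟩

theorem negOne_apply (x : Std (ZMod p) m) : (negOne p m).1 x = -x := rfl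

theorem negOne_mul_self : negOne p m * negOne p m = 1 := by
  apply Subtype.ext; ext x : 1; simp [LinearEquiv.mul_apply, negOne_apply]

theorem negOne_comm (g : StdGroup p m) : g * negOne p m = negOne p m * g := by
  apply Subtype.ext; ext x : 1; simp [LinearEquiv.mul_apply, negOne_apply]

end MatrixGroup

end SymplecticSpace

/-! ### Elementary abelian quotients and the commutator form -/

section Quotient

universe u

/-- Additive maps are automatically linear over the prime field. -/
theorem exists_linear_action {p : ℕ} {S M : Type*} [Group S] [AddCommGroup M] [Module (ZMod p) M]
    (F : S → M →+ M) (h1 : ∀ a, F 1 a = a) (hmul : ∀ s t a, F (s * t) a = F s (F t a)) :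
    ∃ f : S →* (M ≃ₗ[ZMod p] M), ∀ s a, f s a = F s a :=
  ⟨{ toFun := fun s =>
      { toFun := F s
        map_add' := map_add (F s)
        map_smul' := ZMod.map_smul (F s)
        invFun := F s⁻¹
        left_inv := fun a => by rw [← hmul, inv_mul_cancel, h1]
        right_inv := fun a => by rw [← hmul, mul_inv_cancel, h1] }
     map_one' := LinearEquiv.ext h1
     map_mul' := fun s t => LinearEquiv.ext (hmul s t) }, fun _ _ => rfl⟩

/-- An elementary abelian quotient as a vector space. -/
theorem exists_module_quotient {p : ℕ} {E : Type u} {S : Type*} [Group E] [Group S]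
    (φ : S →* MulAut E) (Z : Subgroup E) (hcomm : ∀ x y : E, x * y * x⁻¹ * y⁻¹ ∈ Z)
    (hpow : ∀ x : E, x ^ p ∈ Z) (hZ : ∀ s, ∀ e ∈ Z, φ s e ∈ Z) :
    ∃ (M : Type u) (_ : AddCommGroup M) (_ : Module (ZMod p) M) (π : E → M)
      (f : S →* (M ≃ₗ[ZMod p] M)), Function.Surjective π ∧ (∀ x y, π (x * y) = π x + π y) ∧
      (∀ x, π x = 0 ↔ x ∈ Z) ∧ (∀ s x, f s (π x) = π (φ s x)) ∧
      Nat.card Z * Nat.card M = Nat.card E := by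
  have hN : Z.Normal := ⟨fun n hn g => by
    have := Z.mul_mem (hcomm g n) hn
    simpa using this⟩
  let _ : CommGroup (E ⧸ Z) :=
    { (inferInstance : Group (E ⧸ Z)) with
      mul_comm := by
        intro a b
        obtain ⟨x, rfl⟩ := QuotientGroup.mk_surjective a
        obtain ⟨y, rfl⟩ := QuotientGroup.mk_surjective b
        rw [← QuotientGroup.mk_mul, ← QuotientGroup.mk_mul, QuotientGroup.eq]
        have := hcomm y⁻¹ x⁻¹
        simpa [mul_assoc] using this }
  let π : E → Additive (E ⧸ Z) := fun x => Additive.ofMul (x : E ⧸ Z)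
  have hsurj : Function.Surjective π := QuotientGroup.mk_surjective
  have hmul : ∀ x y, π (x * y) = π x + π y := fun x y => rfl
  have hzero : ∀ x, π x = 0 ↔ x ∈ Z := fun x => QuotientGroup.eq_one_iff x
  let _ : Module (ZMod p) (Additive (E ⧸ Z)) := AddCommGroup.zmodModule (n := p) (by
    intro a
    obtain ⟨x, rfl⟩ := hsurj a
    change π (x ^ p) = 0
    rw [hzero]
    exact hpow x)
  let F : S → Additive (E ⧸ Z) →+ Additive (E ⧸ Z) := fun s =>
    MonoidHom.toAdditive (QuotientGroup.map Z Z (φ s).toMonoidHom (fun e he => hZ s e he))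
  have hF : ∀ s x, F s (π x) = π (φ s x) := fun s x => rfl
  have hF1 : ∀ a, F 1 a = a := by
    intro a
    obtain ⟨x, rfl⟩ := hsurj a
    rw [hF, map_one]; rfl
  have hFmul : ∀ s t a, F (s * t) a = F s (F t a) := by
    intro s t a
    obtain ⟨x, rfl⟩ := hsurj a
    rw [hF, hF, hF, map_mul]; rfl
  obtain ⟨f, hf⟩ := exists_linear_action (p := p) F hF1 hFmul
  refine ⟨Additive (E ⧸ Z), inferInstance, inferInstance, π, f, hsurj, hmul, hzero,
    fun s x => by rw [hf, hF], ?_⟩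
  rw [← Subgroup.card_mul_index Z]; rfl

/-- The commutator form. -/
theorem exists_commutator_form {p : ℕ} {E M : Type*} [Group E] [AddCommGroup M] [Module (ZMod p) M]
    (hcomm : ∀ x y : E, x * y * x⁻¹ * y⁻¹ ∈ Subgroup.center E)
    {π : E → M} (hsurj : Function.Surjective π) (hmul : ∀ x y, π (x * y) = π x + π y)
    (hker : ∀ x, π x = 0 ↔ x ∈ Subgroup.center E) (κ : E → ZMod p)
    (hκ : ∀ a ∈ Subgroup.center E, ∀ b ∈ Subgroup.center E, κ (a * b) = κ a + κ b)
    (hκ0 : ∀ a ∈ Subgroup.center E, κ a = 0 → a = 1) :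
    ∃ ω : LinearMap.BilinForm (ZMod p) M, ω.IsAlt ∧ (∀ a, (∀ b, ω a b = 0) → a = 0) ∧
      ∀ x y, ω (π x) (π y) = κ (x * y * x⁻¹ * y⁻¹) := by
  have hinv : ∀ x, π x⁻¹ = - π x := by
    intro x
    have h1 : π 1 = 0 := (hker 1).2 (one_mem _)
    have h2 := hmul x⁻¹ x
    rw [inv_mul_cancel, h1] at h2
    exact eq_neg_of_add_eq_zero_left h2.symm
  have hcm : ∀ a ∈ Subgroup.center E, ∀ x, x * a = a * x := fun a ha x =>
    Subgroup.mem_center_iff.1 ha x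
  -- Commutators are central, so the commutator map is multiplicative in each argument.
  have hl : ∀ x x' y, κ (x * x' * y * (x * x')⁻¹ * y⁻¹) =
      κ (x * y * x⁻¹ * y⁻¹) + κ (x' * y * x'⁻¹ * y⁻¹) := by
    intro x x' y
    rw [← hκ _ (hcomm x y) _ (hcomm x' y)]
    congr 1
    have h := hcm _ (hcomm x' y) (x * y * x⁻¹ * y⁻¹)
    have h' := hcm _ (hcomm x' y) x
    calc x * x' * y * (x * x')⁻¹ * y⁻¹
        = (x * (x' * y * x'⁻¹ * y⁻¹)) * (y * x⁻¹ * y⁻¹) := by group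
      _ = ((x' * y * x'⁻¹ * y⁻¹) * x) * (y * x⁻¹ * y⁻¹) := by rw [h']
      _ = (x' * y * x'⁻¹ * y⁻¹) * (x * y * x⁻¹ * y⁻¹) := by group
      _ = _ := h.symm
  have hr : ∀ x y y', κ (x * (y * y') * x⁻¹ * (y * y')⁻¹) =
      κ (x * y * x⁻¹ * y⁻¹) + κ (x * y' * x⁻¹ * y'⁻¹) := by
    intro x y y'
    rw [← hκ _ (hcomm x y) _ (hcomm x y')]
    congr 1
    have h' := hcm _ (hcomm x y') y
    calc x * (y * y') * x⁻¹ * (y * y')⁻¹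
        = x * y * x⁻¹ * ((x * y' * x⁻¹ * y'⁻¹) * y⁻¹) := by group
      _ = x * y * x⁻¹ * (y⁻¹ * (x * y' * x⁻¹ * y'⁻¹)) := by
        rw [hcm _ (hcomm x y') y⁻¹]
      _ = _ := by group
  have hone : κ 1 = 0 := by
    have := hκ 1 (one_mem _) 1 (one_mem _)
    simpa using this
  have hwd : ∀ x x' y y', π x = π x' → π y = π y' →
      κ (x * y * x⁻¹ * y⁻¹) = κ (x' * y' * x'⁻¹ * y'⁻¹) := by
    intro x x' y y' hx hy
    have h1 : x'⁻¹ * x ∈ Subgroup.center E := by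
      rw [← hker, hmul, hinv, hx]; simp
    have h2 : y'⁻¹ * y ∈ Subgroup.center E := by
      rw [← hker, hmul, hinv, hy]; simp
    have e1 : x = x' * (x'⁻¹ * x) := by group
    have e2 : y = y' * (y'⁻¹ * y) := by group
    have e3 : κ ((x'⁻¹ * x) * y * (x'⁻¹ * x)⁻¹ * y⁻¹) = 0 := by
      rw [← hcm _ h1 y, ← hone]; congr 1; group
    have e4 : κ (x' * (y'⁻¹ * y) * x'⁻¹ * (y'⁻¹ * y)⁻¹) = 0 := by
      rw [hcm _ h2 x', ← hone]; congr 1; group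
    rw [e1, hl, e3, add_zero, e2, hr, e4, add_zero]
  obtain ⟨s, hs⟩ := hsurj.hasRightInverse
  let W : M → M → ZMod p := fun a b => κ (s a * s b * (s a)⁻¹ * (s b)⁻¹)
  have hW : ∀ x y, W (π x) (π y) = κ (x * y * x⁻¹ * y⁻¹) := fun x y =>
    hwd _ _ _ _ (hs _) (hs _)
  have hWl : ∀ a a' b, W (a + a') b = W a b + W a' b := by
    intro a a' b
    obtain ⟨x, rfl⟩ := hsurj a
    obtain ⟨x', rfl⟩ := hsurj a'
    obtain ⟨y, rfl⟩ := hsurj b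
    rw [← hmul, hW, hW, hW, hl]
  have hWr : ∀ a b b', W a (b + b') = W a b + W a b' := by
    intro a b b'
    obtain ⟨x, rfl⟩ := hsurj a
    obtain ⟨y, rfl⟩ := hsurj b
    obtain ⟨y', rfl⟩ := hsurj b'
    rw [← hmul, hW, hW, hW, hr]
  refine ⟨LinearMap.mk₂ (ZMod p) W hWl ?_ hWr ?_, ?_, ?_, hW⟩
  · intro c a b
    exact ZMod.map_smul (AddMonoidHom.mk' (fun a => W a b) (fun a a' => hWl a a' b)) c a
  · intro c a b
    exact ZMod.map_smul (AddMonoidHom.mk' (fun b => W a b) (fun b b' => hWr a b b')) c b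
  · intro a
    obtain ⟨x, rfl⟩ := hsurj a
    change W _ _ = 0
    rw [hW, ← hone]; congr 1; group
  · intro a ha
    obtain ⟨x, rfl⟩ := hsurj a
    rw [hker, Subgroup.mem_center_iff]
    intro y
    have h1 : W (π x) (π y) = 0 := ha (π y)
    rw [hW] at h1
    have h2 := hκ0 _ (hcomm x y) h1
    rw [mul_inv_eq_one, mul_inv_eq_iff_eq_mul] at h2
    exact h2.symm

end Quotient

/-! ### Odd primes: from the extraspecial group to a Weyl system -/

section WeylSystem

/-- The elements inverted by an automorphism that inverts `E / Z(E)` form a section. -/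
theorem exists_inverted_section {p : ℕ} [Fact p.Prime] (hp : p ≠ 2) {E M : Type*} [Group E]
    [AddCommGroup M] [Module (ZMod p) M] (hcard : Nat.card (Subgroup.center E) = p)
    {π : E → M} (hsurj : Function.Surjective π) (hmul : ∀ x y, π (x * y) = π x + π y)
    (hker : ∀ x, π x = 0 ↔ x ∈ Subgroup.center E) (κ : E → ZMod p)
    (hκ : ∀ a ∈ Subgroup.center E, ∀ b ∈ Subgroup.center E, κ (a * b) = κ a + κ b)
    (ω : LinearMap.BilinForm (ZMod p) M) (hω : ∀ x y, ω (π x) (π y) = κ (x * y * x⁻¹ * y⁻¹))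
    (θ : MulAut E) (hθπ : ∀ x, π (θ x) = -π x) (hθZ : ∀ c ∈ Subgroup.center E, θ c = c) :
    ∃ D : M → E, (∀ w, π (D w) = w) ∧ (∀ w, θ (D w) = (D w)⁻¹) ∧
      (∀ x, θ x = x⁻¹ → x = D (π x)) ∧
      ∀ u w, ∃ c ∈ Subgroup.center E, D u * D w = c * D (u + w) ∧ κ c = 2⁻¹ * ω u w := by
  have hpp := Fact.out (p := p.Prime)
  have hodd : Odd p := hpp.odd_of_ne_two hp
  have hinv : ∀ x, π x⁻¹ = - π x := by
    intro x
    have h1 : π 1 = 0 := (hker 1).2 (one_mem _)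
    have h2 := hmul x⁻¹ x
    rw [inv_mul_cancel, h1] at h2
    exact eq_neg_of_add_eq_zero_left h2.symm
  have hcm : ∀ a ∈ Subgroup.center E, ∀ x, x * a = a * x := fun a ha x =>
    Subgroup.mem_center_iff.1 ha x
  have hpow : ∀ c ∈ Subgroup.center E, c ^ p = 1 := by
    intro c hc
    have h := pow_card_eq_one' (x := (⟨c, hc⟩ : Subgroup.center E))
    rw [hcard] at h
    exact congrArg Subtype.val h
  -- The quotient `x⁻¹ y` is central and fixed by `θ`, which makes it an element of square `1` in a
  -- group of odd order.
  have huniq : ∀ x y, θ x = x⁻¹ → θ y = y⁻¹ → π x = π y → x = y := by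
    intro x y hx hy hxy
    have hd : x⁻¹ * y ∈ Subgroup.center E := by rw [← hker, hmul, hinv, hxy]; simp
    have h1 : θ (x⁻¹ * y) = x * y⁻¹ := by rw [map_mul, map_inv, hx, hy, inv_inv]
    rw [hθZ _ hd] at h1
    have h2 : (x⁻¹ * y) * (x⁻¹ * y) = 1 := by
      have h3 := hcm _ hd x⁻¹
      calc (x⁻¹ * y) * (x⁻¹ * y) = ((x⁻¹ * y) * x⁻¹) * y := by group
        _ = (x⁻¹ * (x⁻¹ * y)) * y := by rw [h3]
        _ = (x⁻¹ * (x * y⁻¹)) * y := by rw [h1]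
        _ = 1 := by group
    obtain ⟨j, hj⟩ := hodd
    have h3 := hpow _ hd
    rw [hj, pow_succ, pow_mul, pow_two, h2, one_pow, one_mul] at h3
    rw [inv_mul_eq_one] at h3
    exact h3
  have hex : ∀ w, ∃ x, π x = w ∧ θ x = x⁻¹ := by
    intro w
    obtain ⟨x, rfl⟩ := hsurj w
    have hc : θ x * x ∈ Subgroup.center E := by rw [← hker, hmul, hθπ]; simp
    obtain ⟨j, hj⟩ := hodd
    set c := θ x * x with hcdef
    have hcj : c ^ j ∈ Subgroup.center E := pow_mem hc j
    -- The defect `c = θ(x) x` is central. Multiplying `x` by `c ^ j` changes it to `c ^ (1 + 2j) =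
    -- c ^ p = 1`.
    refine ⟨x * c ^ j, ?_, ?_⟩
    · rw [hmul, (hker _).2 hcj, add_zero]
    · rw [map_mul, hθZ _ hcj, eq_inv_iff_mul_eq_one]
      calc θ x * c ^ j * (x * c ^ j) = θ x * (c ^ j * x) * c ^ j := by group
        _ = θ x * (x * c ^ j) * c ^ j := by rw [← hcm _ hcj x]
        _ = c * c ^ j * c ^ j := by rw [hcdef]; group
        _ = c ^ p := by rw [hj]; group
        _ = 1 := hpow _ hc
  choose D hD hDθ using hex
  refine ⟨D, hD, hDθ, fun x hx => huniq _ _ hx (hDθ _) (hD _).symm, fun u w => ?_⟩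
  have hc : D u * D w * (D (u + w))⁻¹ ∈ Subgroup.center E := by
    rw [← hker, hmul, hmul, hinv, hD, hD, hD]; simp
  refine ⟨_, hc, by group, ?_⟩
  set c := D u * D w * (D (u + w))⁻¹ with hcdef
  have hCe : D (u + w) = c⁻¹ * (D u * D w) := by rw [hcdef]; group
  -- Applying `θ` to the definition of `c` inverts the three factors and fixes `c`. Combining both
  -- equations shows that a commutator is `c²`, which accounts for the factor `2⁻¹`.
  have h1 : (D u)⁻¹ * (D w)⁻¹ * D (u + w) = c := by
    rw [← hθZ c hc, hcdef, map_mul, map_mul, map_inv, hDθ, hDθ, hDθ, inv_inv]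
  have h2 : (D u)⁻¹ * (D w)⁻¹ * D u * D w = c * c := by
    rw [hCe] at h1
    have h3 := hcm _ (inv_mem hc) ((D u)⁻¹ * (D w)⁻¹)
    rw [← mul_assoc, h3] at h1
    rw [← mul_right_inj c⁻¹]
    calc _ = c⁻¹ * ((D u)⁻¹ * (D w)⁻¹) * (D u * D w) := by group
      _ = c := h1
      _ = _ := by group
  have h4 := hω (D u)⁻¹ (D w)⁻¹
  rw [hinv, hinv, hD, hD, inv_inv, inv_inv, h2, hκ c hc c hc] at h4
  simp only [map_neg, LinearMap.neg_apply, neg_neg] at h4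
  have h20 : (2 : ZMod p) ≠ 0 := by
    intro h
    have := (ZMod.natCast_eq_zero_iff 2 p).1 (by exact_mod_cast h)
    exact hp ((Nat.prime_dvd_prime_iff_eq hpp Nat.prime_two).1 this)
  rw [h4]
  field_simp
  ring

variable {V : Type*} [NormedAddCommGroup V] [InnerProductSpace ℂ V]

theorem exists_stdAddChar_eq {p : ℕ} [Fact p.Prime] {c : ℂ} (h : c ^ p = 1) :
    ∃ k : ZMod p, ZMod.stdAddChar k = c := by
  have hpp := Fact.out (p := p.Prime)
  have h1 : IsPrimitiveRoot (ZMod.stdAddChar (1 : ZMod p) : ℂ) p := by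
    have := Complex.isPrimitiveRoot_exp p hpp.ne_zero
    convert this using 1
    have h2 := ZMod.stdAddChar_coe (N := p) 1
    simpa using h2
  obtain ⟨i, -, hi⟩ := h1.eq_pow_of_pow_eq_one h
  refine ⟨(i : ZMod p), ?_⟩
  rw [← hi, ← AddChar.map_nsmul_eq_pow, nsmul_one]

/-- An involutory permutation of a set of odd size has a fixed point. -/
theorem exists_fixed_line {L : Set (Submodule ℂ V)} (hodd : Odd L.ncard)
    (g : V ≃ₗᵢ[ℂ] V) (hg : g * g = 1) (hL : ∀ l ∈ L, moveLine g l ∈ L) :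
    ∃ l ∈ L, moveLine g l = l := by
  have hfin : L.Finite := Set.finite_of_ncard_pos hodd.pos
  have := hfin.fintype
  have hinv : ∀ l, moveLine g (moveLine g l) = l := fun l => by
    rw [← moveLine_mul, hg, moveLine_one]
  let τ : Equiv.Perm L :=
    { toFun := fun l => ⟨moveLine g l.1, hL _ l.2⟩
      invFun := fun l => ⟨moveLine g l.1, hL _ l.2⟩
      left_inv := fun l => Subtype.ext (hinv _)
      right_inv := fun l => Subtype.ext (hinv _) }
  have h2 : ¬ 2 ∣ Fintype.card L := by
    rw [← Nat.card_eq_fintype_card, Nat.card_coe_set_eq]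
    exact hodd.not_two_dvd_nat
  obtain ⟨a, ha⟩ := Equiv.Perm.exists_fixed_point_of_prime (p := 2) (n := 1) h2 (σ := τ) (by
    rw [pow_one, pow_two]
    exact Equiv.ext fun l => Subtype.ext (hinv _))
  exact ⟨a.1, a.2, congrArg Subtype.val ha⟩

open SymplecticSpace

/-- The central involution `z` of `S` fixes a line `⟨v⟩` and inverts `E/Z`. The elements inverted by
`z` give the operators `D w`, and the stabilizer of `⟨v⟩` permutes exactly these elements, without
extra central factors, so `⟨v, D w v⟩` does not depend on `w ≠ 0`. -/
theorem exists_weyl_system {p m : ℕ} [Fact p.Prime] (hp : p ≠ 2) (hm : 0 < m)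
    {L : Set (Submodule ℂ V)} (hL : IsEquiangularLineSet L) (hn : L.ncard = p ^ (2 * m))
    {E S : Type*} [Group E] [Group S] {φ : S →* MulAut E} (hcard : Nat.card E = p ^ (1 + 2 * m))
    {ρ : E →* (V ≃ₗᵢ[ℂ] V)} {σ : S →* (V ≃ₗᵢ[ℂ] V)}
    (h : IsLineConfiguration p L ρ σ φ (Subgroup.center E)) (hE : IsExtraspecial p E)
    (hS : Nonempty (S ≃* Sp m p)) :
    ∃ (v : V) (D : Std (ZMod p) m → (V ≃ₗᵢ[ℂ] V)) (c : ℂ), ‖v‖ = 1 ∧ (∀ x, D 0 x = x) ∧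
      (∀ u w x, D u (D w x) =
        (ZMod.stdAddChar (2⁻¹ * stdForm (ZMod p) m u w) : ℂ) • D (u + w) x) ∧
      L = (Set.range fun w => Submodule.span ℂ {D w v}) ∧
      ∀ w, w ≠ 0 → inner ℂ v (D w v) = c := by
  have hpp := Fact.out (p := p.Prime)
  have hoddp : Odd p := hpp.odd_of_ne_two hp
  have hoddL : Odd L.ncard := by rw [hn]; exact hoddp.pow
  -- the symplectic group
  obtain ⟨eS⟩ := hS
  let τ : StdGroup p m →* S := eS.symm.toMonoidHom.comp (toSp p m)
  have hτ : Function.Surjective τ := eS.symm.surjective.comp toSp_surjective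
  let z : S := τ (negOne p m)
  have hzz : z * z = 1 := by rw [← map_mul, negOne_mul_self, map_one]
  have hzc : ∀ s, s * z = z * s := by
    intro s
    obtain ⟨g, rfl⟩ := hτ s
    rw [← map_mul, negOne_comm, map_mul]
  -- a line fixed by the central involution
  obtain ⟨l, hl, hzl⟩ := exists_fixed_line hoddL (σ z) (by rw [← map_mul, hzz, map_one])
    (fun l hl => h.map_mem z l hl)
  obtain ⟨v, hv, rfl⟩ := hL.exists_unit hl
  have hv0 : v ≠ 0 := by rintro rfl; simp at hv
  -- the center
  have hZex : ∀ e ∈ Subgroup.center E, ∃ k : ZMod p, ∀ x, ρ e x = (ZMod.stdAddChar k : ℂ) • x := by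
    intro e he
    obtain ⟨c, hc⟩ := (h.mem_iff e).1 he
    have hep : e ^ p = 1 := by
      have h1 := pow_card_eq_one' (x := (⟨e, he⟩ : Subgroup.center E))
      rw [h.card_eq] at h1
      exact congrArg Subtype.val h1
    have hk : ∀ k : ℕ, ρ (e ^ k) v = c ^ k • v := by
      intro k
      induction k with
      | zero => simp
      | succ k ih =>
        rw [pow_succ', map_mul, LinearIsometryEquiv.coe_mul, Function.comp_apply, ih, hc, smul_smul,
          pow_succ']
    have h2 := hk p
    rw [hep, map_one] at h2
    have h3 : c ^ p = 1 := by
      have h4 : (1 - c ^ p) • v = 0 := by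
        rw [sub_smul, one_smul, ← h2]; simp
      rcases smul_eq_zero.1 h4 with h5 | h5
      · exact (sub_eq_zero.1 h5).symm
      · exact absurd h5 hv0
    obtain ⟨k, rfl⟩ := exists_stdAddChar_eq h3
    exact ⟨k, hc⟩
  -- The logarithm of the scalar by which a central element acts; its value `0` off the center is
  -- irrelevant.
  have hκex : ∀ e, ∃ k : ZMod p, e ∈ Subgroup.center E →
      ∀ x, ρ e x = (ZMod.stdAddChar k : ℂ) • x := by
    intro e
    by_cases he : e ∈ Subgroup.center E
    · obtain ⟨k, hk⟩ := hZex e he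
      exact ⟨k, fun _ => hk⟩
    · exact ⟨0, fun h => absurd h he⟩
  choose κ hκρ using hκex
  have hchar : ∀ k k' : ZMod p, (ZMod.stdAddChar k : ℂ) • v = (ZMod.stdAddChar k' : ℂ) • v →
      k = k' := fun k k' hk => ZMod.injective_stdAddChar (smul_left_injective ℂ hv0 hk)
  have hκ : ∀ a ∈ Subgroup.center E, ∀ b ∈ Subgroup.center E, κ (a * b) = κ a + κ b := by
    intro a ha b hb
    apply hchar
    rw [← hκρ _ (mul_mem ha hb), map_mul, LinearIsometryEquiv.coe_mul, Function.comp_apply,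
      hκρ _ hb, hκρ _ ha, smul_smul, AddChar.map_add_eq_mul]
  have hκ0 : ∀ a ∈ Subgroup.center E, κ a = 0 → a = 1 := by
    intro a ha h0
    apply h.injective
    refine LinearIsometryEquiv.ext fun x => ?_
    rw [hκρ a ha, h0, AddChar.map_zero_eq_one, one_smul, map_one]; rfl
  have hφZ : ∀ s, ∀ c ∈ Subgroup.center E, φ s c = c := by
    intro s c hc
    apply h.injective
    refine LinearIsometryEquiv.ext fun x => ?_
    rw [h.conj_eq, LinearIsometryEquiv.coe_mul, LinearIsometryEquiv.coe_mul, Function.comp_apply,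
      Function.comp_apply, hκρ c hc, hκρ c hc, map_smul]
    congr 1
    exact (σ s).apply_symm_apply x
  -- the quotient
  have hcomm : ∀ x y : E, x * y * x⁻¹ * y⁻¹ ∈ Subgroup.center E := by
    intro x y
    rw [← hE.commutator_eq_center]
    exact Subgroup.commutator_mem_commutator (Subgroup.mem_top x) (Subgroup.mem_top y)
  have hpow : ∀ x : E, x ^ p ∈ Subgroup.center E := by
    intro x
    rw [← QuotientGroup.eq_one_iff, QuotientGroup.mk_pow]
    exact hE.elementaryAbelian_quotient.2 _
  obtain ⟨M, _, _, π, f, hsurj, hmul, hker, hfπ, hcM⟩ := exists_module_quotient φ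
    (Subgroup.center E) hcomm hpow (fun s e he => by rwa [hφZ s e he])
  obtain ⟨ω, hωa, hωn, hω⟩ := exists_commutator_form hcomm hsurj hmul hker κ hκ hκ0
  have hcM' : Nat.card M = p ^ (2 * m) := by
    rw [hE.card_center, hcard, pow_add, pow_one] at hcM
    exact Nat.eq_of_mul_eq_mul_left hpp.pos hcM
  have hfinM : Finite M := Nat.finite_of_card_ne_zero (by
    rw [hcM']; exact (pow_pos hpp.pos _).ne')
  obtain ⟨m', e, he⟩ := exists_std_isometry _ M ω hωa hωn rfl
  obtain rfl : m' = m := by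
    have h1 := Nat.card_congr e.toEquiv
    rw [natCard_std, hcM'] at h1
    have := Nat.pow_right_injective hpp.two_le h1
    omega
  have hω_inv : ∀ s x y, ω (f s x) (f s y) = ω x y := by
    intro s a b
    obtain ⟨x, rfl⟩ := hsurj a
    obtain ⟨y, rfl⟩ := hsurj b
    rw [hfπ, hfπ, hω, hω, ← map_mul, ← map_inv, ← map_mul, ← map_inv, ← map_mul,
      hφZ s _ (hcomm x y)]
  have htr : ∀ x y : M, x ≠ 0 → y ≠ 0 → ∃ g, (f.comp τ) g x = y := by
    intro a b ha hb
    obtain ⟨x, rfl⟩ := hsurj a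
    obtain ⟨y, rfl⟩ := hsurj b
    obtain ⟨e', s, -, hes⟩ := h.transitive v hl x (fun hx => ha ((hker x).2 hx)) y
      (fun hy => hb ((hker y).2 hy))
    obtain ⟨g, rfl⟩ := hτ s
    refine ⟨g, ?_⟩
    rw [← hker] at hes
    have h1 : ∀ x, π x⁻¹ = - π x := by
      intro x
      have h1 : π 1 = 0 := (hker 1).2 (one_mem _)
      have h2 := hmul x⁻¹ x
      rw [inv_mul_cancel, h1] at h2
      exact eq_neg_of_add_eq_zero_left h2.symm
    rw [hmul, hmul, hmul, h1, h1] at hes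
    rw [MonoidHom.comp_apply, hfπ]
    rw [neg_add_eq_zero] at hes
    rw [hes]; abel
  have hneg : ∀ x, π (φ z x) = -π x := by
    intro x
    rw [← hfπ]
    exact map_neg_one hp hm ω e he (f.comp τ) (fun g => hω_inv (τ g)) htr (negOne p m')
      negOne_apply (π x)
  obtain ⟨D, hD, hDθ, hDu, hDm⟩ := exists_inverted_section hp hE.card_center hsurj hmul hker κ hκ ω
    hω (φ z) hneg (hφZ z)
  have hD0 : D 0 = 1 := by
    have h1 := hDu 1 (by simp)
    rw [(hker 1).2 (one_mem _)] at h1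
    exact h1.symm
  have hDne : ∀ w, w ≠ 0 → D w ∉ Subgroup.center E := by
    intro w hw hc
    rw [← hker, hD] at hc
    exact hw hc
  have hconst : ∀ a b : M, a ≠ 0 → b ≠ 0 → inner ℂ v (ρ (D b) v) = inner ℂ v (ρ (D a) v) := by
    intro a b ha hb
    obtain ⟨e', s, ⟨c, hc⟩, hes⟩ := h.transitive v hl _ (hDne a ha) _ (hDne b hb)
    -- This element acts as the commutator of `z` with `e' s`, because `z` and `s` commute. Both
    -- factors fix `⟨v⟩`, so it does too.
    have hd : φ z e' * e'⁻¹ ∈ Subgroup.center E := by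
      apply h.stabilizer v hl
      rw [← moveLine_span_eq_iff]
      have hg : ρ e' * σ s ∈ lineStabilizer (MonoidHom.id _) (Submodule.span ℂ {v}) :=
        moveLine_span_eq_iff.2 ⟨c, hc⟩
      have hz' : σ z ∈ lineStabilizer (MonoidHom.id _) (Submodule.span ℂ {v}) := hzl
      have := mul_mem (mul_mem (mul_mem hz' hg) (inv_mem hz')) (inv_mem hg)
      have e1 : ρ (φ z e' * e'⁻¹) = σ z * (ρ e' * σ s) * (σ z)⁻¹ * (ρ e' * σ s)⁻¹ := by
        have e2 : σ s * (σ z)⁻¹ = (σ z)⁻¹ * σ s := by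
          rw [mul_inv_eq_iff_eq_mul, mul_assoc, ← map_mul, hzc, map_mul, inv_mul_cancel_left]
        rw [map_mul, h.conj_eq, map_inv, mul_inv_rev]
        calc _ = σ z * ρ e' * ((σ z)⁻¹ * σ s) * (σ s)⁻¹ * (ρ e')⁻¹ := by group
          _ = _ := by rw [← e2]; group
      rw [e1]
      exact this
    set x' := e' * φ s (D a) * e'⁻¹ with hx'
    have hθx : φ z x' = x'⁻¹ := by
      have e1 : φ z e' = (φ z e' * e'⁻¹) * e' := by group
      have e2 : φ z (φ s (D a)) = (φ s (D a))⁻¹ := by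
        rw [← MulAut.mul_apply, ← map_mul, ← hzc, map_mul, MulAut.mul_apply, hDθ, map_inv]
      have e3 := Subgroup.mem_center_iff.1 hd
      rw [hx', map_mul, map_mul, map_inv, e2, e1]
      set d := φ z e' * e'⁻¹
      calc d * e' * (φ s (D a))⁻¹ * (d * e')⁻¹ = d * (e' * (φ s (D a))⁻¹ * e'⁻¹) * d⁻¹ := by group
        _ = (e' * (φ s (D a))⁻¹ * e'⁻¹) * d * d⁻¹ := by rw [e3]
        _ = _ := by group
    -- Equality holds in `E`, not only modulo the center, because `x'` is inverted by `z`.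
    have hxb : x' = D b := by
      have e1 : π x' = b := by
        rw [← hker, hmul] at hes
        have e2 : π (D b) + π (D b)⁻¹ = 0 := by
          rw [← hmul, mul_inv_cancel, hker]; exact one_mem _
        rw [eq_neg_of_add_eq_zero_right e2, hD, neg_add_eq_zero] at hes
        exact hes.symm
      rw [← e1]; exact hDu x' hθx
    have hcn : ‖c‖ = 1 := by
      have e1 := congrArg norm hc
      rwa [LinearIsometryEquiv.norm_map, LinearIsometryEquiv.norm_map, norm_smul, hv, mul_one,
        eq_comm] at e1
    have e1 : ρ x' (ρ e' (σ s v)) = ρ e' (σ s (ρ (D a) v)) := by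
      have : ρ x' * (ρ e' * σ s) = ρ e' * σ s * ρ (D a) := by
        rw [hx', map_mul, map_mul, map_inv, h.conj_eq]; group
      exact congrArg (fun g : V ≃ₗᵢ[ℂ] V => g v) this
    have e2 : inner ℂ (ρ e' (σ s v)) (ρ x' (ρ e' (σ s v))) = inner ℂ v (ρ (D a) v) := by
      rw [e1, LinearIsometryEquiv.inner_map_map, LinearIsometryEquiv.inner_map_map]
    rw [hc, map_smul, inner_smul_left, inner_smul_right, ← mul_assoc, RCLike.conj_mul, hcn] at e2
    rw [← hxb]
    simpa using e2
  obtain ⟨a, ha⟩ := exists_basis_vector (p := p) hm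
  refine ⟨v, fun w => ρ (D (e w)), inner ℂ v (ρ (D (e a)) v), hv, ?_, ?_, ?_, ?_⟩
  · intro x; change ρ (D (e 0)) x = x; rw [map_zero, hD0, map_one]; rfl
  · intro u w x
    obtain ⟨c, hc, h1, h2⟩ := hDm (e u) (e w)
    change ρ (D (e u)) (ρ (D (e w)) x) = _ • ρ (D (e (u + w))) x
    rw [← he, ← h2, map_add, ← hκρ c hc]
    have := congrArg (fun g => ρ g x) h1
    simpa [map_mul] using this
  · rw [h.lines_eq v hl]
    apply Set.eq_of_subset_of_subset
    · rintro _ ⟨x, rfl⟩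
      obtain ⟨w, hw⟩ := e.surjective (π x)
      refine ⟨w, ?_⟩
      have hc : x * (D (e w))⁻¹ ∈ Subgroup.center E := by
        have e2 : π (D (e w)) + π (D (e w))⁻¹ = 0 := by
          rw [← hmul, mul_inv_cancel, hker]; exact one_mem _
        rw [← hker, hmul, eq_neg_of_add_eq_zero_right e2, hD, hw]; simp
      have e1 : ρ x v = (ZMod.stdAddChar (κ (x * (D (e w))⁻¹)) : ℂ) • ρ (D (e w)) v := by
        rw [← hκρ _ hc]
        have : ρ x = ρ (x * (D (e w))⁻¹) * ρ (D (e w)) := by rw [← map_mul]; simp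
        exact congrArg (fun g : V ≃ₗᵢ[ℂ] V => g v) this
      have hu : IsUnit (ZMod.stdAddChar (κ (x * (D (e w))⁻¹)) : ℂ) :=
        ((ZMod.stdAddChar (N := p)).val_isUnit _)
      change _ = Submodule.span ℂ {ρ x v}
      rw [e1, Submodule.span_singleton_smul_eq hu]
    · rintro _ ⟨w, rfl⟩
      exact ⟨D (e w), rfl⟩
  · intro w hw
    exact hconst _ _ (e.map_ne_zero_iff.2 ha) (e.map_ne_zero_iff.2 hw)

end WeylSystem

/-! ### Gram matrices with two eigenvalues, and scaling -/

section Gram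

variable {V V' : Type*} [NormedAddCommGroup V] [InnerProductSpace ℂ V]
  [NormedAddCommGroup V'] [InnerProductSpace ℂ V']

/-- Dependent vectors whose Gram matrix is a combination of the identity and of a square root of a
scalar matrix. -/
theorem exists_sign_of_gram {ι : Type*} [Fintype ι] [DecidableEq ι] [FiniteDimensional ℂ V] (x : ι → V)
    (hd : Module.finrank ℂ V < Fintype.card ι) (n s : ℂ) (K : ι → ι → ℂ)
    (hG : ∀ i j, inner ℂ (x i) (x j) = (1 - s) * (if i = j then 1 else 0) + s * K i j)
    (hK : ∀ i k, ∑ j, K i j * K j k = if i = k then n ^ 2 else 0) :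
    ∃ ε : ℤˣ, s * (n + ((ε : ℤ) : ℂ)) = ((ε : ℤ) : ℂ) := by
  have hdep : ¬ LinearIndependent ℂ x := fun h => by
    have := h.fintype_card_le_finrank
    omega
  obtain ⟨a, ha, i₀, hi₀⟩ := Fintype.not_linearIndependent_iff.1 hdep
  -- The coefficients of a linear relation lie in the kernel of the Gram matrix `(1 - s)I + sK`.
  have h1 : ∀ i, (1 - s) * a i + s * ∑ j, K i j * a j = 0 := by
    intro i
    have h2 : inner ℂ (x i) (∑ j, a j • x j) = 0 := by rw [ha, inner_zero_right]
    rw [inner_sum] at h2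
    simp only [inner_smul_right, hG] at h2
    rw [← h2, Finset.mul_sum]
    simp only [mul_add, Finset.sum_add_distrib, mul_ite, mul_one, mul_zero]
    rw [Finset.sum_ite_eq]
    simp only [Finset.mem_univ, if_true]
    congr 1
    · ring
    · exact Finset.sum_congr rfl fun j _ => by ring
  have h3 : (1 - s) * ∑ j, K i₀ j * a j + s * (n ^ 2 * a i₀) = 0 := by
    have h4 : ∑ i, K i₀ i * ((1 - s) * a i + s * ∑ j, K i j * a j) = 0 :=
      Finset.sum_eq_zero fun i _ => by rw [h1, mul_zero]
    have h5 : ∑ i, K i₀ i * ∑ j, K i j * a j = n ^ 2 * a i₀ := by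
      simp only [Finset.mul_sum]
      rw [Finset.sum_comm]
      have : ∀ j, ∑ i, K i₀ i * (K i j * a j) = (if i₀ = j then n ^ 2 else 0) * a j := by
        intro j
        rw [← hK, Finset.sum_mul]
        exact Finset.sum_congr rfl fun i _ => by ring
      simp only [this, ite_mul, zero_mul, Finset.sum_ite_eq, Finset.mem_univ, if_true]
    rw [← h4, ← h5, Finset.mul_sum, Finset.mul_sum, ← Finset.sum_add_distrib]
    exact Finset.sum_congr rfl fun i _ => by ring
  -- Multiplying by `(1 - s)I - sK` turns the kernel equation into a scalar one, since `K² = n² I`.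
  have h6 : ((1 - s) - s * n) * ((1 - s) + s * n) = 0 := by
    have h7 : (((1 - s) - s * n) * ((1 - s) + s * n)) * a i₀ = 0 := by
      have := h1 i₀
      linear_combination (1 - s) * this - s * h3
    exact (mul_eq_zero.1 h7).resolve_right hi₀
  rcases mul_eq_zero.1 h6 with h | h
  · exact ⟨1, by push_cast; linear_combination -h⟩
  · exact ⟨-1, by push_cast; linear_combination h⟩

/-- Scaling the first family by `√C` makes the Gram matrices equal and leaves the lines unchanged.
-/
theorem lineSetEquivalent_of_gram {ι : Type*} [Finite ι] (x : ι → V) (y : ι → V') {C : ℝ}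
    (hC : 0 < C) (hG : ∀ i j, inner ℂ (y i) (y j) = (C : ℂ) * inner ℂ (x i) (x j))
    (hx : Submodule.span ℂ (Set.range x) = ⊤) (hy : Submodule.span ℂ (Set.range y) = ⊤) :
    LineSetEquivalent (Set.range fun i => Submodule.span ℂ {x i})
      (Set.range fun i => Submodule.span ℂ {y i}) := by
  have hr0 : (Real.sqrt C : ℂ) ≠ 0 := by
    exact_mod_cast (Real.sqrt_pos.2 hC).ne'
  have hrr : (Real.sqrt C : ℂ) * Real.sqrt C = C := by
    exact_mod_cast Real.mul_self_sqrt hC.le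
  have hspan : Submodule.span ℂ (Set.range fun i => (Real.sqrt C : ℂ) • x i) = ⊤ := by
    rw [eq_top_iff, ← hx, Submodule.span_le]
    rintro _ ⟨i, rfl⟩
    have : x i = (Real.sqrt C : ℂ)⁻¹ • ((Real.sqrt C : ℂ) • x i) := by
      rw [smul_smul, inv_mul_cancel₀ hr0, one_smul]
    rw [this]
    exact Submodule.smul_mem _ _ (Submodule.subset_span ⟨i, rfl⟩)
  obtain ⟨g, hg⟩ := exists_isometry_of_inner_eq (fun i => (Real.sqrt C : ℂ) • x i) y (by
    intro i j
    rw [inner_smul_left, inner_smul_right, hG, Complex.conj_ofReal, ← mul_assoc, hrr]) hspan hy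
  refine ⟨g, ?_⟩
  rw [← Set.range_comp]
  congr 1
  funext i
  rw [Function.comp_apply, moveLine_span, ← hg i, map_smul,
    Submodule.span_singleton_smul_eq (IsUnit.mk0 _ hr0)]

theorem span_range_of_lines {ι : Type*} {L : Set (Submodule ℂ V)} (hL : sSup L = ⊤) {x : ι → V}
    (hx : L = Set.range fun i => Submodule.span ℂ {x i}) :
    Submodule.span ℂ (Set.range x) = ⊤ := by
  rw [eq_top_iff, ← hL, sSup_le_iff, hx]
  rintro _ ⟨i, rfl⟩
  exact Submodule.span_mono (by rintro _ rfl; exact ⟨i, rfl⟩)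

end Gram

/-! ### Character sums and abstract Weyl operators -/

section WeilTarget

open SymplecticSpace

variable {p m : ℕ} [Fact p.Prime]

open Classical in
theorem sum_stdAddChar_comp {A : Type*} [AddCommGroup A] [Fintype A] (B : A →+ ZMod p) :
    ∑ a, (ZMod.stdAddChar (B a) : ℂ) = if ∀ a, B a = 0 then (Fintype.card A : ℂ) else 0 := by
  have h := AddChar.sum_eq_ite ((ZMod.stdAddChar (N := p)).compAddMonoidHom B)
  simp only [AddChar.compAddMonoidHom_apply] at h
  rw [h]
  congr 1
  rw [eq_iff_iff]
  constructor
  · intro h0 a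
    have := DFunLike.congr_fun h0 a
    apply ZMod.injective_stdAddChar (N := p)
    rw [AddChar.map_zero_eq_one]
    exact this
  · intro h0
    ext a
    simp [h0]

theorem sum_stdAddChar_dotProduct (c : Fin m → ZMod p) :
    ∑ b : Fin m → ZMod p, (ZMod.stdAddChar (b ⬝ᵥ c) : ℂ) = if c = 0 then (p : ℂ) ^ m else 0 := by
  classical
  refine (sum_stdAddChar_comp (AddMonoidHom.mk' (fun b => b ⬝ᵥ c) fun a b => add_dotProduct a b c)).trans ?_
  have : (∀ b, b ⬝ᵥ c = 0) ↔ c = 0 := by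
    constructor
    · intro h
      exact dotProduct_eq _ _ fun b => by rw [dotProduct_comm, h, zero_dotProduct]
    · rintro rfl b; simp
  simp [this]

theorem two_ne_zero_zmod (hp : p ≠ 2) : (2 : ZMod p) ≠ 0 := by
  intro h
  have := (ZMod.natCast_eq_zero_iff 2 p).1 (by exact_mod_cast h)
  exact hp ((Nat.prime_dvd_prime_iff_eq Fact.out Nat.prime_two).1 this)

/-- The values of the commutator character in a system of Weyl operators. -/
noncomputable def weylKernel (u w : Std (ZMod p) m) : ℂ :=
  ZMod.stdAddChar (-(2⁻¹ * stdForm (ZMod p) m u w))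

theorem weylKernel_self (u : Std (ZMod p) m) : weylKernel u u = 1 := by
  rw [weylKernel, stdForm_isAlt u, mul_zero, neg_zero, AddChar.map_zero_eq_one]

-- Orthogonality of characters, with nondegeneracy of the symplectic form: the commutator matrix
-- squares to `p^(2m)` times the identity, as `exists_sign_of_gram` requires.
open Classical in
theorem sum_weylKernel (hp : p ≠ 2) (u v : Std (ZMod p) m) :
    ∑ w, weylKernel u w * weylKernel w v = if u = v then ((p : ℂ) ^ m) ^ 2 else 0 := by
  have h1 : ∀ w, weylKernel u w * weylKernel w v =
      ZMod.stdAddChar (2⁻¹ * stdForm (ZMod p) m w (u - v)) := by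
    intro w
    rw [weylKernel, weylKernel, ← AddChar.map_add_eq_mul, map_sub,
      ← neg_swap stdForm_isAlt u w]
    congr 1
    ring
  simp only [h1]
  refine (sum_stdAddChar_comp (AddMonoidHom.mk' (fun w => 2⁻¹ * stdForm (ZMod p) m w (u - v))
    fun a b => by simp [mul_add])).trans ?_
  have h2 := two_ne_zero_zmod hp
  have : (∀ w, 2⁻¹ * stdForm (ZMod p) m w (u - v) = 0) ↔ u = v := by
    constructor
    · intro h
      rw [← sub_eq_zero]
      apply eq_zero_of_stdForm_eq_zero
      intro w
      rw [← neg_swap stdForm_isAlt, (mul_eq_zero.1 (h w)).resolve_left (inv_ne_zero h2), neg_zero]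
    · rintro rfl w; simp
  have hc : (Fintype.card (Std (ZMod p) m) : ℂ) = ((p : ℂ) ^ m) ^ 2 := by
    rw [← Nat.card_eq_fintype_card, natCard_std]; push_cast; ring
  simp only [AddMonoidHom.mk'_apply, this, hc]

/-- Applying the unitary operator `D (-u)` to both arguments reduces a Gram entry to the difference
`w - u`. The rule serves both the given lines and the model. -/
theorem weyl_inner {V : Type*} [NormedAddCommGroup V] [InnerProductSpace ℂ V]
    (D : Std (ZMod p) m → (V ≃ₗᵢ[ℂ] V)) (h0 : ∀ x, D 0 x = x)
    (hD : ∀ u w x, D u (D w x) =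
      (ZMod.stdAddChar (2⁻¹ * stdForm (ZMod p) m u w) : ℂ) • D (u + w) x) (u w) (x y : V) :
    inner ℂ (D u x) (D w y) = weylKernel u w * inner ℂ x (D (w - u) y) := by
  rw [← (D (-u)).inner_map_map, hD, hD]
  have h1 : stdForm (ZMod p) m (-u) u = 0 := by
    rw [map_neg, LinearMap.neg_apply, stdForm_isAlt u, neg_zero]
  rw [h1, mul_zero, AddChar.map_zero_eq_one, one_smul, neg_add_cancel, h0, inner_smul_right,
    weylKernel, map_neg, LinearMap.neg_apply, mul_neg, neg_add_eq_sub]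

end WeilTarget

/-! ### The Schrödinger representation and traces on Weil modules -/

section WeilTarget

open SymplecticSpace

variable {p m : ℕ} [Fact p.Prime]

/-- The Weyl operators `f(x) ↦ ζ ^ (a ⬝ b / 2 + b ⬝ x) f(x + a)`. -/
noncomputable def weylOp (w : Std (ZMod p) m) : WeilSpace p m ≃ₗᵢ[ℂ] WeilSpace p m where
  toFun f := WithLp.toLp 2 fun x =>
    (ZMod.stdAddChar (2⁻¹ * (w.1 ⬝ᵥ w.2) + w.2 ⬝ᵥ x) : ℂ) * f (x + w.1)
  invFun f := WithLp.toLp 2 fun x =>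
    (ZMod.stdAddChar (-(2⁻¹ * (w.1 ⬝ᵥ w.2) + w.2 ⬝ᵥ (x - w.1))) : ℂ) * f (x - w.1)
  map_add' f g := by ext x; simp [mul_add]
  map_smul' c f := by ext x; simp [mul_left_comm]
  left_inv f := by
    ext x
    simp only [sub_add_cancel, ← mul_assoc]
    rw [← AddChar.map_add_eq_mul, neg_add_cancel, AddChar.map_zero_eq_one, one_mul]
  right_inv f := by
    ext x
    simp only [add_sub_cancel_right, ← mul_assoc]
    rw [← AddChar.map_add_eq_mul, add_neg_cancel, AddChar.map_zero_eq_one, one_mul]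
  norm_map' f := by
    rw [EuclideanSpace.norm_eq, EuclideanSpace.norm_eq]
    congr 1
    refine Eq.trans ?_ (Equiv.sum_comp (Equiv.addRight w.1) fun x => ‖f x‖ ^ 2)
    refine Finset.sum_congr rfl fun x _ => ?_
    simp only [LinearEquiv.coe_mk, LinearMap.coe_mk, AddHom.coe_mk, norm_mul, AddChar.norm_apply,
      one_mul, Equiv.coe_addRight]

theorem weylOp_apply (w : Std (ZMod p) m) (f : WeilSpace p m) (x : Fin m → ZMod p) :
    weylOp w f x = (ZMod.stdAddChar (2⁻¹ * (w.1 ⬝ᵥ w.2) + w.2 ⬝ᵥ x) : ℂ) * f (x + w.1) := rfl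

theorem weylOp_zero (f : WeilSpace p m) : weylOp 0 f = f := by
  ext x
  simp [weylOp_apply]

theorem weylOp_mul (hp : p ≠ 2) (u w : Std (ZMod p) m) (f : WeilSpace p m) :
    weylOp u (weylOp w f) =
      (ZMod.stdAddChar (2⁻¹ * stdForm (ZMod p) m u w) : ℂ) • weylOp (u + w) f := by
  have h2 := two_ne_zero_zmod hp
  ext x
  rw [PiLp.smul_apply, weylOp_apply, weylOp_apply, weylOp_apply, smul_eq_mul, ← mul_assoc,
    ← mul_assoc, ← AddChar.map_add_eq_mul, ← AddChar.map_add_eq_mul, Prod.fst_add, add_assoc x]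
  congr 2
  rw [stdForm_apply, Prod.snd_add]
  simp only [add_dotProduct, dotProduct_add]
  rw [dotProduct_comm u.2 w.1, dotProduct_comm w.2 u.1]
  field_simp
  ring

theorem stdAddChar_ne_zero (k : ZMod p) : (ZMod.stdAddChar k : ℂ) ≠ 0 := by
  rw [← norm_ne_zero_iff, AddChar.norm_apply]
  exact one_ne_zero

theorem weylOp_mem_heisenbergGroup (w : Std (ZMod p) m) : weylOp w ∈ heisenbergGroup p m :=
  Subgroup.subset_closure ⟨w.1, w.2, _, fun f x => weylOp_apply w f x⟩

theorem weylOp_neg (hp : p ≠ 2) (w : Std (ZMod p) m) (f : WeilSpace p m) :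
    weylOp w (weylOp (-w) f) = f := by
  rw [weylOp_mul hp, map_neg, stdForm_isAlt w, neg_zero, mul_zero, AddChar.map_zero_eq_one,
    one_smul, add_neg_cancel, weylOp_zero]

/-- Scalars do not matter for lines, so the whole group may be replaced by the operators `weylOp w`.
-/
theorem exists_weylOp_of_mem (hp : p ≠ 2) {g : WeilSpace p m ≃ₗᵢ[ℂ] WeilSpace p m}
    (hg : g ∈ heisenbergGroup p m) : ∃ w, ∃ c : ℂ, c ≠ 0 ∧ ∀ f, g f = c • weylOp w f := by
  induction hg using Subgroup.closure_induction with
  | mem g hg =>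
    obtain ⟨a, b, c, h⟩ := hg
    refine ⟨(a, b), ZMod.stdAddChar (c - 2⁻¹ * (a ⬝ᵥ b)), (stdAddChar_ne_zero _),
      fun f => ?_⟩
    ext x
    rw [h, PiLp.smul_apply, weylOp_apply, smul_eq_mul, ← mul_assoc, ← AddChar.map_add_eq_mul]
    congr 2
    ring
  | one => exact ⟨0, 1, one_ne_zero, fun f => by rw [weylOp_zero, one_smul]; rfl⟩
  | mul g g' _ _ h h' =>
    obtain ⟨w, c, hc, h⟩ := h
    obtain ⟨w', c', hc', h'⟩ := h'
    refine ⟨w + w', c * (c' * ZMod.stdAddChar (2⁻¹ * stdForm (ZMod p) m w w')),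
      mul_ne_zero hc (mul_ne_zero hc' (stdAddChar_ne_zero _)), fun f => ?_⟩
    rw [LinearIsometryEquiv.coe_mul, Function.comp_apply, h', map_smul, h, weylOp_mul hp,
      smul_smul, smul_smul]
    congr 1
    ring
  | inv g _ h =>
    obtain ⟨w, c, hc, h⟩ := h
    refine ⟨-w, c⁻¹, inv_ne_zero hc, fun f => ?_⟩
    apply g.injective
    rw [h (c⁻¹ • _), map_smul, weylOp_neg hp, smul_smul, mul_inv_cancel₀ hc, one_smul]
    exact g.apply_symm_apply f

variable (ε : ℤˣ)

theorem mem_weilModule_iff (f : WeilSpace p m) :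
    f ∈ weilModule p m ε ↔ ∀ x, f (-x) = ((ε : ℤ) : ℂ) * f x := by
  rw [weilModule, Module.End.mem_eigenspace_iff]
  constructor
  · intro h x
    rw [← weilInvolution_apply]
    exact congrArg (fun f : WeilSpace p m => f x) h
  · intro h
    ext x
    exact (weilInvolution_apply f x).trans (h x)

/-- The orthonormal basis of the Weil module. -/
noncomputable abbrev weilBasis : OrthonormalBasis (Fin (Module.finrank ℂ (weilModule p m ε))) ℂ
    (weilModule p m ε) := stdOrthonormalBasis ℂ (weilModule p m ε)

/-- The images of the distinguished vector under the Weyl operators. -/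
noncomputable def weylVector (w : Std (ZMod p) m) : WeilTensor p m ε :=
  ∑ i, weylOp w (weilBasis ε i : WeilSpace p m) ⊗ₜ[ℂ] innerSL ℂ (weilBasis ε i)

theorem inner_innerSL {H : Type*} [NormedAddCommGroup H] [InnerProductSpace ℂ H] [CompleteSpace H]
    (u v : H) : inner ℂ (innerSL ℂ u) (innerSL ℂ v) = inner ℂ v u := by
  have h : ∀ u : H, (InnerProductSpace.toDual ℂ H).symm (innerSL ℂ u) = u := fun u =>
    (InnerProductSpace.toDual ℂ H).symm_apply_apply u
  change inner ℂ ((InnerProductSpace.toDual ℂ H).symm _) ((InnerProductSpace.toDual ℂ H).symm _) = _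
  rw [h, h]

/-- The dual basis kills the off-diagonal terms; what remains is the trace of a Weyl operator
compressed to the Weil module. -/
theorem inner_weylVector (hp : p ≠ 2) (u w : Std (ZMod p) m) :
    inner ℂ (weylVector ε u) (weylVector ε w) = weylKernel u w *
      ∑ i, inner ℂ (weilBasis (p := p) (m := m) ε i : WeilSpace p m)
        (weylOp (w - u) (weilBasis ε i : WeilSpace p m)) := by
  rw [Finset.mul_sum]
  refine (sum_inner (𝕜 := ℂ) (E := WeilTensor p m ε) Finset.univ _ _).trans ?_
  refine Finset.sum_congr rfl fun i _ => ?_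
  refine (inner_sum (𝕜 := ℂ) (E := WeilTensor p m ε) Finset.univ _ _).trans ?_
  refine (Finset.sum_eq_single i ?_ ?_).trans ?_
  · intro j _ hj
    rw [TensorProduct.inner_tmul, inner_innerSL, (weilBasis (p := p) (m := m) ε).inner_eq_zero hj, mul_zero]
  · intro h; exact absurd (Finset.mem_univ _) h
  · rw [TensorProduct.inner_tmul, inner_innerSL, weyl_inner (weylOp (p := p) (m := m)) weylOp_zero
        (weylOp_mul hp),
      (weilBasis (p := p) (m := m) ε).inner_eq_one, mul_one]

-- This is the kernel function of the orthogonal projection to the Weil module, half the sum of the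
-- identity and `ε` times `f(x) ↦ f(-x)`.
open Classical in
theorem sum_weilBasis (x y : Fin m → ZMod p) :
    ∑ i, (starRingEnd ℂ) ((weilBasis (p := p) (m := m) ε i : WeilSpace p m) x) *
        (weilBasis ε i : WeilSpace p m) y =
      2⁻¹ * ((if y = x then 1 else 0) + ((ε : ℤ) : ℂ) * if y = -x then 1 else 0) := by
  have hε : ((ε : ℤ) : ℂ) * ((ε : ℤ) : ℂ) = 1 := by
    rw [← Int.cast_mul, Int.units_coe_mul_self]; simp
  -- The vector of the Weil module that represents evaluation at `x`; its expansion in the basis is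
  -- the claim.
  let k : WeilSpace p m := (2⁻¹ : ℂ) • (EuclideanSpace.single x 1 +
    ((ε : ℤ) : ℂ) • EuclideanSpace.single (-x) 1)
  have hk : k ∈ weilModule p m ε := by
    rw [mem_weilModule_iff]
    intro y
    simp only [k, PiLp.smul_apply, PiLp.add_apply, smul_eq_mul]
    simp only [PiLp.single_apply, neg_eq_iff_eq_neg, neg_neg]
    linear_combination -2⁻¹ * hε * (if y = -x then 1 else 0)
  have hin : ∀ u : weilModule p m ε, inner ℂ u (⟨k, hk⟩ : weilModule p m ε) =
      (starRingEnd ℂ) ((u : WeilSpace p m) x) := by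
    intro u
    have hu := (mem_weilModule_iff ε u.1).1 u.2 x
    rw [Submodule.coe_inner]
    simp only [k, inner_smul_right, inner_add_right, EuclideanSpace.inner_single_right, one_mul]
    rw [hu, map_mul, map_intCast]
    linear_combination 2⁻¹ * (starRingEnd ℂ) ((u : WeilSpace p m) x) * hε
  have h := (weilBasis ε).sum_repr' ⟨k, hk⟩
  have h2 := congrArg (fun u : weilModule p m ε => (u : WeilSpace p m) y) h
  simp only [hin] at h2
  rw [Submodule.coe_sum] at h2
  simp only [WithLp.ofLp_sum, Finset.sum_apply, Submodule.coe_smul, PiLp.smul_apply,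
    smul_eq_mul] at h2
  rw [h2]
  simp only [k, PiLp.smul_apply, PiLp.add_apply, smul_eq_mul, PiLp.single_apply]

/-- With the projection written as a half sum, the identity contributes the trace of `weylOp w`,
which vanishes for `w ≠ 0`. The reflection contributes `ε` times the phase at the unique solution `x
= -w.1/2` of `x + w.1 = -x`, and that phase is `1`. -/
theorem inner_weilBasis_weylOp (hp : p ≠ 2) (w : Std (ZMod p) m) :
    ∑ i, inner ℂ (weilBasis (p := p) (m := m) ε i : WeilSpace p m)
        (weylOp w (weilBasis ε i : WeilSpace p m)) =
      2⁻¹ * ((if w = 0 then (p : ℂ) ^ m else 0) + ((ε : ℤ) : ℂ)) := by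
  classical
  have h2 := two_ne_zero_zmod hp
  simp only [PiLp.inner_apply, RCLike.inner_apply, weylOp_apply]
  rw [Finset.sum_comm]
  have h1 : ∀ x, ∑ i, (ZMod.stdAddChar (2⁻¹ * (w.1 ⬝ᵥ w.2) + w.2 ⬝ᵥ x) : ℂ) *
      (weilBasis (p := p) (m := m) ε i : WeilSpace p m) (x + w.1) *
        (starRingEnd ℂ) ((weilBasis (p := p) (m := m) ε i : WeilSpace p m) x) =
      2⁻¹ * (((ZMod.stdAddChar (2⁻¹ * (w.1 ⬝ᵥ w.2) + w.2 ⬝ᵥ x) : ℂ) * if w.1 = 0 then 1 else 0) +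
        ((ε : ℤ) : ℂ) * if x = -(2⁻¹ : ZMod p) • w.1 then 1 else 0) := by
    intro x
    have h3 : (x + w.1 = -x) ↔ x = -(2⁻¹ : ZMod p) • w.1 := by
      constructor
      · intro h
        have h4 : (2 : ZMod p) • x = -w.1 := by
          rw [two_smul]; linear_combination (exp := 1) h
        rw [neg_smul, ← smul_neg, ← h4, smul_smul, inv_mul_cancel₀ h2, one_smul]
      · rintro rfl
        have h4 : w.1 = (2⁻¹ : ZMod p) • w.1 + (2⁻¹ : ZMod p) • w.1 := by
          rw [← add_smul, ← two_mul, mul_inv_cancel₀ h2, one_smul]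
        rw [neg_smul, neg_neg]
        nth_rewrite 2 [h4]
        abel
    have h5 := sum_weilBasis ε x (x + w.1)
    simp only [mul_assoc]
    rw [← Finset.mul_sum]
    simp only [mul_comm ((weilBasis (p := p) (m := m) ε _ : WeilSpace p m) (x + w.1))]
    rw [h5]
    simp only [h3, add_eq_left]
    by_cases hx : x = -(2⁻¹ : ZMod p) • w.1
    · have h6 : 2⁻¹ * (w.1 ⬝ᵥ w.2) + w.2 ⬝ᵥ x = 0 := by
        rw [hx, dotProduct_smul, dotProduct_comm w.1, smul_eq_mul]; ring
      rw [h6, AddChar.map_zero_eq_one]; ring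
    · simp only [hx, if_false]; ring
  rw [Finset.sum_congr rfl fun x _ => h1 x, ← Finset.mul_sum, Finset.sum_add_distrib,
    ← Finset.mul_sum]
  simp only [Finset.sum_ite_eq', Finset.mem_univ, if_true, mul_one]
  congr 2
  by_cases hw : w.1 = 0
  · simp only [hw, if_true, mul_one, zero_dotProduct, mul_zero, zero_add, dotProduct_comm w.2]
    rw [sum_stdAddChar_dotProduct]
    congr 1
    rw [Prod.ext_iff, eq_iff_iff]
    simp [hw]
  · have : w ≠ 0 := fun h => hw (by rw [h]; rfl)
    simp [hw, this]

end WeilTarget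

/-! ### The Weil lines and their identification -/

section WeilTarget

open SymplecticSpace

variable {p m : ℕ} [Fact p.Prime] (ε : ℤˣ)

theorem coe_weilAction (s : weilGroup p m) (u : weilModule p m ε) :
    (weilAction ε s u : WeilSpace p m) = s.1 u := rfl

theorem weilDualAction_apply (s : weilGroup p m) (χ : StrongDual ℂ (weilModule p m ε))
    (u : weilModule p m ε) : weilDualAction ε s χ u = χ (weilAction ε s⁻¹ u) := rfl

theorem inner_weilAction (s : weilGroup p m) (u v : weilModule p m ε) :
    inner ℂ u (weilAction ε s v) = inner ℂ (weilAction ε s⁻¹ u) v := by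
  rw [Submodule.coe_inner, Submodule.coe_inner, coe_weilAction, coe_weilAction,
    ← s.1.inner_map_map (s⁻¹.1 u.1)]
  congr 1
  exact (s.1.apply_symm_apply u.1).symm

/-- The vector `v₀` is the identity of `U` written as a tensor, so `s` acts trivially on it. Hence
the orbit under `ES` is already an orbit under `E`. -/
theorem map_weilVector (g : WeilSpace p m ≃ₗᵢ[ℂ] WeilSpace p m) (s : weilGroup p m) :
    TensorProduct.map (g * s.1).toLinearEquiv.toLinearMap (weilDualAction ε s)
        (weilVector p m ε) =
      ∑ i, g (weilBasis (p := p) (m := m) ε i : WeilSpace p m) ⊗ₜ[ℂ]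
        innerSL ℂ (weilBasis (p := p) (m := m) ε i) := by
  let b := weilBasis (p := p) (m := m) ε
  let t : weilModule p m ε → weilModule p m ε := fun u => weilAction ε s u
  have ht : ∀ u v : weilModule p m ε, inner ℂ u (t v) = inner ℂ (weilAction ε s⁻¹ u) v :=
    inner_weilAction ε s
  have hcomp : ∀ i, weilDualAction ε s (innerSL ℂ (b i)) = innerSL ℂ (t (b i)) := by
    intro i
    ext x
    rw [weilDualAction_apply, innerSL_apply_apply, innerSL_apply_apply, ← inner_conj_symm, ← ht,
      inner_conj_symm]
  have hexp : ∀ i, g (s.1 (b i : WeilSpace p m)) =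
      ∑ j, (inner ℂ (b j) (t (b i)) : ℂ) • g (b j : WeilSpace p m) := by
    intro i
    have h := congrArg (fun u : weilModule p m ε => g (u : WeilSpace p m)) (b.sum_repr' (t (b i)))
    simp only [Submodule.coe_sum, Submodule.coe_smul, map_sum, map_smul] at h
    exact h.symm
  have hparseval : ∀ j, ∑ i, (inner ℂ (b j) (t (b i)) : ℂ) • innerSL ℂ (t (b i)) =
      innerSL ℂ (b j) := by
    intro j
    ext x
    simp only [sum_apply, smul_apply, smul_eq_mul,
      innerSL_apply_apply]
    have h1 : ∀ i, inner ℂ (t (b i)) x = inner ℂ (b i) (weilAction ε s⁻¹ x) := fun i => by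
      rw [← inner_conj_symm, ht, inner_conj_symm]
    simp only [h1, ht]
    rw [b.sum_inner_mul_inner, ← ht]
    congr 1
    exact Subtype.ext (s.1.apply_symm_apply x.1)
  rw [weilVector, map_sum]
  simp only [TensorProduct.map_tmul]
  calc _ = ∑ i, ∑ j, g (b j : WeilSpace p m) ⊗ₜ[ℂ]
        ((inner ℂ (b j) (t (b i)) : ℂ) • innerSL ℂ (t (b i))) := by
        refine Finset.sum_congr rfl fun i _ => ?_
        change g (s.1 (b i : WeilSpace p m)) ⊗ₜ[ℂ] weilDualAction ε s (innerSL ℂ (b i)) = _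
        rw [hcomp, hexp, TensorProduct.sum_tmul]
        exact Finset.sum_congr rfl fun j _ => by rw [TensorProduct.smul_tmul]
    _ = _ := by
        rw [Finset.sum_comm]
        refine Finset.sum_congr rfl fun j _ => ?_
        rw [← TensorProduct.tmul_sum, hparseval]

theorem weilLines_eq_range (hp : p ≠ 2) :
    weilLines p m ε = Set.range fun w => Submodule.span ℂ {weylVector (p := p) (m := m) ε w} := by
  apply Set.eq_of_subset_of_subset
  · rintro _ ⟨e, he, s, rfl⟩
    obtain ⟨w, c, hc, h⟩ := exists_weylOp_of_mem hp he
    refine ⟨w, ?_⟩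
    have h1 : ∑ i, e (weilBasis (p := p) (m := m) ε i : WeilSpace p m) ⊗ₜ[ℂ]
        innerSL ℂ (weilBasis (p := p) (m := m) ε i) =
        c • weylVector ε w := by
      rw [weylVector, Finset.smul_sum]
      exact Finset.sum_congr rfl fun i _ => by rw [h, TensorProduct.smul_tmul']
    rw [map_weilVector, h1, Submodule.span_singleton_smul_eq (IsUnit.mk0 _ hc)]
  · rintro _ ⟨w, rfl⟩
    refine ⟨weylOp w, weylOp_mem_heisenbergGroup w, 1, ?_⟩
    rw [map_weilVector]
    rfl

/-- Averaging Weyl operators with a fixed shift over all characters produces the matrix units of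
`W`. Applied to `v₀`, these give all tensors of a point mass with an evaluation functional, and the
latter span `U*`. -/
theorem span_weylVector (hp : p ≠ 2) :
    Submodule.span ℂ (Set.range (weylVector (p := p) (m := m) ε)) = ⊤ := by
  classical
  have h2 := two_ne_zero_zmod hp
  have hpp := Fact.out (p := p.Prime)
  have hp0 : (p : ℂ) ^ m ≠ 0 := pow_ne_zero _ (by exact_mod_cast hpp.ne_zero)
  set T := Submodule.span ℂ (Set.range (weylVector (p := p) (m := m) ε)) with hT
  let b := weilBasis (p := p) (m := m) ε
  let ev : (Fin m → ZMod p) → StrongDual ℂ (weilModule p m ε) := fun y =>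
    ∑ i, ((b i : WeilSpace p m) y) • innerSL ℂ (b i)
  have hev : ∀ y u, ev y u = (u : WeilSpace p m) y := by
    intro y u
    have h := congrArg (fun u : weilModule p m ε => (u : WeilSpace p m) y) (b.sum_repr' u)
    simp only [Submodule.coe_sum, Submodule.coe_smul, WithLp.ofLp_sum, Finset.sum_apply,
      PiLp.smul_apply, smul_eq_mul] at h
    rw [← h]
    simp only [ev, sum_apply, smul_apply, smul_eq_mul,
      innerSL_apply_apply]
    exact Finset.sum_congr rfl fun i _ => mul_comm _ _
  have h1 : ∀ x₀ y₀, (EuclideanSpace.single x₀ (1 : ℂ) : WeilSpace p m) ⊗ₜ[ℂ] ev y₀ ∈ T := by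
    intro x₀ y₀
    have h3 : ∀ f : WeilSpace p m, ∑ c : Fin m → ZMod p,
        (ZMod.stdAddChar (-(2⁻¹ * ((y₀ - x₀) ⬝ᵥ c) + c ⬝ᵥ x₀)) : ℂ) • weylOp (y₀ - x₀, c) f =
        ((p : ℂ) ^ m) • f y₀ • (EuclideanSpace.single x₀ (1 : ℂ) : WeilSpace p m) := by
      intro f
      ext x
      simp only [WithLp.ofLp_sum, Finset.sum_apply, PiLp.smul_apply, smul_eq_mul,
        PiLp.single_apply, weylOp_apply, ← mul_assoc, ← AddChar.map_add_eq_mul]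
      rw [← Finset.sum_mul]
      have h4 : ∀ c : Fin m → ZMod p, -(2⁻¹ * ((y₀ - x₀) ⬝ᵥ c) + c ⬝ᵥ x₀) +
          (2⁻¹ * ((y₀ - x₀) ⬝ᵥ c) + c ⬝ᵥ x) = c ⬝ᵥ (x - x₀) := by
        intro c; rw [dotProduct_sub]; ring
      simp only [h4]
      rw [sum_stdAddChar_dotProduct]
      by_cases hx : x = x₀
      · subst hx; simp
      · simp [hx, sub_eq_zero]
    have h4 : ((p : ℂ) ^ m) • ((EuclideanSpace.single x₀ (1 : ℂ) : WeilSpace p m) ⊗ₜ[ℂ] ev y₀) =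
        ∑ c : Fin m → ZMod p, (ZMod.stdAddChar (-(2⁻¹ * ((y₀ - x₀) ⬝ᵥ c) + c ⬝ᵥ x₀)) : ℂ) •
          weylVector ε (y₀ - x₀, c) := by
      simp only [weylVector, Finset.smul_sum]
      rw [Finset.sum_comm]
      simp only [TensorProduct.smul_tmul', ev, TensorProduct.tmul_sum, Finset.smul_sum]
      refine Finset.sum_congr rfl fun i _ => ?_
      rw [← TensorProduct.sum_tmul, h3, TensorProduct.tmul_smul, TensorProduct.smul_tmul',
        smul_comm]
    have h5 : ((p : ℂ) ^ m) • ((EuclideanSpace.single x₀ (1 : ℂ) : WeilSpace p m) ⊗ₜ[ℂ] ev y₀) ∈ T := by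
      rw [h4]
      exact Submodule.sum_mem _ fun c _ => Submodule.smul_mem _ _ (Submodule.subset_span ⟨_, rfl⟩)
    exact (Submodule.smul_mem_iff _ hp0).1 h5
  have h6 : ∀ x₀ (χ : StrongDual ℂ (weilModule p m ε)),
      (EuclideanSpace.single x₀ (1 : ℂ) : WeilSpace p m) ⊗ₜ[ℂ] χ ∈ T := by
    intro x₀ χ
    obtain ⟨u, rfl⟩ := (InnerProductSpace.toDual ℂ (weilModule p m ε)).surjective χ
    have h7 : InnerProductSpace.toDual ℂ (weilModule p m ε) u =
        ∑ y, (starRingEnd ℂ ((u : WeilSpace p m) y)) • ev y := by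
      ext f
      simp only [sum_apply, smul_apply, smul_eq_mul, hev,
        InnerProductSpace.toDual_apply_apply]
      rw [Submodule.coe_inner, PiLp.inner_apply]
      exact Finset.sum_congr rfl fun y _ => by rw [RCLike.inner_apply, mul_comm]
    rw [h7, TensorProduct.tmul_sum]
    refine Submodule.sum_mem _ fun y _ => ?_
    rw [TensorProduct.tmul_smul]
    exact Submodule.smul_mem _ _ (h1 _ _)
  rw [eq_top_iff, ← TensorProduct.span_tmul_eq_top, Submodule.span_le]
  rintro _ ⟨f, χ, rfl⟩
  have hf : f = ∑ x, f x • (EuclideanSpace.single x (1 : ℂ) : WeilSpace p m) := by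
    ext y
    simp only [WithLp.ofLp_sum, Finset.sum_apply, PiLp.smul_apply, smul_eq_mul, PiLp.single_apply]
    simp
  rw [hf, TensorProduct.sum_tmul]
  refine Submodule.sum_mem _ fun x _ => ?_
  rw [← TensorProduct.smul_tmul']
  exact Submodule.smul_mem _ _ (h6 _ _)

/-- The Gram matrix is `(1 - c)I + cK`, where `K` is the commutator matrix. Dependence gives `c =
ε/(p^m + ε)`, the ratio of the two trace values of the model. -/
theorem lineSetEquivalent_weilLines {V : Type*} [NormedAddCommGroup V] [InnerProductSpace ℂ V]
    [FiniteDimensional ℂ V] (hp : p ≠ 2) (hm : 0 < m) {L : Set (Submodule ℂ V)} (hL : sSup L = ⊤)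
    (hd : Module.finrank ℂ V < p ^ (2 * m)) {v : V} {D : Std (ZMod p) m → (V ≃ₗᵢ[ℂ] V)} {c : ℂ}
    (hv : ‖v‖ = 1) (hD0 : ∀ x, D 0 x = x)
    (hD : ∀ u w x, D u (D w x) =
      (ZMod.stdAddChar (2⁻¹ * stdForm (ZMod p) m u w) : ℂ) • D (u + w) x)
    (hLD : L = Set.range fun w => Submodule.span ℂ {D w v})
    (hc : ∀ w, w ≠ 0 → inner ℂ v (D w v) = c) :
    ∃ ε : ℤˣ, LineSetEquivalent (V' := WeilTensor p m ε) L (weilLines p m ε) := by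
  classical
  have hpp := Fact.out (p := p.Prime)
  have hG : ∀ u w, inner ℂ (D u v) (D w v) =
      (1 - c) * (if u = w then 1 else 0) + c * weylKernel u w := by
    intro u w
    rw [weyl_inner D hD0 hD]
    by_cases h : u = w
    · subst h
      rw [sub_self, hD0, weylKernel_self, inner_self_eq_norm_sq_to_K, hv]
      simp
    · rw [hc _ (sub_ne_zero.2 (Ne.symm h)), if_neg h]; ring
  obtain ⟨ε, hε⟩ := exists_sign_of_gram (fun w => D w v) (by
    rwa [← Nat.card_eq_fintype_card, natCard_std]) ((p : ℂ) ^ m) c weylKernel hG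
    (sum_weylKernel hp)
  refine ⟨ε, ?_⟩
  rw [hLD, weilLines_eq_range ε hp]
  -- This factor is the squared length of the vectors in the model, the dimension of the Weil
  -- module.
  have hC : (0 : ℝ) < ((p : ℝ) ^ m + ((ε : ℤ) : ℝ)) / 2 := by
    have h1 : (1 : ℝ) < (p : ℝ) ^ m := by
      exact_mod_cast Nat.one_lt_pow hm.ne' hpp.one_lt
    rcases Int.units_eq_one_or ε with rfl | rfl
    · push_cast; linarith
    · push_cast; linarith
  refine lineSetEquivalent_of_gram _ _ hC ?_ (span_range_of_lines hL hLD) (span_weylVector ε hp)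
  intro u w
  rw [hG, inner_weylVector ε hp, inner_weilBasis_weylOp ε hp]
  push_cast
  by_cases h : u = w
  · subst h
    simp [weylKernel_self]
    ring
  · have : w - u ≠ 0 := sub_ne_zero.2 (Ne.symm h)
    simp only [h, this, if_false]
    linear_combination (-2⁻¹ * weylKernel u w) * hε

end WeilTarget

/-! ### The prime two: inner products as a function on the elementary abelian group -/

section SignFunction

variable {A : Type*} [AddCommGroup A] [Module (ZMod 2) A]

theorem add_add_self_two (a b : A) : a + b + b = a := by
  rw [add_assoc, ZModModule.add_self, add_zero]

theorem add_eq_zero_iff_two {a b : A} : a + b = 0 ↔ b = a := by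
  constructor
  · intro h
    have := add_add_self_two b a
    rw [add_comm b a, h, zero_add] at this
    exact this.symm
  · rintro rfl; exact ZModModule.add_self _

theorem add_eq_iff_two {a b c : A} : a + b = c ↔ b = a + c := by
  constructor
  · rintro rfl; rw [← add_assoc, ZModModule.add_self, zero_add]
  · rintro rfl; rw [← add_assoc, ZModModule.add_self, zero_add]

theorem zmod_two_cases (t : ZMod 2) : t = 0 ∨ t = 1 := by
  revert t; decide

theorem exists_functional (W : Submodule (ZMod 2) A) {z : A} (hz : z ∉ W) :
    ∃ τ : A →ₗ[ZMod 2] ZMod 2, (∀ w ∈ W, τ w = 0) ∧ τ z = 1 := by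
  obtain ⟨τ, h1, h2⟩ := Submodule.exists_le_ker_of_notMem hz
  exact ⟨τ, fun w hw => h2 hw, (zmod_two_cases _).resolve_left h1⟩

/-- The kernel of `τ` contains one element of each pair `{a, a + h}`. -/
theorem sum_eq_two_mul_sum_filter [Fintype A] {R : Type*} [CommRing R] (τ : A →ₗ[ZMod 2] ZMod 2)
    {h : A} (hτ : τ h = 1) (S : Finset A) (hS : ∀ a ∈ S, a + h ∈ S) (g : A → R)
    (hg : ∀ a, g (a + h) = g a) : ∑ a ∈ S, g a = 2 * ∑ a ∈ S with τ a = 0, g a := by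
  rw [← Finset.sum_filter_add_sum_filter_not S (fun a => τ a = 0), two_mul]
  congr 1
  have h1 : ∀ t : ZMod 2, t ≠ 0 → t + 1 = 0 := by decide
  have h2 : ∀ t : ZMod 2, t = 0 → t + 1 ≠ 0 := by decide
  refine Finset.sum_nbij' (fun a => a + h) (fun a => a + h) ?_ ?_ ?_ ?_ ?_
  · intro a ha
    rw [Finset.mem_filter] at ha ⊢
    exact ⟨hS a ha.1, by rw [map_add, hτ]; exact h1 _ ha.2⟩
  · intro a ha
    rw [Finset.mem_filter] at ha ⊢
    exact ⟨hS a ha.1, by rw [map_add, hτ]; exact h2 _ ha.2⟩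
  · intro a _; exact add_add_self_two a h
  · intro a _; exact add_add_self_two a h
  · intro a _; exact (hg a).symm

theorem card_eq_two_mul_card_filter [Fintype A] (τ : A →ₗ[ZMod 2] ZMod 2) {h : A} (hτ : τ h = 1)
    (S : Finset A) (hS : ∀ a ∈ S, a + h ∈ S) : S.card = 2 * (S.filter fun a => τ a = 0).card := by
  have := sum_eq_two_mul_sum_filter (R := ℤ) τ hτ S hS (fun _ => 1) (fun _ => rfl)
  simp only [Finset.sum_const, nsmul_eq_mul, mul_one] at this
  exact_mod_cast this

/-- Inner products of a vector with its images under an elementary abelian `2`-group of order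
`2 ^ (2m + 1)` that acts regularly on the lines of a system of equiangular lines, where `z` is the
scalar `-1` and `d` is the dimension. -/
structure IsSignFunction [Fintype A] (m d : ℕ) (z : A) (f : A → ℝ) (c : ℝ) : Prop where
  card_eq : Fintype.card A = 2 * 4 ^ m
  ne_zero : z ≠ 0
  map_zero : f 0 = 1
  map_add_self : ∀ a, f (a + z) = -f a
  pos : 0 < c
  eq_or_eq : ∀ a, a ≠ 0 → a ≠ z → f a = c ∨ f a = -c
  conv : ∀ a, ∑ b, f b * f (a + b) = 2 * (1 + (4 ^ m - 1) * c ^ 2) * f a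
  dim : d * (1 + (4 ^ m - 1) * c ^ 2) = 4 ^ m
  one_lt : 1 < d
  two_mul_le : 2 * d ≤ 4 ^ m

-- The convolution square of `f` has the same symmetries as `f`, so it is a combination of `f` and
-- of the antisymmetric delta function `δ₀ - δ_z`. Linear dependence of the vectors excludes the
-- delta part; then the frame is tight, and the trace of its frame operator gives the dimension
-- equation.
open Classical in
theorem exists_isSignFunction [Fintype A] {V : Type*} [NormedAddCommGroup V]
    [InnerProductSpace ℂ V] [FiniteDimensional ℂ V] {m : ℕ} (hm : 0 < m)
    (hcard : Fintype.card A = 2 * 4 ^ m) {z : A} (hz : z ≠ 0) {f : A → ℝ} (h0 : f 0 = 1)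
    {x : A → V} (hG : ∀ a b, inner ℂ (x a) (x b) = (f (a + b) : ℂ)) (hxz : ∀ a, x (a + z) = -x a)
    (hx : Submodule.span ℂ (Set.range x) = ⊤) (hd1 : 1 < Module.finrank ℂ V)
    (hd2 : 2 * Module.finrank ℂ V ≤ 4 ^ m)
    (htr : ∀ a b, a ≠ 0 → a ≠ z → b ≠ 0 → b ≠ z → ∃ g : A ≃+ A, (∀ y, f (g y) = f y) ∧
      (g a = b ∨ g a = b + z)) :
    ∃ c, IsSignFunction m (Module.finrank ℂ V) z f c := by
  have hfz : ∀ a, f (a + z) = -f a := by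
    intro a
    have h1 := hG 0 (a + z)
    have h2 := hG 0 a
    rw [hxz, inner_neg_right, h2, zero_add, zero_add] at h1
    exact_mod_cast h1.symm
  have hN4 : 4 ≤ 4 ^ m := Nat.le_self_pow hm.ne' 4
  obtain ⟨a₀, ha₀⟩ : ∃ a₀, a₀ ∉ ({0, z} : Finset A) := by
    by_contra! h
    have h1 := Finset.card_le_card (fun a _ => h a : (Finset.univ : Finset A) ⊆ {0, z})
    rw [Finset.card_univ, hcard] at h1
    have := Finset.card_le_two (a := 0) (b := z)
    omega
  simp only [Finset.mem_insert, Finset.mem_singleton, not_or] at ha₀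
  have hsq : ∀ b, b ≠ 0 → b ≠ z → f b = f a₀ ∨ f b = -f a₀ := by
    intro b hb0 hbz
    obtain ⟨g, hg, h | h⟩ := htr a₀ b ha₀.1 ha₀.2 hb0 hbz
    · left; rw [← h, hg]
    · right; rw [← hg a₀, h, hfz, neg_neg]
  -- the antisymmetric delta function
  let D : A → ℝ := fun a => (if a = 0 then 1 else 0) - (if a = z then 1 else 0)
  -- convolution square
  set k : A → ℝ := fun a => ∑ b, f b * f (a + b) with hk
  have hkz : ∀ a, k (a + z) = -k a := by
    intro a
    simp only [hk]
    rw [← Finset.sum_neg_distrib]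
    refine Finset.sum_congr rfl fun b _ => ?_
    rw [add_right_comm, hfz]; ring
  have hkg : ∀ g : A ≃+ A, (∀ y, f (g y) = f y) → ∀ a, k (g a) = k a := by
    intro g hg a
    simp only [hk]
    rw [← Equiv.sum_comp g.toEquiv]
    refine Finset.sum_congr rfl fun b _ => ?_
    change f (g b) * f (g a + g b) = _
    rw [← map_add, hg, hg]
  have hkf : ∀ b, b ≠ 0 → b ≠ z → k b * f b = k a₀ * f a₀ := by
    intro b hb0 hbz
    obtain ⟨g, hg, h | h⟩ := htr a₀ b ha₀.1 ha₀.2 hb0 hbz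
    · rw [← h, hg, hkg g hg]
    · have h1 := hkg g hg a₀
      have h2 := hg a₀
      rw [h, hkz] at h1
      rw [h, hfz] at h2
      rw [← h1, ← h2]; ring
  -- dependence
  obtain ⟨τ, -, hτ⟩ := exists_functional (⊥ : Submodule (ZMod 2) A) (z := z) (by simpa using hz)
  have hT := card_eq_two_mul_card_filter τ hτ Finset.univ (fun a _ => Finset.mem_univ _)
  rw [Finset.card_univ, hcard] at hT
  -- One vector from each pair `±x` gives `4 ^ m` vectors, more than the dimension. The relation is
  -- extended by zero, so it is nonzero modulo symmetric functions.
  obtain ⟨y, t₀, hyt, hyz, hy⟩ : ∃ (y : A → ℂ) (t₀ : A), y t₀ ≠ 0 ∧ y (t₀ + z) = 0 ∧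
      ∑ w, y w • x w = 0 := by
    have hdep : ¬ LinearIndependent ℂ (fun t : {a // τ a = 0} => x t) := by
      intro h
      have h1 := h.fintype_card_le_finrank
      rw [Fintype.card_subtype] at h1
      omega
    obtain ⟨y, hy, t, ht⟩ := Fintype.not_linearIndependent_iff.1 hdep
    refine ⟨fun a => if h : τ a = 0 then y ⟨a, h⟩ else 0, t, ?_, ?_, ?_⟩
    · dsimp only; rw [dif_pos t.2]; exact ht
    · dsimp only; rw [dif_neg]
      rw [map_add, t.2, hτ]; decide
    · rw [← hy]
      rw [← Finset.sum_filter_add_sum_filter_not Finset.univ (fun a => τ a = 0)]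
      rw [Finset.sum_eq_zero (s := Finset.univ.filter fun a => ¬ τ a = 0), add_zero]
      · rw [Finset.sum_subtype (p := fun a => τ a = 0) _ (by simp)]
        exact Finset.sum_congr rfl fun a _ => by dsimp only; rw [dif_pos a.2]
      · intro a ha
        dsimp only
        rw [dif_neg (Finset.mem_filter.1 ha).2, zero_smul]
  have hfy : ∀ u, ∑ w, (f (u + w) : ℂ) * y w = 0 := by
    intro u
    have h1 : inner ℂ (x u) (∑ w, y w • x w) = 0 := by rw [hy, inner_zero_right]
    rw [inner_sum] at h1
    rw [← h1]
    exact Finset.sum_congr rfl fun w _ => by rw [inner_smul_right, hG, mul_comm]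
  have hDy : ∀ t, ∑ w, (D (t + w) : ℂ) * y w = y t - y (t + z) := by
    intro t
    have h1 : ∀ w, (D (t + w) : ℂ) = (if w = t then 1 else 0) - (if w = t + z then 1 else 0) := by
      intro w
      simp only [D, add_eq_zero_iff_two, @add_eq_iff_two A _ _ t w z]
      push_cast
      split_ifs <;> simp
    simp [h1, sub_mul, Finset.sum_sub_distrib]
  have hf_of : ∀ g : A → ℝ, (∀ a, g (a + z) = - g a) → ∀ r, (∀ a, a ≠ 0 → a ≠ z → g a = r * f a) →
      ∀ a, g a = r * f a + (g 0 - r) * D a := by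
    intro g hg r hr a
    by_cases ha0 : a = 0
    · subst ha0
      simp only [D, h0, if_true, if_neg hz.symm]; ring
    by_cases haz : a = z
    · subst haz
      have h1 := hg 0
      have h2 := hfz 0
      rw [zero_add] at h1 h2
      simp only [D, h1, h2, h0, if_true, if_neg hz]; ring
    · simp only [D, hr a ha0 haz, if_neg ha0, if_neg haz]; ring
  -- Otherwise `f` is the delta function, whose convolution with `y` does not vanish.
  have hc0 : f a₀ ≠ 0 := by
    intro hc
    have h1 : ∀ a, f a = D a := by
      intro a
      have := hf_of f hfz 0 (fun a h1 h2 => by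
        rcases hsq a h1 h2 with h | h <;> rw [h, hc] <;> simp) a
      rw [h0] at this
      rw [this]; ring
    have h2 := hDy t₀
    simp only [← h1] at h2
    rw [hfy, hyz, sub_zero] at h2
    exact hyt h2.symm
  obtain ⟨r, hr⟩ : ∃ r, ∀ a, a ≠ 0 → a ≠ z → k a = r * f a := by
    refine ⟨k a₀ * f a₀ / f a₀ ^ 2, fun a h1 h2 => ?_⟩
    have h3 := hkf a h1 h2
    rw [← h3]
    have h4 : f a ^ 2 = f a₀ ^ 2 := by
      rcases hsq a h1 h2 with h | h <;> rw [h]; ring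
    rw [← h4]
    have h5 : f a ≠ 0 := by
      rcases hsq a h1 h2 with h | h <;> rw [h]
      · exact hc0
      · exact neg_ne_zero.2 hc0
    field_simp
  have hkr := hf_of k hkz r hr
  -- Convolving the decomposition of `k` with `y` leaves only the delta term, with the coefficient
  -- `k 0 - r`.
  have hr0 : k 0 = r := by
    have h1 : ∑ u, (f (t₀ + u) : ℂ) * ∑ w, (f (u + w) : ℂ) * y w = 0 :=
      Finset.sum_eq_zero fun u _ => by rw [hfy, mul_zero]
    have h2 : ∀ w, ∑ u, (f (t₀ + u) : ℂ) * (f (u + w) : ℂ) = (k (t₀ + w) : ℂ) := by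
      intro w
      simp only [hk]
      push_cast
      rw [← Equiv.sum_comp (Equiv.addLeft t₀)]
      refine Finset.sum_congr rfl fun b _ => ?_
      simp only [Equiv.coe_addLeft]
      rw [← add_assoc, ZModModule.add_self, zero_add]
      congr 3
      abel
    simp only [Finset.mul_sum, ← mul_assoc] at h1
    rw [Finset.sum_comm] at h1
    simp only [← Finset.sum_mul, h2] at h1
    have h3 : ∑ w, (k (t₀ + w) : ℂ) * y w = r * ∑ w, (f (t₀ + w) : ℂ) * y w +
        (k 0 - r) * ∑ w, (D (t₀ + w) : ℂ) * y w := by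
      rw [Finset.mul_sum, Finset.mul_sum, ← Finset.sum_add_distrib]
      refine Finset.sum_congr rfl fun w _ => ?_
      rw [hkr (t₀ + w)]
      push_cast; ring
    rw [h1, hfy, hDy, hyz, mul_zero, zero_add, sub_zero, eq_comm, mul_eq_zero] at h3
    have h4 := h3.resolve_right hyt
    exact_mod_cast sub_eq_zero.1 h4
  have hk0 : k 0 = 2 * (1 + (4 ^ m - 1) * |f a₀| ^ 2) := by
    have h1 : ∀ b, f b * f (0 + b) = f a₀ ^ 2 + (1 - f a₀ ^ 2) * ((if b = 0 then 1 else 0) +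
        (if b = z then 1 else 0)) := by
      intro b
      rw [zero_add]
      by_cases hb0 : b = 0
      · subst hb0; simp [h0, hz.symm]
      by_cases hbz : b = z
      · subst hbz
        have h2 := hfz 0
        rw [zero_add] at h2
        simp [h0, hz, h2]
      · rcases hsq b hb0 hbz with h | h <;> rw [h] <;> simp [hb0, hbz] <;> ring
    simp only [hk, h1]
    rw [Finset.sum_add_distrib, ← Finset.mul_sum, Finset.sum_add_distrib]
    simp only [Finset.sum_const, Finset.card_univ, hcard, Finset.sum_ite_eq', Finset.mem_univ,
      if_true, nsmul_eq_mul, sq_abs]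
    push_cast; ring
  have hconv : ∀ a, k a = k 0 * f a := by
    intro a
    rw [hkr a, hr0]; ring
  -- the frame operator
  have hframe : ∀ b, ∑ a, (f (a + b) : ℂ) • x a = (k 0 : ℂ) • x b := by
    intro b
    rw [← sub_eq_zero]
    set w := ∑ a, (f (a + b) : ℂ) • x a - (k 0 : ℂ) • x b with hw
    have h1 : ∀ c, inner ℂ (x c) w = 0 := by
      intro c
      rw [hw, inner_sub_right, inner_sum, inner_smul_right, hG]
      simp only [inner_smul_right, hG]
      have h2 := hconv (c + b)
      simp only [hk] at h2
      rw [← Equiv.sum_comp (Equiv.addRight b)] at h2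
      have h3 : ∀ a, c + b + (a + b) = c + a := by
        intro a
        rw [add_add_add_comm, ZModModule.add_self, add_zero]
      simp only [Equiv.coe_addRight, h3] at h2
      rw [sub_eq_zero]
      exact_mod_cast h2
    have h2 : ∀ u, inner ℂ u w = 0 := by
      intro u
      have hu : u ∈ Submodule.span ℂ (Set.range x) := by rw [hx]; trivial
      induction hu using Submodule.span_induction with
      | mem u hu => obtain ⟨c, rfl⟩ := hu; exact h1 c
      | zero => exact inner_zero_left _
      | add u v _ _ hu hv => rw [inner_add_left, hu, hv, add_zero]
      | smul c u _ hu => rw [inner_smul_left, hu, mul_zero]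
    exact inner_self_eq_zero.1 (h2 w)
  have hframe' : ∀ u, ∑ a, (inner ℂ (x a) u : ℂ) • x a = (k 0 : ℂ) • u := by
    intro u
    have hu : u ∈ Submodule.span ℂ (Set.range x) := by rw [hx]; trivial
    induction hu using Submodule.span_induction with
    | mem u hu =>
      obtain ⟨b, rfl⟩ := hu
      simp only [hG]
      exact hframe b
    | zero => simp
    | add u v _ _ hu hv => simp only [inner_add_right, add_smul, Finset.sum_add_distrib, hu, hv,
        smul_add]
    | smul c u _ hu =>
      simp only [inner_smul_right, mul_smul]
      rw [← Finset.smul_sum, hu, smul_comm]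
  -- The trace of the frame operator, a scalar, is also the sum of the squared norms of all the unit
  -- vectors `x a`.
  have hdim : (Module.finrank ℂ V : ℝ) * k 0 = 2 * 4 ^ m := by
    let e := stdOrthonormalBasis ℂ V
    have h1 : ∑ i, inner ℂ (e i) (∑ a, (inner ℂ (x a) (e i) : ℂ) • x a) =
        (Module.finrank ℂ V : ℂ) * k 0 := by
      simp only [hframe', inner_smul_right, e.inner_eq_one]
      simp
    have h2 : ∑ i, inner ℂ (e i) (∑ a, (inner ℂ (x a) (e i) : ℂ) • x a) = 2 * 4 ^ m := by
      simp only [inner_sum, inner_smul_right]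
      rw [Finset.sum_comm]
      simp only [e.sum_inner_mul_inner, hG, ZModModule.add_self, h0]
      simp [hcard]
    rw [h1] at h2
    exact_mod_cast h2
  refine ⟨|f a₀|, hcard, hz, h0, hfz, abs_pos.2 hc0, ?_, ?_, ?_, hd1, hd2⟩
  · intro a h1 h2
    rcases abs_choice (f a₀) with h | h <;> rw [h]
    · exact hsq a h1 h2
    · rw [neg_neg]; exact (hsq a h1 h2).symm
  · intro a
    rw [← hk0]
    exact hconv a
  · rw [hk0] at hdim
    linarith

end SignFunction

/-! ### Numerical restrictions on sign functions -/

section SignFunction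

variable {A : Type*} [AddCommGroup A] [Fintype A]

open Classical in
theorem sum_delta_sub_delta_mul (z : A) (g : A → ℝ) :
    ∑ a, ((if a = 0 then 1 else 0) - (if a = z then 1 else 0)) * g a = g 0 - g z := by
  simp [sub_mul, Finset.sum_sub_distrib]

namespace IsSignFunction

variable {m d : ℕ} {z : A} {f : A → ℝ} {c : ℝ} (h : IsSignFunction m d z f c)

include h

theorem map_self : f z = -1 := by
  have := h.map_add_self 0
  rwa [zero_add, h.map_zero] at this

theorem sq_eq {a : A} (h0 : a ≠ 0) (hz : a ≠ z) : f a ^ 2 = c ^ 2 := by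
  rcases h.eq_or_eq a h0 hz with h | h <;> rw [h]; ring

theorem exists_nontrivial (hm : 0 < m) : ∃ a, a ≠ 0 ∧ a ≠ z := by
  classical
  by_contra! H
  have h1 : (Finset.univ : Finset A) ⊆ {0, z} := by
    intro a _
    rw [Finset.mem_insert, Finset.mem_singleton]
    by_cases ha : a = 0
    · exact Or.inl ha
    · exact Or.inr (H a ha)
  have h2 := Finset.card_le_card h1
  have h3 : 4 ≤ 4 ^ m := Nat.le_self_pow hm.ne' 4
  rw [Finset.card_univ, h.card_eq] at h2
  have := Finset.card_le_two (a := 0) (b := z)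
  omega

open Classical in
theorem eq_add {g : A → ℝ} {s : ℝ} (g0 : g 0 = 1) (gz : g z = -1)
    (hg : ∀ a, a ≠ 0 → a ≠ z → f a = s * g a) (a : A) :
    f a = s * g a + (1 - s) * ((if a = 0 then 1 else 0) - (if a = z then 1 else 0)) := by
  have hz := h.ne_zero
  by_cases h0 : a = 0
  · subst h0; simp [h.map_zero, g0, hz.symm]
  by_cases h1 : a = z
  · subst h1; simp [h.map_self, gz, hz]; ring
  · simp [hg a h0 h1, h0, h1]

variable [Module (ZMod 2) A]

/-- A character up to a factor would be the Gram function of one line or of a simplex: the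
idempotent equation leaves only `d = 1` and `d = 4 ^ m - 1`, which the bounds on `d` exclude. -/
theorem ne_mul_character (hm : 0 < m) {χ : A → ℝ} (hχ : ∀ a b, χ (a + b) = χ a * χ b)
    (hχz : χ z = -1) (s : ℝ) : ¬ ∀ a, a ≠ 0 → a ≠ z → f a = s * χ a := by
  classical
  intro hf
  have hχ0 : χ 0 = 1 := by
    have := hχ 0 z
    rw [zero_add, hχz] at this
    linarith
  have hχχ : ∀ a, χ a * χ a = 1 := fun a => by rw [← hχ, ZModModule.add_self, hχ0]
  have hD := h.eq_add hχ0 hχz hf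
  have hX : ∑ b, χ b * f b = 2 * 4 ^ m * s + 2 * (1 - s) := by
    have h1 : ∀ b, χ b * f b = s + (1 - s) *
        (((if b = 0 then 1 else 0) - (if b = z then 1 else 0)) * χ b) := by
      intro b
      rw [hD b]
      linear_combination s * hχχ b
    simp only [h1]
    rw [Finset.sum_add_distrib, ← Finset.mul_sum, sum_delta_sub_delta_mul, hχ0, hχz]
    simp only [Finset.sum_const, Finset.card_univ, h.card_eq, nsmul_eq_mul]
    push_cast; ring
  obtain ⟨a, ha0, haz⟩ := h.exists_nontrivial hm
  have hs0 : s ≠ 0 := by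
    rintro rfl
    have h1 := h.sq_eq ha0 haz
    rw [hf a ha0 haz] at h1
    have := h.pos
    nlinarith
  have hsc : c ^ 2 = s ^ 2 := by
    rw [← h.sq_eq ha0 haz, hf a ha0 haz]
    linear_combination s ^ 2 * hχχ a
  have hχa : χ a ≠ 0 := fun h0 => by have := hχχ a; rw [h0] at this; norm_num at this
  have h1 := h.conv a
  have h2 : ∑ b, f b * f (a + b) = s * (χ a * ∑ b, χ b * f b) + (1 - s) * (f a - f (a + z)) := by
    have h3 : ∑ b, χ b * f (a + b) = χ a * ∑ b, χ b * f b := by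
      rw [← Equiv.sum_comp (Equiv.addLeft a), Finset.mul_sum]
      refine Finset.sum_congr rfl fun b _ => ?_
      rw [Equiv.coe_addLeft, ← add_assoc, ZModModule.add_self, zero_add, hχ]; ring
    rw [← h3]
    have h4 := sum_delta_sub_delta_mul z fun b => f (a + b)
    rw [add_zero] at h4
    rw [← h4, Finset.mul_sum, Finset.mul_sum, ← Finset.sum_add_distrib]
    refine Finset.sum_congr rfl fun b _ => ?_
    rw [hD b]; ring
  rw [h2, hX, h.map_add_self, hf a ha0 haz, hsc] at h1
  have h3 : (s - 1) * ((4 ^ m - 1) * s + 1) = 0 := by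
    have : (2 * s * χ a) * ((s - 1) * ((4 ^ m - 1) * s + 1)) = 0 := by
      linear_combination -h1
    exact (mul_eq_zero.1 this).resolve_left (by positivity)
  have hdim := h.dim
  have h1d : (1 : ℝ) < d := by exact_mod_cast h.one_lt
  have h2d : (2 : ℝ) * d ≤ 4 ^ m := by exact_mod_cast h.two_mul_le
  have hN : (4 : ℝ) ≤ 4 ^ m := by exact_mod_cast Nat.le_self_pow hm.ne' 4
  rw [hsc] at hdim
  rcases mul_eq_zero.1 h3 with h4 | h4
  · have : s = 1 := by linarith
    rw [this] at hdim
    nlinarith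
  · have h5 : (d : ℝ) * (1 - s) = 4 ^ m := by
      rw [← hdim]; linear_combination -(d * s) * h4
    have h6 : s * (4 ^ m - 1) = -1 := by linarith
    have h7 : (d : ℝ) = 4 ^ m - 1 := by
      have : (4 : ℝ) ^ m * (d - (4 ^ m - 1)) = 0 := by
        linear_combination (4 ^ m - 1) * h5 + d * h6
      have := (mul_eq_zero.1 this).resolve_left (by positivity)
      linarith
    linarith

-- The four elements of `⟨a, z⟩` contribute `f a` each, all others `±c²`. The set with the plus sign
-- is a union of cosets of `⟨a, z⟩`, so its size is `4n`; this divisibility is the integrality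
-- condition used for small `m`.
open Classical in
theorem exists_conv_eq {a : A} (ha0 : a ≠ 0) (haz : a ≠ z) :
    ∃ n : ℕ, ∑ b, f b * f (a + b) = 4 * f a + c ^ 2 * (8 * n - 2 * 4 ^ m + 4) := by
  have hz := h.ne_zero
  have hazn : a + z ≠ 0 := fun h0 => haz (add_eq_zero_iff_two.1 h0).symm
  let H : Finset A := {0, z, a, a + z}
  have hHz : ∀ b, b ∉ H → b + z ∉ H := by
    intro b hb hb'
    apply hb
    simp only [H, Finset.mem_insert, Finset.mem_singleton] at hb' ⊢
    rcases hb' with h1 | h1 | h1 | h1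
    · right; left; exact (add_eq_zero_iff_two.1 h1).symm
    · left; exact add_eq_right.1 h1
    · right; right; right; rw [← h1, add_add_self_two]
    · right; right; left; exact add_right_cancel h1
  have hHa : ∀ b, b ∉ H → b + a ∉ H := by
    intro b hb hb'
    apply hb
    simp only [H, Finset.mem_insert, Finset.mem_singleton] at hb' ⊢
    rcases hb' with h1 | h1 | h1 | h1
    · right; right; left; exact (add_eq_zero_iff_two.1 h1).symm
    · right; right; right; rw [← h1, add_comm b a, ← add_assoc, ZModModule.add_self, zero_add]
    · left; exact add_eq_right.1 h1
    · right; left; rw [add_comm a z] at h1; exact add_right_cancel h1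
  let S : Finset A := Finset.univ.filter fun b => b ∉ H ∧ 0 < f b * f (a + b)
  have hSz : ∀ b ∈ S, b + z ∈ S := by
    intro b hb
    simp only [S, Finset.mem_filter, Finset.mem_univ, true_and] at hb ⊢
    refine ⟨hHz b hb.1, ?_⟩
    rw [← add_assoc, h.map_add_self, h.map_add_self, neg_mul_neg]
    exact hb.2
  have hSa : ∀ b ∈ S, b + a ∈ S := by
    intro b hb
    simp only [S, Finset.mem_filter, Finset.mem_univ, true_and] at hb ⊢
    refine ⟨hHa b hb.1, ?_⟩
    have : a + (b + a) = b := by rw [add_comm b a, ← add_assoc, ZModModule.add_self, zero_add]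
    rw [this, mul_comm, add_comm b a]
    exact hb.2
  obtain ⟨τ, hτa, hτz⟩ := exists_functional (Submodule.span (ZMod 2) {a}) (z := z) (by
    rw [Submodule.mem_span_singleton]
    rintro ⟨t, ht⟩
    rcases zmod_two_cases t with rfl | rfl
    · rw [zero_smul] at ht; exact hz ht.symm
    · rw [one_smul] at ht; exact haz ht)
  have hτa := hτa a (Submodule.mem_span_singleton_self a)
  obtain ⟨τ', -, hτ'⟩ := exists_functional (⊥ : Submodule (ZMod 2) A) (z := a) (by simpa using ha0)
  have hS1 := card_eq_two_mul_card_filter τ hτz S hSz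
  have hS2 := card_eq_two_mul_card_filter τ' hτ' (S.filter fun b => τ b = 0) (by
    intro b hb
    rw [Finset.mem_filter] at hb ⊢
    exact ⟨hSa b hb.1, by rw [map_add, hb.2, hτa, add_zero]⟩)
  rw [hS2] at hS1
  set n := ((S.filter fun b => τ b = 0).filter fun b => τ' b = 0).card
  refine ⟨n, ?_⟩
  have hH4 : H.card = 4 := by
    have h1 : (0 : A) ∉ ({z, a, a + z} : Finset A) := by
      simp [hz.symm, ha0.symm, hazn.symm]
    have h2 : z ∉ ({a, a + z} : Finset A) := by
      simp [haz.symm, ha0]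
    have h3 : a ∉ ({a + z} : Finset A) := by simp [hz]
    simp only [H]
    rw [Finset.card_insert_of_notMem h1, Finset.card_insert_of_notMem h2,
      Finset.card_insert_of_notMem h3, Finset.card_singleton]
  have key : ∀ b, f b * f (a + b) = c ^ 2 * (2 * (if b ∈ S then 1 else 0) - 1) +
      (if b ∈ H then 1 else 0) * (f a + c ^ 2) := by
    intro b
    by_cases hb : b ∈ H
    · have hbS : b ∉ S := fun hS => (Finset.mem_filter.1 hS).2.1 hb
      have h1 : f b * f (a + b) = f a := by
        simp only [H, Finset.mem_insert, Finset.mem_singleton] at hb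
        rcases hb with rfl | rfl | rfl | rfl
        · rw [h.map_zero, add_zero, one_mul]
        · rw [h.map_self, h.map_add_self]; ring
        · rw [ZModModule.add_self, h.map_zero, mul_one]
        · rw [← add_assoc, ZModModule.add_self, zero_add, h.map_self, h.map_add_self]; ring
      rw [h1, if_neg hbS, if_pos hb]; ring
    · have hb' := hb
      simp only [H, Finset.mem_insert, Finset.mem_singleton, not_or] at hb'
      have hab0 : a + b ≠ 0 := fun h0 => hb'.2.2.1 (add_eq_zero_iff_two.1 h0)
      have habz : a + b ≠ z := fun h0 => hb'.2.2.2 (by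
        rw [← h0, ← add_assoc, ZModModule.add_self, zero_add])
      have hpos : 0 < c ^ 2 := pow_pos h.pos 2
      have h1 : f b * f (a + b) = c ^ 2 ∨ f b * f (a + b) = -c ^ 2 := by
        rcases h.eq_or_eq b hb'.1 hb'.2.1 with h1 | h1 <;>
        rcases h.eq_or_eq (a + b) hab0 habz with h2 | h2 <;> rw [h1, h2]
        · left; ring
        · right; ring
        · right; ring
        · left; ring
      rcases h1 with h1 | h1
      · have hbS : b ∈ S := by
          rw [Finset.mem_filter]
          exact ⟨Finset.mem_univ _, hb, by rw [h1]; exact hpos⟩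
        rw [h1, if_pos hbS, if_neg hb]; ring
      · have hbS : b ∉ S := by
          rw [Finset.mem_filter]
          rintro ⟨-, -, h2⟩
          rw [h1] at h2; linarith
        rw [h1, if_neg hbS, if_neg hb]; ring
  simp only [key]
  rw [Finset.sum_add_distrib, ← Finset.mul_sum, Finset.sum_sub_distrib, ← Finset.mul_sum,
    ← Finset.sum_mul]
  simp only [Finset.sum_ite_mem, Finset.univ_inter, Finset.sum_const, hS1, hH4, Finset.card_univ,
    h.card_eq, nsmul_eq_mul]
  push_cast
  ring

/-- For `m = 1` the bounds force `d = 2` and `3c² = 1`, and integrality asks for `8n = 4`. -/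
theorem one_lt_exponent (hm : 0 < m) : 1 < m := by
  by_contra hm'
  obtain rfl : m = 1 := by omega
  obtain ⟨a, ha0, haz⟩ := h.exists_nontrivial hm
  obtain ⟨n, hn⟩ := h.exists_conv_eq ha0 haz
  have hd : d = 2 := by have := h.one_lt; have := h.two_mul_le; omega
  have hdim := h.dim
  rw [h.conv] at hn
  subst hd
  have hpos := h.pos
  have h1 : 3 * c ^ 2 = 1 := by push_cast at hdim; linarith
  have h2 : c ^ 2 * (8 * n - 4) = 0 := by
    have : 2 * (1 + (4 ^ 1 - 1) * c ^ 2) = 4 := by linarith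
    rw [this] at hn
    linarith
  have h3 := (mul_eq_zero.1 h2).resolve_left (by positivity)
  have h4 : (8 : ℤ) * n - 4 = 0 := by exact_mod_cast h3
  omega

/-- Integrality requires a square condition on the odd integer `j = 2n - 7`; among `2 ≤ d ≤ 8` only
`d = 6` admits a solution. -/
theorem eq_third_of_exponent_two (hm : m = 2) : d = 6 ∧ c = 1 / 3 := by
  subst hm
  obtain ⟨a, ha0, haz⟩ := h.exists_nontrivial two_pos
  obtain ⟨n, hn⟩ := h.exists_conv_eq ha0 haz
  have hdim := h.dim
  rw [h.conv] at hn
  have hpos := h.pos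
  have hsq := h.sq_eq ha0 haz
  have h1d := h.one_lt
  have h2d : d ≤ 8 := by have := h.two_mul_le; omega
  have hc2 : c ^ 2 ≠ 0 := by positivity
  have key : (2 * (1 + 15 * c ^ 2) - 4) ^ 2 = 16 * c ^ 2 * (2 * (n : ℝ) - 7) ^ 2 := by
    have h1 : (2 * (1 + 15 * c ^ 2) - 4) * f a = c ^ 2 * (8 * n - 28) := by linarith
    have h2 : c ^ 2 * ((2 * (1 + 15 * c ^ 2) - 4) ^ 2 - 16 * c ^ 2 * (2 * (n : ℝ) - 7) ^ 2) = 0 := by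
      have h3 := congrArg (fun x => x ^ 2) h1
      simp only [mul_pow, hsq] at h3
      linear_combination h3
    have := (mul_eq_zero.1 h2).resolve_left hc2
    linarith
  obtain ⟨j, hj⟩ : ∃ j : ℤ, j = 2 * n - 7 := ⟨_, rfl⟩
  have hjr : (2 * (n : ℝ) - 7) = j := by rw [hj]; push_cast; ring
  rw [hjr] at key
  interval_cases d <;> push_cast at hdim
  · have hc : c ^ 2 = 7 / 15 := by linarith
    rw [hc] at key
    have : (7 : ℤ) * j ^ 2 = 135 := by
      have : (7 : ℝ) * j ^ 2 = 135 := by linarith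
      exact_mod_cast this
    omega
  · have hc : c ^ 2 = 13 / 45 := by linarith
    rw [hc] at key
    have : (13 : ℤ) * j ^ 2 = 125 := by
      have : (13 : ℝ) * j ^ 2 = 125 := by linarith
      exact_mod_cast this
    omega
  · have hc : c ^ 2 = 1 / 5 := by linarith
    rw [hc] at key
    have h5 : j ^ 2 = 5 := by
      have : (j : ℝ) ^ 2 = 5 := by linarith
      exact_mod_cast this
    have h6 : j < 3 := by nlinarith
    have h7 : -3 < j := by nlinarith
    interval_cases j <;> omega
  · have hc : c ^ 2 = 11 / 75 := by linarith
    rw [hc] at key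
    have : (11 : ℤ) * j ^ 2 = 27 := by
      have : (11 : ℝ) * j ^ 2 = 27 := by linarith
      exact_mod_cast this
    omega
  · have hc : c ^ 2 = 1 / 9 := by linarith
    refine ⟨rfl, ?_⟩
    nlinarith
  · have hc : c ^ 2 = 9 / 105 := by linarith
    rw [hc] at key
    have : (21 : ℤ) * j ^ 2 = 5 := by
      have : (21 : ℝ) * j ^ 2 = 5 := by linarith
      exact_mod_cast this
    omega
  · have hc : c ^ 2 = 1 / 15 := by linarith
    rw [hc] at key
    have h5 : j ^ 2 = 0 := by
      have : (j : ℝ) ^ 2 = 0 := by linarith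
      exact_mod_cast this
    have h6 : j = 0 := by simpa using h5
    omega

end IsSignFunction

end SignFunction

/-! ### Signs as exponents, and the case of exponent two -/

section SignFunction

/-- The sign attached to an element of `ZMod 2`. -/
def zsign (t : ZMod 2) : ℝ := if t = 0 then 1 else -1

theorem zsign_zero : zsign 0 = 1 := rfl

theorem zsign_one : zsign 1 = -1 := by
  rw [zsign, if_neg (by decide)]

theorem zsign_add (t u : ZMod 2) : zsign (t + u) = zsign t * zsign u := by
  have h : (1 : ZMod 2) + 1 = 0 := by decide
  rcases zmod_two_cases t with rfl | rfl <;> rcases zmod_two_cases u with rfl | rfl <;>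
    simp [zsign_zero, zsign_one, h]

theorem zsign_injective {t u : ZMod 2} (h : zsign t = zsign u) : t = u := by
  rcases zmod_two_cases t with rfl | rfl <;> rcases zmod_two_cases u with rfl | rfl <;>
    simp [zsign_zero, zsign_one] at h ⊢ <;> norm_num at h

theorem zsign_eq (t : ZMod 2) : zsign t = 1 - 2 * (t.val : ℝ) := by
  rcases zmod_two_cases t with rfl | rfl
  · simp [zsign_zero]
  · rw [zsign_one, ZMod.val_one]; norm_num

theorem exists_sum_zsign {P : Type*} [Fintype P] (t : P → ZMod 2) :
    ∃ n : ℕ, ∑ i, zsign (t i) = Fintype.card P - 2 * n ∧ (n : ZMod 2) = ∑ i, t i := by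
  refine ⟨∑ i, (t i).val, ?_, ?_⟩
  · simp only [zsign_eq, Finset.sum_sub_distrib, Finset.sum_const, Finset.card_univ, nsmul_eq_mul,
      mul_one, ← Finset.mul_sum]
    push_cast; ring
  · push_cast
    exact Finset.sum_congr rfl fun i _ => ZMod.natCast_zmod_val _

variable {A : Type*} [AddCommGroup A] [Module (ZMod 2) A] [Fintype A]

namespace IsSignFunction

variable {m d : ℕ} {z : A} {f : A → ℝ} {c : ℝ} (h : IsSignFunction m d z f c)

include h

-- The reference sign `s` is left open, since the right choice between `c` and `-c` decides whether
-- the exponent is quadratic. Setting the exponent to `0` at `0` and to `1` at `z` makes the rule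
-- for `a + z` valid everywhere.
open Classical in
theorem exists_exponent {s : ℝ} (hs : s = c ∨ s = -c) :
    ∃ q : A → ZMod 2, q 0 = 0 ∧ (∀ a, q (a + z) = q a + 1) ∧
      ∀ a, a ≠ 0 → a ≠ z → f a = s * zsign (q a) := by
  have hz := h.ne_zero
  have hpos := h.pos
  have hs0 : s ≠ 0 := by rcases hs with rfl | rfl <;> simp [hpos.ne']
  have h11 : (1 : ZMod 2) + 1 = 0 := by decide
  refine ⟨fun a => if a = 0 ∨ (a ≠ z ∧ f a = s) then 0 else 1, by simp, ?_, ?_⟩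
  · intro a
    dsimp only
    rw [h.map_add_self]
    by_cases h0 : a = 0
    · subst h0; simp [hz]
    by_cases h1 : a = z
    · subst h1
      simp [ZModModule.add_self, hz]
    · have h2 : a + z ≠ 0 := fun h0 => h1 (add_eq_zero_iff_two.1 h0).symm
      by_cases h3 : f a = s
      · have : ¬ (-f a = s) := by rw [h3]; intro h4; apply hs0; linarith
        simp [h0, h1, h2, h3]
        intro h4; exact this (by rw [h3, h4])
      · have : -f a = s := by
          rcases h.eq_or_eq a h0 h1 with h4 | h4 <;> rcases hs with rfl | rfl <;> simp_all
        simp [h0, h1, h3, this, h11]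
  · intro a h0 h1
    by_cases h3 : f a = s
    · simp [h0, h1, h3, zsign_zero]
    · have : f a = -s := by
        rcases h.eq_or_eq a h0 h1 with h4 | h4 <;> rcases hs with rfl | rfl <;> simp_all
      simp only [h0, h3, and_false, or_self, if_false, zsign_one]
      rw [this]; ring

/-- The coset sums `Φ` of `f` are antisymmetric under `z`, and the subspace together with `z` has
index two. So `Φ` has only two values up to sign, and the convolution equation for `f` becomes two
quadratic equations for them. -/
theorem sum_subspace_of_exponent_two (hm : m = 2) {P : Type*} [AddCommGroup P]
    [Module (ZMod 2) P] [Fintype P] (hP : Fintype.card P = 8) (g : P →ₗ[ZMod 2] A)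
    (hg : ∀ i, i ≠ 0 → g i ≠ 0) (hgz : ∀ i, g i ≠ z) :
    ∑ i, f (g i) = 0 ∨ ∑ i, f (g i) = 4 / 3 ∨ ∑ i, f (g i) = 8 / 3 := by
  classical
  obtain ⟨-, rfl⟩ := h.eq_third_of_exponent_two hm
  subst hm
  have hginj : Function.Injective g := by
    rw [injective_iff_map_eq_zero]
    intro i hi
    by_contra h0
    exact hg i h0 hi
  let Φ : A → ℝ := fun x => ∑ i, f (x + g i)
  have hΦg : ∀ x j, Φ (x + g j) = Φ x := by
    intro x j
    simp only [Φ]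
    rw [← Equiv.sum_comp (Equiv.addLeft j) fun i => f (x + g i)]
    refine Finset.sum_congr rfl fun i _ => ?_
    rw [Equiv.coe_addLeft, map_add, add_assoc]
  have hΦz : ∀ x, Φ (x + z) = - Φ x := by
    intro x
    simp only [Φ]
    rw [← Finset.sum_neg_distrib]
    refine Finset.sum_congr rfl fun i _ => ?_
    rw [add_right_comm, h.map_add_self]
  have h1 : ∀ x, ∑ b, f b * Φ (x + b) = 16 / 3 * Φ x := by
    intro x
    simp only [Φ, Finset.mul_sum]
    rw [Finset.sum_comm]
    refine Finset.sum_congr rfl fun i _ => ?_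
    have h2 := h.conv (x + g i)
    have h3 : (2 : ℝ) * (1 + (4 ^ 2 - 1) * (1 / 3) ^ 2) = 16 / 3 := by norm_num
    rw [h3] at h2
    rw [← h2]
    exact Finset.sum_congr rfl fun b _ => by rw [add_right_comm]
  have h2 : ∀ x, ∑ b, Φ b * Φ (x + b) = 8 * (16 / 3) * Φ x := by
    intro x
    have h3 : ∀ b, Φ b * Φ (x + b) = ∑ i, f (b + g i) * Φ (x + b) := fun b => Finset.sum_mul _ _ _
    simp only [h3]
    rw [Finset.sum_comm]
    have h4 : ∀ i, ∑ b, f (b + g i) * Φ (x + b) = 16 / 3 * Φ x := by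
      intro i
      rw [← h1, ← Equiv.sum_comp (Equiv.addRight (g i)) fun b => f b * Φ (x + b)]
      refine Finset.sum_congr rfl fun b _ => ?_
      rw [Equiv.coe_addRight, ← add_assoc, hΦg]
    simp only [h4, Finset.sum_const, Finset.card_univ, hP, nsmul_eq_mul]
    push_cast; ring
  -- coordinates transversal to the subspace
  have hzW : z ∉ LinearMap.range g := by rintro ⟨i, hi⟩; exact hgz i hi
  obtain ⟨τ, hτg, hτz⟩ := exists_functional (LinearMap.range g) hzW
  obtain ⟨t', ht'⟩ : ∃ t', t' ∉ LinearMap.range g ⊔ Submodule.span (ZMod 2) {z} := by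
    by_contra! H
    have h3 : Function.Surjective (fun x : P × ZMod 2 => g x.1 + x.2 • z) := by
      intro a
      obtain ⟨_, ⟨i, rfl⟩, w, hw, rfl⟩ := Submodule.mem_sup.1 (H a)
      obtain ⟨t, rfl⟩ := Submodule.mem_span_singleton.1 hw
      exact ⟨(i, t), rfl⟩
    have h4 := Fintype.card_le_of_surjective _ h3
    rw [Fintype.card_prod, hP, h.card_eq, ZMod.card] at h4
    omega
  obtain ⟨τ', hτ'W, hτ't'⟩ := exists_functional _ ht'
  have hτ'g : ∀ i, τ' (g i) = 0 := fun i =>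
    hτ'W _ (Submodule.mem_sup_left (LinearMap.mem_range_self g i))
  have hτ'z : τ' z = 0 := hτ'W _ (Submodule.mem_sup_right (Submodule.mem_span_singleton_self z))
  have hτg : ∀ i, τ (g i) = 0 := fun i => hτg _ (LinearMap.mem_range_self g i)
  obtain ⟨t, hτt, hτ't⟩ : ∃ t, τ t = 0 ∧ τ' t = 1 := by
    refine ⟨t' + τ t' • z, ?_, ?_⟩
    · rw [map_add, map_smul, hτz, smul_eq_mul, mul_one]; exact ZModModule.add_self _
    · rw [map_add, map_smul, hτ'z, hτ't', smul_zero, add_zero]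
  let T : Finset A := Finset.univ.filter fun a => τ a = 0
  have hTt : ∀ a ∈ T, a + t ∈ T := by
    intro a ha
    rw [Finset.mem_filter] at ha ⊢
    exact ⟨Finset.mem_univ _, by rw [map_add, ha.2, hτt, add_zero]⟩
  let K : Finset A := T.filter fun a => τ' a = 0
  have hK8 : K.card = 8 := by
    have h3 := card_eq_two_mul_card_filter τ hτz Finset.univ (fun _ _ => Finset.mem_univ _)
    have h4 := card_eq_two_mul_card_filter τ' hτ't T hTt
    rw [Finset.card_univ, h.card_eq] at h3
    change 2 * 4 ^ 2 = 2 * T.card at h3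
    change T.card = 2 * K.card at h4
    omega
  have hKg : Finset.univ.image g = K := by
    refine Finset.eq_of_subset_of_card_le ?_ ?_
    · intro a ha
      obtain ⟨i, -, rfl⟩ := Finset.mem_image.1 ha
      simp only [K, T, Finset.mem_filter, Finset.mem_univ, true_and]
      exact ⟨hτg i, hτ'g i⟩
    · rw [hK8, Finset.card_image_of_injective _ hginj, Finset.card_univ, hP]
  have hsum : ∀ G : A → ℝ, (∀ a, G (a + z) = G a) → (∀ a, G (a + t) = G a) →
      (∀ i, G (g i) = G 0) → ∑ a, G a = 32 * G 0 := by
    intro G hGz hGt hGg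
    rw [sum_eq_two_mul_sum_filter τ hτz Finset.univ (fun _ _ => Finset.mem_univ _) G hGz,
      sum_eq_two_mul_sum_filter τ' hτ't T hTt G hGt]
    change 2 * (2 * ∑ a ∈ K, G a) = _
    rw [← hKg, Finset.sum_image (fun _ _ _ _ h => hginj h)]
    simp only [hGg, Finset.sum_const, Finset.card_univ, hP, nsmul_eq_mul]
    push_cast; ring
  have e1 := h2 0
  have e2 := h2 t
  have e3 := hsum (fun b => Φ b * Φ b + Φ (t + b) * Φ (t + b)) (by
    intro a; rw [← add_assoc, hΦz, hΦz]; ring) (by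
    intro a
    have : t + (a + t) = a := by rw [add_comm a t, ← add_assoc, ZModModule.add_self, zero_add]
    rw [this, add_comm a t]; ring) (by
    intro i
    have := hΦg 0 i
    rw [zero_add] at this
    rw [hΦg, this, add_zero])
  have e4 := hsum (fun b => Φ b * Φ (t + b)) (by
    intro a; rw [← add_assoc, hΦz, hΦz]; ring) (by
    intro a
    have : t + (a + t) = a := by rw [add_comm a t, ← add_assoc, ZModModule.add_self, zero_add]
    rw [this, add_comm a t]; ring) (by
    intro i
    have := hΦg 0 i
    rw [zero_add] at this
    rw [hΦg, this, add_zero])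
  have e6 : ∑ b, Φ (t + b) * Φ (t + b) = ∑ b, Φ b * Φ b :=
    Equiv.sum_comp (Equiv.addLeft t) fun b => Φ b * Φ b
  rw [Finset.sum_add_distrib, e6] at e3
  simp only [zero_add] at e1
  rw [e1, add_zero] at e3
  rw [e2, add_zero] at e4
  have e5 : Φ 0 = ∑ i, f (g i) := by simp [Φ]
  rw [← e5]
  -- With `x = Φ 0` and `y = Φ t`, the two equations amount to `x² + y² = (8/3)x` and `xy = (4/3)y`.
  by_cases hr : Φ t = 0
  · rw [hr] at e3
    have : Φ 0 * (Φ 0 - 8 / 3) = 0 := by linarith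
    rcases mul_eq_zero.1 this with h3 | h3
    · exact Or.inl h3
    · right; right; linarith
  · right; left
    have : Φ t * (Φ 0 - 4 / 3) = 0 := by linarith
    have := (mul_eq_zero.1 this).resolve_left hr
    linarith

/-- The third difference of the exponent vanishes on independent triples when `m = 2`. -/
theorem third_difference_of_exponent_two (hm : m = 2) {q : A → ZMod 2} (hq0 : q 0 = 0)
    (hqz : ∀ a, q (a + z) = q a + 1)
    (hq : ∀ a, a ≠ 0 → a ≠ z → f a = -(1 / 3) * zsign (q a)) (a b e : A) :
    q (a + b + e) + q (a + b) + q (b + e) + q (a + e) + q a + q b + q e = 0 := by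
  classical
  let g : (ZMod 2 × ZMod 2 × ZMod 2) →ₗ[ZMod 2] A :=
    (LinearMap.toSpanSingleton (ZMod 2) A a).coprod
      ((LinearMap.toSpanSingleton (ZMod 2) A b).coprod (LinearMap.toSpanSingleton (ZMod 2) A e))
  have hg : ∀ i : ZMod 2 × ZMod 2 × ZMod 2, g i = i.1 • a + (i.2.1 • b + i.2.2 • e) := fun i => rfl
  have h11 : (1 : ZMod 2) + 1 = 0 := by decide
  have hcard : Fintype.card (ZMod 2 × ZMod 2 × ZMod 2) = 8 := rfl
  have hsumP : ∀ F : ZMod 2 × ZMod 2 × ZMod 2 → ZMod 2, ∑ i, F i = F (0, 0, 0) + F (0, 0, 1) + (F (0, 1, 0) + F (0, 1, 1)) +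
      (F (1, 0, 0) + F (1, 0, 1) + (F (1, 1, 0) + F (1, 1, 1))) := by
    intro F
    have h2 : ∀ G : ZMod 2 → ZMod 2, ∑ i, G i = G 0 + G 1 := fun G => Fin.sum_univ_two G
    rw [Fintype.sum_prod_type]
    simp only [Fintype.sum_prod_type, h2]
  have hgoal : ∑ i, q (g i) =
      q (a + b + e) + q (a + b) + q (b + e) + q (a + e) + q a + q b + q e := by
    rw [hsumP]
    simp only [hg, zero_smul, one_smul, zero_add, add_zero, hq0, ← add_assoc]
    ring
  have hqz0 : q z = 1 := by have := hqz 0; rwa [zero_add, hq0, zero_add] at this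
  by_cases hind : ∀ i, i ≠ 0 → g i ≠ 0 ∧ g i ≠ z
  · rw [← hgoal]
    have hgz : ∀ i, g i ≠ z := by
      intro i
      by_cases hi : i = 0
      · rw [hi, _root_.map_zero]; exact h.ne_zero.symm
      · exact (hind i hi).2
    have h3 := h.sum_subspace_of_exponent_two hm hcard g (fun i hi => (hind i hi).1) hgz
    have hD : ∀ i, f (g i) = -(1 / 3) * zsign (q (g i)) + (4 / 3) * (if i = 0 then 1 else 0) := by
      intro i
      by_cases hi : i = 0
      · rw [hi, _root_.map_zero, h.map_zero, hq0, zsign_zero]; norm_num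
      · rw [hq _ (hind i hi).1 (hind i hi).2]; simp [hi]
    simp only [hD] at h3
    rw [Finset.sum_add_distrib, ← Finset.mul_sum, ← Finset.mul_sum] at h3
    obtain ⟨n, hn, hn'⟩ := exists_sum_zsign fun i => q (g i)
    rw [hn, hcard] at h3
    simp only [Finset.sum_ite_eq', Finset.mem_univ, if_true] at h3
    rw [← hn']
    push_cast at h3
    -- The number `n` of odd exponents is `2`, `4` or `6`, hence even. With `s = 1/3` instead of
    -- `-1/3` it would be odd.
    rcases h3 with h3 | h3 | h3
    · have : (n : ℝ) = 2 := by linarith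
      have : n = 2 := by exact_mod_cast this
      subst this; decide
    · have : (n : ℝ) = 4 := by linarith
      have : n = 4 := by exact_mod_cast this
      subst this; decide
    · have : (n : ℝ) = 6 := by linarith
      have : n = 6 := by exact_mod_cast this
      subst this; decide
  -- In a triple dependent modulo `z` the terms cancel in pairs.
  · push Not at hind
    obtain ⟨⟨i, j, k⟩, hi, hgi⟩ := hind
    have hgi' : g (i, j, k) = 0 ∨ g (i, j, k) = z := by
      by_cases h0 : g (i, j, k) = 0
      · exact Or.inl h0
      · exact Or.inr (hgi h0)
    have hx2 : ∀ x : ZMod 2, x + x = 0 := by decide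
    have hx2' : ∀ x y : ZMod 2, x + (x + y) = y := by decide
    have ha2 : ∀ x : A, x + x = 0 := fun x => ZModModule.add_self x
    have ha2' : ∀ x y : A, x + (x + y) = y := fun x y => by
      rw [← add_assoc, ha2, zero_add]
    have hz1 : ∀ x, q (z + x) = q x + 1 := fun x => by rw [add_comm, hqz]
    have hz2 : ∀ x y, q (x + (z + y)) = q (x + y) + 1 := fun x y => by
      rw [← hqz]; congr 1; abel
    have hz3 : ∀ x y, q (x + (y + z)) = q (x + y) + 1 := fun x y => by
      rw [← hqz]; congr 1; abel
    rw [hg] at hgi'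
    rcases zmod_two_cases i with rfl | rfl <;> rcases zmod_two_cases j with rfl | rfl <;>
      rcases zmod_two_cases k with rfl | rfl <;>
      simp only [zero_smul, one_smul, zero_add, add_zero] at hgi'
    · exact absurd rfl hi
    all_goals
      rcases hgi' with hgi' | hgi'
      all_goals
        try simp only [add_eq_iff_two, add_zero] at hgi'
        subst hgi'
        simp only [add_comm, add_left_comm, add_assoc, ha2, ha2', hx2, hx2', hqz, hz1, hz2, hz3,
          hqz0, hq0, add_zero]

end IsSignFunction

end SignFunction

/-! ### Quadratic exponents from transvections -/

section SignFunction

variable {A : Type*} [AddCommGroup A] [Module (ZMod 2) A] [Fintype A]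

open SymplecticSpace

namespace IsSignFunction

variable {m d : ℕ} {z : A} {f : A → ℝ} {c : ℝ} (h : IsSignFunction m d z f c)

include h

/-- Sign functions invariant under the symplectic group have quadratic exponents. -/
theorem exists_exponent_of_equivariant (hm : 0 < m) (π : A →ₗ[ZMod 2] Std (ZMod 2) m)
    (hπ : Function.Surjective π) (hπ0 : ∀ a, π a = 0 ↔ a = 0 ∨ a = z)
    (F : StdGroup 2 m →* (A ≃ₗ[ZMod 2] A)) (hFπ : ∀ g a, π (F g a) = g.1 (π a))
    (hFf : ∀ g a, f (F g a) = f a) (hFz : ∀ g, F g z = z) :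
    ∃ (s : ℝ) (q : A → ZMod 2), (s = c ∨ s = -c) ∧ q 0 = 0 ∧ (∀ a, q (a + z) = q a + 1) ∧
      (∀ a, a ≠ 0 → a ≠ z → f a = s * zsign (q a)) ∧
      ∀ a b e, q (a + b + e) + q (a + b) + q (b + e) + q (a + e) + q a + q b + q e = 0 := by
  have hB := stdForm_isAlt (K := ZMod 2) (m := m)
  have hN := stdForm_nondegenerate (K := ZMod 2) (m := m)
  set B := stdForm (ZMod 2) m with hBdef
  have hBsymm : ∀ x y, B x y = B y x := fun x y => by
    rw [← neg_swap hB, ZModModule.neg_eq_self]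
  have hx2 : ∀ x : ZMod 2, x + x = 0 := by decide
  have ha2 : ∀ x : A, x + x = 0 := fun x => ZModModule.add_self x
  have hoff : ∀ a, π a ≠ 0 → a ≠ 0 ∧ a ≠ z := fun a ha => by
    rw [Ne, hπ0, not_or] at ha; exact ha
  have hπz : π z = 0 := (hπ0 z).2 (Or.inr rfl)
  have hπe : ∀ a b, π a = π b → b = a ∨ b = a + z := by
    intro a b hab
    have h1 : π (a + b) = 0 := by rw [map_add, hab]; exact ZModModule.add_self _
    rcases (hπ0 _).1 h1 with h2 | h2
    · exact Or.inl (add_eq_zero_iff_two.1 h2)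
    · exact Or.inr (add_eq_iff_two.1 h2)
  have hfne : ∀ a, a ≠ 0 → a ≠ z → f a ≠ 0 := by
    intro a h0 h1
    have := h.pos
    rcases h.eq_or_eq a h0 h1 with h2 | h2 <;> rw [h2] <;> simp [this.ne']
  -- transvections
  have hfix : ∀ v a, B (π a) v = 0 → F (transvec hB v 1) a = a := by
    intro v a hav
    by_cases h0 : π a = 0
    · rcases (hπ0 a).1 h0 with rfl | rfl
      · exact _root_.map_zero _
      · exact hFz _
    have h1 : π (F (transvec hB v 1) a) = π a := by
      rw [hFπ, transvec_apply, hav, mul_zero, zero_smul, add_zero]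
    rcases hπe _ _ h1.symm with h2 | h2
    · exact h2
    · exfalso
      have h3 := hFf (transvec hB v 1) a
      rw [h2, h.map_add_self] at h3
      exact hfne a (hoff a h0).1 (hoff a h0).2 (by linarith)
  -- Each transvection lifts to a transvection of `A`, and its direction is a distinguished lift of
  -- `v`.
  have hex : ∀ v, ∃ e, v ≠ 0 → π e = v ∧ ∀ a, F (transvec hB v 1) a = a + B (π a) v • e := by
    intro v
    by_cases hv : v = 0
    · exact ⟨0, fun h => absurd hv h⟩
    obtain ⟨w, -, hw⟩ := exists_ortho_and_not_ortho hN hB (W := ⊥) (y := v) (by simpa using hv)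
    obtain ⟨a₀, rfl⟩ := hπ w
    have hw1 : B (π a₀) v = 1 := zmod_two_eq_one (by rwa [hBsymm])
    refine ⟨F (transvec hB v 1) a₀ + a₀, fun _ => ⟨?_, ?_⟩⟩
    · rw [map_add, hFπ, transvec_apply, hw1, mul_one, one_smul, add_comm, ← add_assoc,
        ZModModule.add_self, zero_add]
    · intro a
      rcases zmod_two_cases (B (π a) v) with h1 | h1
      · rw [h1, zero_smul, add_zero, hfix v a h1]
      · have h2 := hfix v (a + a₀) (by rw [map_add, map_add, LinearMap.add_apply, h1, hw1, hx2])
        rw [map_add] at h2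
        rw [h1, one_smul, add_comm (F _ a₀), ← add_assoc, ← h2, add_assoc, ha2, add_zero]
  choose E hE using hex
  have hEF : ∀ (g : StdGroup 2 m) v, v ≠ 0 → F g (E v) = E (g.1 v) := by
    intro g v hv
    have hgv : g.1 v ≠ 0 := g.1.map_ne_zero_iff.2 hv
    obtain ⟨w, -, hw⟩ := exists_ortho_and_not_ortho hN hB (W := ⊥) (y := v) (by simpa using hv)
    obtain ⟨a, rfl⟩ := hπ w
    have hw1 : B (π a) v = 1 := zmod_two_eq_one (by rwa [hBsymm])
    have h1 : g * transvec hB v 1 = transvec hB (g.1 v) 1 * g := by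
      rw [← conj_transvec, inv_mul_cancel_right]
    have h2 := congrArg (fun t => F t a) h1
    simp only [map_mul, LinearEquiv.mul_apply] at h2
    rw [(hE v hv).2, (hE _ hgv).2, hFπ, (mem_isometryGroup.1 g.2), hw1, one_smul, one_smul,
      map_add] at h2
    exact add_left_cancel h2
  have hftr : ∀ v w, v ≠ 0 → w ≠ 0 → f (E v) = f (E w) := by
    intro v w hv hw
    obtain ⟨g, hg⟩ := exists_isometry_map_eq (fun x => eq_zero_of_stdForm_eq_zero) hv hB hw
    rw [← hg, ← hEF g v hv, hFf]
  obtain ⟨v₀, hv₀⟩ := exists_basis_vector (p := 2) hm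
  have hE0 : ∀ v, v ≠ 0 → E v ≠ 0 ∧ E v ≠ z := fun v hv => hoff _ (by rwa [(hE v hv).1])
  -- This sign gives the distinguished lifts the exponent `1`, as the polar form requires.
  obtain ⟨s, hs⟩ : ∃ s, s = -f (E v₀) := ⟨_, rfl⟩
  have hsc : s = c ∨ s = -c := by
    rcases h.eq_or_eq _ (hE0 v₀ hv₀).1 (hE0 v₀ hv₀).2 with h1 | h1
    · right; rw [hs, h1]
    · left; rw [hs, h1, neg_neg]
  have hs0 : s ≠ 0 := by rw [hs]; exact neg_ne_zero.2 (hfne _ (hE0 v₀ hv₀).1 (hE0 v₀ hv₀).2)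
  obtain ⟨q, hq0, hqz, hq⟩ := h.exists_exponent hsc
  have hqz0 : q z = 1 := by have := hqz 0; rwa [zero_add, hq0, zero_add] at this
  have hqf : ∀ a b, a ≠ 0 → a ≠ z → b ≠ 0 → b ≠ z → f a = f b → q a = q b := by
    intro a b ha haz hb hbz hab
    rw [hq a ha haz, hq b hb hbz] at hab
    exact zsign_injective (mul_left_cancel₀ hs0 hab)
  have hqE : ∀ v, v ≠ 0 → q (E v) = 1 := by
    intro v hv
    have h1 := hq _ (hE0 v hv).1 (hE0 v hv).2
    rw [hftr v v₀ hv hv₀] at h1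
    apply zsign_injective
    rw [zsign_one]
    apply mul_left_cancel₀ hs0
    rw [← h1, hs]; ring
  have hqF : ∀ g a, q (F g a) = q a := by
    intro g a
    by_cases ha : π a = 0
    · rcases (hπ0 a).1 ha with rfl | rfl
      · rw [_root_.map_zero]
      · rw [hFz]
    · have ha' : π (F g a) ≠ 0 := by rw [hFπ]; exact g.1.map_ne_zero_iff.2 ha
      exact hqf _ _ (hoff _ ha').1 (hoff _ ha').2 (hoff _ ha).1 (hoff _ ha).2 (hFf g a)
  -- the polar form
  let β : A → A → ZMod 2 := fun a b => q (a + b) + q a + q b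
  have hβs : ∀ a b, β a b = β b a := fun a b => by simp only [β]; rw [add_comm a b]; ring
  have hβz : ∀ a b, β a (b + z) = β a b := by
    intro a b
    simp only [β]
    rw [← add_assoc, hqz, hqz]
    linear_combination hx2 1
  have hβr : ∀ a b b', π b = π b' → β a b = β a b' := by
    intro a b b' hb
    rcases hπe _ _ hb with rfl | rfl
    · rfl
    · rw [hβz]
  have hβl : ∀ a a' b, π a = π a' → β a b = β a' b := fun a a' b ha => by
    rw [hβs, hβr b a a' ha, hβs]
  have hβ0 : ∀ a b, π a = 0 → β a b = 0 := by
    intro a b ha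
    rw [hβl a 0 b (by rw [ha, _root_.map_zero])]
    simp only [β, hq0, zero_add, add_zero, hx2]
  have hβself : ∀ a b, π a = π b → β a b = 0 := by
    intro a b hab
    rw [hβr a b a hab.symm]
    simp only [β, ha2, hq0, zero_add, hx2]
  have hcocycle : ∀ a b e, β a b + β (a + b) e = β b e + β a (b + e) := by
    intro a b e
    simp only [β]
    rw [add_assoc a b e]
    linear_combination hx2 (q (a + b)) - hx2 (q (b + e))
  -- The transvection along `π b` maps `a` to `a + E (π b)`, and both have the same exponent.
  have hβ1 : ∀ a b, B (π a) (π b) = 1 → β a b = 1 := by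
    intro a b hab
    have hb : π b ≠ 0 := by
      intro h0; rw [h0, _root_.map_zero] at hab; exact zero_ne_one hab
    have ha : π a ≠ 0 := by
      intro h0; rw [h0, _root_.map_zero, LinearMap.zero_apply] at hab; exact zero_ne_one hab
    have hne : π (a + E (π b)) ≠ 0 := by
      rw [map_add, (hE _ hb).1]
      intro h0
      have := add_eq_zero_iff_two.1 h0
      rw [this, hB] at hab; exact zero_ne_one hab
    rw [hβr a b (E (π b)) (hE _ hb).1.symm]
    have h1 := hFf (transvec hB (π b) 1) a
    rw [(hE _ hb).2, hab, one_smul] at h1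
    simp only [β]
    rw [hqf _ _ (hoff _ hne).1 (hoff _ hne).2 (hoff _ ha).1 (hoff _ ha).2 h1, hqE _ hb, hx2,
      zero_add]
  -- The cocycle identity shows that both sides equal `β (a + b) e`.
  have hstep : ∀ a b e, B (π a) (π e) = 0 → B (π b) (π e) = 0 → B (π a) (π b) = 1 →
      β a e = β b e := by
    have key : ∀ a b e, B (π a) (π e) = 0 → B (π b) (π e) = 0 → B (π a) (π b) = 1 →
        β (a + b) e = β b e := by
      intro a b e hae hbe hab
      have h1 := hcocycle a b e
      rw [hβ1 a b hab, hβ1 a (b + e) (by rw [map_add, map_add, hab, hae, add_zero]),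
        add_comm] at h1
      exact add_right_cancel h1
    intro a b e hae hbe hab
    rw [← key a b e hae hbe hab, add_comm, key b a e hbe hae (by rw [hBsymm, hab])]
  have hconst : ∀ a b e, B (π a) (π e) = 0 → B (π b) (π e) = 0 → π a ≠ 0 → π a ≠ π e → π b ≠ 0 →
      π b ≠ π e → β a e = β b e := by
    intro a b e hae hbe ha0 hae' hb0 hbe'
    have hW : ∀ a, π a ≠ 0 → π a ≠ π e → π a ∉ Submodule.span (ZMod 2) {π e} := by
      intro a h1 h2 h3
      obtain ⟨t, ht⟩ := Submodule.mem_span_singleton.1 h3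
      rcases zmod_two_cases t with rfl | rfl
      · rw [zero_smul] at ht; exact h1 ht.symm
      · rw [one_smul] at ht; exact h2 ht.symm
    have hmem := Submodule.mem_span_singleton_self (R := ZMod 2) (π e)
    obtain ⟨x, hx, hax⟩ := exists_ortho_and_not_ortho hN hB (hW a ha0 hae')
    obtain ⟨y, hy, hby⟩ := exists_ortho_and_not_ortho hN hB (hW b hb0 hbe')
    have hx := hx _ hmem
    have hy := hy _ hmem
    have hax := zmod_two_eq_one hax
    have hby := zmod_two_eq_one hby
    -- Such a `w` links `a` and `b` by two applications of `hstep`.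
    obtain ⟨w, hw, haw, hbw⟩ : ∃ w, B (π e) w = 0 ∧ B (π a) w = 1 ∧ B (π b) w = 1 := by
      rcases zmod_two_cases (B (π b) x) with h1 | h1
      · rcases zmod_two_cases (B (π a) y) with h2 | h2
        · exact ⟨x + y, by rw [map_add, hx, hy, add_zero], by rw [map_add, hax, h2, add_zero],
            by rw [map_add, h1, hby, zero_add]⟩
        · exact ⟨y, hy, h2, hby⟩
      · exact ⟨x, hx, hax, h1⟩
    obtain ⟨w, rfl⟩ := hπ w
    rw [hstep a w e hae (by rw [hBsymm, hw]) haw, hstep b w e hbe (by rw [hBsymm, hw]) hbw]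
  have hconst' : ∀ a e a' e', B (π a) (π e) = 0 → π a ≠ 0 → π a ≠ π e → π e ≠ 0 →
      B (π a') (π e') = 0 → π a' ≠ 0 → π a' ≠ π e' → π e' ≠ 0 → β a e = β a' e' := by
    intro a e a' e' h1 h2 h3 h4 h1' h2' h3' h4'
    obtain ⟨g, hg⟩ := exists_isometry_map_eq (fun x => eq_zero_of_stdForm_eq_zero) h4 hB h4'
    have e1 : β (F g a) (F g e) = β a e := by
      simp only [β]
      rw [← map_add, hqF, hqF, hqF]
    have e2 : π (F g e) = π e' := by rw [hFπ, hg]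
    rw [← e1, hβr _ _ _ e2]
    apply hconst
    · rw [← e2, hFπ, hFπ, mem_isometryGroup.1 g.2, h1]
    · exact h1'
    · rw [hFπ]; exact g.1.map_ne_zero_iff.2 h2
    · rw [← e2, hFπ, hFπ]; exact fun h0 => h3 (g.1.injective h0)
    · exact h2'
    · exact h3'
  -- On orthogonal pairs of different nonzero vectors `β` is constant. If the constant were `1`,
  -- then `r` below would be additive and `f` would be a multiple of a character.
  have hβB : ∀ a b, β a b = B (π a) (π b) := by
    by_contra! H
    obtain ⟨a₁, e₁, hne⟩ := H
    have hBae : B (π a₁) (π e₁) = 0 := by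
      by_contra h0
      have h1 := zmod_two_eq_one h0
      exact hne (by rw [hβ1 _ _ h1, h1])
    rw [hBae] at hne
    have h1 : π a₁ ≠ 0 := fun h0 => hne (hβ0 _ _ h0)
    have h2 : π a₁ ≠ π e₁ := fun h0 => hne (hβself _ _ h0)
    have h3 : π e₁ ≠ 0 := fun h0 => hne (by rw [hβs]; exact hβ0 _ _ h0)
    have hall : ∀ a b, π a ≠ 0 → π b ≠ 0 → π a ≠ π b → β a b = 1 := by
      intro a b ha hb hab
      rcases zmod_two_cases (B (π a) (π b)) with h4 | h4
      · rw [hconst' a b a₁ e₁ h4 ha hab hb hBae h1 h2 h3]; exact zmod_two_eq_one hne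
      · exact hβ1 a b h4
    classical
    let r : A → ZMod 2 := fun a => q a + if π a = 0 then 0 else 1
    have hr : ∀ a b, r (a + b) = r a + r b := by
      intro a b
      have hqab : q (a + b) = β a b + q a + q b := by
        simp only [β]; linear_combination - hx2 (q a) - hx2 (q b)
      simp only [r]
      rw [hqab, map_add]
      by_cases ha : π a = 0
      · rw [hβ0 a b ha, ha]; simp; ring
      by_cases hb : π b = 0
      · rw [hβs, hβ0 b a hb, hb]; simp [ha]; ring
      by_cases hab : π a = π b
      · rw [hβself a b hab, hab]
        simp only [ZModModule.add_self, hb, if_true, if_false]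
        linear_combination - hx2 1
      · have hab' : π a + π b ≠ 0 := fun h0 => hab (add_eq_zero_iff_two.1 h0).symm
        rw [hall a b ha hb hab]
        simp only [ha, hb, hab', if_false]
        ring
    refine h.ne_mul_character hm (χ := fun a => zsign (r a)) (fun a b => ?_) ?_ (-s) ?_
    · rw [hr, zsign_add]
    · simp only [r, hπz, if_true, add_zero, hqz0, zsign_one]
    · intro a ha haz
      have : π a ≠ 0 := fun h0 => ((hπ0 a).1 h0).elim ha haz
      simp only [r, this, if_false, zsign_add, zsign_one]
      rw [hq a ha haz]; ring
  refine ⟨s, q, hsc, hq0, hqz, hq, fun a b e => ?_⟩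
  have e1 : β (a + b) e + β a e + β b e = 0 := by
    rw [hβB, hβB, hβB, map_add, map_add, LinearMap.add_apply]
    linear_combination hx2 (B (π a) (π e)) + hx2 (B (π b) (π e))
  simp only [β] at e1
  linear_combination e1 - hx2 (q e)

end IsSignFunction

end SignFunction

/-! ### Coordinates for a quadratic exponent -/

section SignFunction

variable {A : Type*} [AddCommGroup A] [Module (ZMod 2) A] [Fintype A]

open SymplecticSpace

namespace IsSignFunction

variable {m d : ℕ} {z : A} {f : A → ℝ} {c : ℝ} (h : IsSignFunction m d z f c)

include h

/-- Normal form of a sign function with quadratic exponent. -/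
theorem exists_coordinates (hm : 0 < m) {s : ℝ} (hs : s = c ∨ s = -c) {q : A → ZMod 2}
    (hq0 : q 0 = 0) (hqz : ∀ a, q (a + z) = q a + 1)
    (hq : ∀ a, a ≠ 0 → a ≠ z → f a = s * zsign (q a))
    (hq3 : ∀ a b e, q (a + b + e) + q (a + b) + q (b + e) + q (a + e) + q a + q b + q e = 0)
    (htr : ∀ a b, a ≠ 0 → a ≠ z → b ≠ 0 → b ≠ z → ∃ g : A ≃+ A, (∀ y, f (g y) = f y) ∧
      g z = z ∧ (g a = b ∨ g a = b + z)) :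
    ∃ ψ : Std (ZMod 2) m →ₗ[ZMod 2] A, (∀ a, ∃ u, a = ψ u ∨ a = ψ u + z) ∧
      ∀ u, u ≠ 0 → f (ψ u) = s * zsign (u.1 ⬝ᵥ u.2) := by
  have hx2 : ∀ x : ZMod 2, x + x = 0 := by decide
  have ha2 : ∀ x : A, x + x = 0 := fun x => ZModModule.add_self x
  have hs0 : s ≠ 0 := by
    have := h.pos
    rcases hs with rfl | rfl <;> simp [this.ne']
  have hqz0 : q z = 1 := by have := hqz 0; rwa [zero_add, hq0, zero_add] at this
  let β : A → A → ZMod 2 := fun a b => q (a + b) + q a + q b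
  have hβs : ∀ a b, β a b = β b a := fun a b => by simp only [β]; rw [add_comm a b]; ring
  have hβl : ∀ a a' b, β (a + a') b = β a b + β a' b := by
    intro a a' b
    simp only [β]
    linear_combination hq3 a a' b - hx2 (q (a + b)) - hx2 (q (a' + b)) - hx2 (q a) - hx2 (q a') - hx2 (q b)
  have hβr : ∀ a b b', β a (b + b') = β a b + β a b' := by
    intro a b b'
    rw [hβs, hβl, hβs b, hβs b']
  let B : LinearMap.BilinForm (ZMod 2) A := LinearMap.mk₂ (ZMod 2) β hβl
    (fun c a b => ZMod.map_smul (AddMonoidHom.mk' (fun a => β a b) (fun a a' => hβl a a' b)) c a)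
    hβr (fun c a b => ZMod.map_smul (AddMonoidHom.mk' (fun b => β a b) (hβr a)) c b)
  have hBβ : ∀ a b, B a b = β a b := fun _ _ => rfl
  have hqadd : ∀ a b, q (a + b) = q a + q b + B a b := by
    intro a b
    rw [hBβ]
    simp only [β]
    linear_combination - hx2 (q a) - hx2 (q b)
  have hBalt : B.IsAlt := by
    intro a
    rw [hBβ]
    simp only [β, ha2, hq0, zero_add, hx2]
  have hBz : ∀ a, B a z = 0 := by
    intro a
    rw [hBβ]
    simp only [β, hqz, hqz0]
    linear_combination hx2 (q a) + hx2 1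
  -- nondegeneracy
  have hrad : ∀ a, (∀ b, B a b = 0) → a = 0 ∨ a = z := by
    intro a ha
    by_contra! hne
    have hall : ∀ b b', B b b' = 0 := by
      intro b b'
      by_cases hb0 : b = 0
      · rw [hb0, _root_.map_zero, LinearMap.zero_apply]
      by_cases hbz : b = z
      · rw [hbz, hBβ, hβs]; exact hBz b'
      obtain ⟨g, hg, hgz, hgab⟩ := htr a b hne.1 hne.2 hb0 hbz
      have hqg : ∀ y, q (g y) = q y := by
        intro y
        by_cases hy0 : y = 0
        · rw [hy0, _root_.map_zero]
        by_cases hyz : y = z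
        · rw [hyz, hgz]
        have h0 : g y ≠ 0 := fun h0 => hy0 (g.injective (by rw [h0, _root_.map_zero]))
        have h1 : g y ≠ z := fun h0 => hyz (g.injective (by rw [h0, hgz]))
        have h2 := hg y
        rw [hq _ h0 h1, hq _ hy0 hyz] at h2
        exact zsign_injective (mul_left_cancel₀ hs0 h2)
      have hBg : ∀ y y', B (g y) (g y') = B y y' := by
        intro y y'
        rw [hBβ, hBβ]
        simp only [β]
        rw [← _root_.map_add, hqg, hqg, hqg]
      obtain ⟨y, rfl⟩ := g.surjective b'
      rcases hgab with h1 | h1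
      · rw [← h1, hBg, ha]
      · have h2 : b = g a + z := by rw [h1, add_add_self_two]
        rw [h2, _root_.map_add, LinearMap.add_apply, hBg, ha, hBβ z, hβs, ← hBβ, hBz, add_zero]
    refine h.ne_mul_character hm (χ := fun a => zsign (q a)) (fun a b => ?_) ?_ s hq
    · rw [hqadd, hall, add_zero, zsign_add]
    · rw [hqz0, zsign_one]
  -- a complement
  obtain ⟨T, hT⟩ := Submodule.exists_isCompl (Submodule.span (ZMod 2) {z})
  have hfr : Module.finrank (ZMod 2) T = 2 * m := by
    have h1 := Submodule.finrank_add_eq_of_isCompl hT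
    rw [finrank_span_singleton h.ne_zero] at h1
    have h2 := Module.card_eq_pow_finrank (K := ZMod 2) (V := A)
    rw [h.card_eq, ZMod.card] at h2
    have h3 : 2 * 4 ^ m = 2 ^ (1 + 2 * m) := by
      rw [pow_add, pow_mul]; norm_num
    rw [h3] at h2
    have := Nat.pow_right_injective le_rfl h2
    omega
  have hdec : ∀ a, ∃ t ∈ T, ∃ k : ZMod 2, a = t + k • z := by
    intro a
    have h1 : a ∈ Submodule.span (ZMod 2) {z} ⊔ T := by rw [hT.sup_eq_top]; trivial
    obtain ⟨w, hw, t, ht, rfl⟩ := Submodule.mem_sup.1 h1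
    obtain ⟨k, rfl⟩ := Submodule.mem_span_singleton.1 hw
    exact ⟨t, ht, k, add_comm _ _⟩
  have hzT : z ∉ T := by
    intro h0
    exact h.ne_zero ((Submodule.disjoint_def.1 hT.disjoint) z
      (Submodule.mem_span_singleton_self z) h0)
  obtain ⟨m', e, he⟩ := exists_std_isometry _ T (B.restrict T) (fun x => hBalt x.1) (by
    intro x hx
    have h1 : ∀ b, B x.1 b = 0 := by
      intro b
      obtain ⟨t, ht, k, rfl⟩ := hdec b
      rw [_root_.map_add, map_smul, hBz, smul_zero, add_zero]
      exact hx ⟨t, ht⟩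
    rcases hrad _ h1 with h2 | h2
    · exact Subtype.ext h2
    · exact absurd (h2 ▸ x.2) hzT) rfl
  obtain rfl : m' = m := by
    have h1 := e.finrank_eq
    rw [hfr, finrank_std] at h1
    omega
  have he' : ∀ u w, B (e u : A) (e w) = stdForm (ZMod 2) m' u w := he
  -- Two quadratic forms with the same polar form differ by a linear form `r`. Adding `r u • z`
  -- absorbs it, since `z` has exponent `1`.
  let r : Std (ZMod 2) m' → ZMod 2 := fun u => q (e u : A) + u.1 ⬝ᵥ u.2
  have hr : ∀ u w, r (u + w) = r u + r w := by
    intro u w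
    simp only [r]
    rw [_root_.map_add, Submodule.coe_add, hqadd, he', stdForm_apply, Prod.fst_add, Prod.snd_add]
    simp only [add_dotProduct, dotProduct_add]
    rw [dotProduct_comm u.2 w.1]
    linear_combination hx2 (u.1 ⬝ᵥ w.2)
  let rl : Std (ZMod 2) m' →ₗ[ZMod 2] ZMod 2 :=
    (AddMonoidHom.mk' r hr).toZModLinearMap 2
  have hrl : ∀ u, rl u = r u := fun _ => rfl
  let ψ : Std (ZMod 2) m' →ₗ[ZMod 2] A :=
    T.subtype ∘ₗ e.toLinearMap + (LinearMap.toSpanSingleton (ZMod 2) A z) ∘ₗ rl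
  have hψ : ∀ u, ψ u = (e u : A) + r u • z := fun _ => rfl
  have hqk : ∀ (a : A) (k : ZMod 2), q (a + k • z) = q a + k := by
    intro a k
    rcases zmod_two_cases k with rfl | rfl
    · rw [zero_smul, add_zero, add_zero]
    · rw [one_smul, hqz]
  refine ⟨ψ, fun a => ?_, fun u hu => ?_⟩
  · obtain ⟨t, ht, k, rfl⟩ := hdec a
    obtain ⟨u, hu⟩ := e.surjective ⟨t, ht⟩
    refine ⟨u, ?_⟩
    have hk : ∀ k l : ZMod 2, k = l ∨ k = l + 1 := by decide
    rw [hψ, hu]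
    rcases hk k (r u) with rfl | rfl
    · exact Or.inl rfl
    · right; rw [add_smul, one_smul, add_assoc]
  · have heu : (e u : A) ≠ 0 := fun h0 => hu (e.map_eq_zero_iff.1 (Subtype.ext h0))
    have h1 : ψ u ≠ 0 := by
      intro h0
      rw [hψ] at h0
      have h2 := add_eq_zero_iff_two.1 h0
      apply hu
      apply e.map_eq_zero_iff.1
      apply Subtype.ext
      refine (Submodule.disjoint_def.1 hT.disjoint) _ ?_ (e u).2
      rw [← h2]; exact Submodule.smul_mem _ _ (Submodule.mem_span_singleton_self z)
    have h2 : ψ u ≠ z := by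
      intro h0
      rw [hψ] at h0
      apply hu
      apply e.map_eq_zero_iff.1
      apply Subtype.ext
      refine (Submodule.disjoint_def.1 hT.disjoint) _ ?_ (e u).2
      have h3 : (e u : A) = z + r u • z := by
        have := add_add_self_two (e u : A) (r u • z)
        rw [h0] at this
        exact this.symm
      rw [h3]
      exact add_mem (Submodule.mem_span_singleton_self z)
        (Submodule.smul_mem _ _ (Submodule.mem_span_singleton_self z))
    rw [hq _ h1 h2, hψ, hqk]
    congr 2
    simp only [r]
    linear_combination hx2 (q (e u : A))

end IsSignFunction

end SignFunction

/-! ### The Gram matrix of an elementary abelian configuration -/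

section OrthogonalSystem

open SymplecticSpace

variable {V : Type*} [NormedAddCommGroup V] [InnerProductSpace ℂ V] [FiniteDimensional ℂ V]

open Classical in
/-- The lines of an elementary abelian configuration carry the Gram matrix of a quadratic form. -/
theorem exists_orthogonal_system {m : ℕ} (hm : 0 < m)
    {L : Set (Submodule ℂ V)} (hL : IsEquiangularLineSet L) (hn : L.ncard = 2 ^ (2 * m))
    (hd1 : 1 < Module.finrank ℂ V) (hd2 : 2 * Module.finrank ℂ V ≤ 2 ^ (2 * m))
    {E S : Type*} [Group E] [Group S] {φ : S →* MulAut E} (hcard : Nat.card E = 2 ^ (1 + 2 * m))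
    {ρ : E →* (V ≃ₗᵢ[ℂ] V)} {σ : S →* (V ≃ₗᵢ[ℂ] V)} {Z : Subgroup E}
    (h : IsLineConfiguration 2 L ρ σ φ Z) (hE : IsElementaryAbelian 2 E)
    (hS : Nonempty (S ≃* Sp m 2)) :
    1 < m ∧ ∃ (x : Std (ZMod 2) m → V) (s : ℝ),
      (∀ u w, inner ℂ (x u) (x w) = (1 - s) * (if u = w then 1 else 0) +
        s * zsign ((u + w).1 ⬝ᵥ (u + w).2)) ∧
      L = Set.range fun u => Submodule.span ℂ {x u} := by
  have h4 : 2 ^ (2 * m) = 4 ^ m := by rw [pow_mul]; norm_num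
  have hx2 : ∀ x : E, x * x = 1 := fun x => by rw [← pow_two]; exact hE.2 x
  have hxinv : ∀ x : E, x⁻¹ = x := fun x => inv_eq_of_mul_eq_one_right (hx2 x)
  obtain ⟨l, hl⟩ : L.Nonempty := by
    rw [Set.nonempty_iff_ne_empty]
    rintro rfl
    rw [Set.ncard_empty] at hn
    exact (pow_pos two_pos _).ne hn
  obtain ⟨v, hv, rfl⟩ := hL.exists_unit hl
  have hv0 : v ≠ 0 := by rintro rfl; simp at hv
  -- the scalars
  obtain ⟨ζ, hζ1, hZ⟩ : ∃ ζ, ζ ≠ 1 ∧ ∀ e, e ∈ Z ↔ e = 1 ∨ e = ζ := by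
    have h1 : Z ≠ ⊥ := by
      rintro rfl
      have := h.card_eq
      rw [Subgroup.card_bot] at this
      omega
    obtain ⟨ζ, hζ, hζ1⟩ := (Subgroup.bot_or_exists_ne_one Z).resolve_left h1
    refine ⟨ζ, hζ1, fun e => ⟨fun he => ?_, ?_⟩⟩
    · by_contra! hne
      have hfin : Finite Z := Nat.finite_of_card_ne_zero (by rw [h.card_eq]; norm_num)
      have : Fintype Z := Fintype.ofFinite Z
      have h2 : Fintype.card Z = 2 := by rw [← Nat.card_eq_fintype_card, h.card_eq]
      have h3 : ({1, ⟨ζ, hζ⟩, ⟨e, he⟩} : Finset Z).card = 3 := by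
        rw [Finset.card_eq_three]
        refine ⟨1, ⟨ζ, hζ⟩, ⟨e, he⟩, ?_, ?_, ?_, rfl⟩
        · exact fun h0 => hζ1 (congrArg Subtype.val h0).symm
        · exact fun h0 => hne.1 (congrArg Subtype.val h0).symm
        · exact fun h0 => hne.2 (congrArg Subtype.val h0).symm
      have := Finset.card_le_univ ({1, ⟨ζ, hζ⟩, ⟨e, he⟩} : Finset Z)
      omega
    · rintro (rfl | rfl)
      · exact one_mem _
      · exact hζ
  -- A scalar of square `1` that is not the identity.
  have hρζ : ∀ x, ρ ζ x = -x := by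
    obtain ⟨c, hc⟩ := (h.mem_iff ζ).1 ((hZ ζ).2 (Or.inr rfl))
    have h1 : (c * c) • v = v := by
      rw [mul_smul, ← hc v, ← hc]
      have := congrArg (fun g => ρ g v) (hx2 ζ)
      simpa [map_mul] using this
    have h2 : c * c = 1 := by
      have h3 : (c * c - 1) • v = 0 := by rw [sub_smul, h1, one_smul, sub_self]
      exact sub_eq_zero.1 ((smul_eq_zero.1 h3).resolve_right hv0)
    rcases mul_self_eq_one_iff.1 h2 with rfl | rfl
    · exfalso
      apply hζ1
      apply h.injective
      refine LinearIsometryEquiv.ext fun x => ?_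
      rw [hc, one_smul, map_one]; rfl
    · intro x; rw [hc, neg_one_smul]
  -- the vector space
  obtain ⟨A, _, _, π, F, hsurj, hmul, hker, hF, hcA⟩ := exists_module_quotient (p := 2) φ
    (⊥ : Subgroup E) (fun x y => by rw [Subgroup.mem_bot, hE.1 x y]; group)
    (fun x => by rw [Subgroup.mem_bot]; exact hE.2 x)
    (fun s e he => by rw [Subgroup.mem_bot] at he ⊢; rw [he, map_one])
  have hπ1 : π 1 = 0 := (hker 1).2 (one_mem _)
  have hinj : ∀ x y, π x = π y → x = y := by
    intro x y hxy
    have h1 : π (x * y) = 0 := by rw [hmul, hxy]; exact ZModModule.add_self _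
    rw [hker, Subgroup.mem_bot] at h1
    rw [← hxinv y]; exact eq_inv_of_mul_eq_one_left h1
  rw [Subgroup.card_bot, one_mul, hcard] at hcA
  have hfinA : Finite A := Nat.finite_of_card_ne_zero (by rw [hcA]; positivity)
  have : Fintype A := Fintype.ofFinite A
  have hcA' : Fintype.card A = 2 * 4 ^ m := by
    rw [← Nat.card_eq_fintype_card, hcA, pow_add, h4, pow_one]
  obtain ⟨ι, hι⟩ := hsurj.hasRightInverse
  have hιπ : ∀ x, ι (π x) = x := fun x => hinj _ _ (hι _)
  let x : A → V := fun a => ρ (ι a) v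
  have hx : ∀ e, x (π e) = ρ e v := fun e => by simp only [x, hιπ]
  let f : A → ℝ := fun a => (inner ℂ v (x a)).re
  -- The elements of `E` act as unitary involutions, so the inner product equals its conjugate.
  have hreal : ∀ a, inner ℂ v (x a) = (f a : ℂ) := by
    intro a
    rw [eq_comm]
    apply Complex.conj_eq_iff_re.1
    rw [inner_conj_symm]
    have h1 : ρ (ι a) (x a) = v := by
      have := congrArg (fun g => ρ g v) (hx2 (ι a))
      simpa [map_mul] using this
    rw [← (ρ (ι a)).inner_map_map, h1]
  have hG : ∀ a b, inner ℂ (x a) (x b) = (f (a + b) : ℂ) := by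
    intro a b
    obtain ⟨e, rfl⟩ := hsurj a
    obtain ⟨e', rfl⟩ := hsurj b
    rw [← hmul, ← hreal, hx, hx, hx, ← (ρ e).inner_map_map]
    have h1 : ρ e (ρ e v) = v := by
      have := congrArg (fun g => ρ g v) (hx2 e)
      simpa [map_mul] using this
    rw [h1, map_mul]; rfl
  set z := π ζ with hz
  have hz0 : z ≠ 0 := by
    rw [← hπ1]; exact fun h0 => hζ1 (hinj _ _ h0)
  have hxz : ∀ a, x (a + z) = -x a := by
    intro a
    obtain ⟨e, rfl⟩ := hsurj a
    rw [hz, ← hmul, hx, hx, hE.1, map_mul]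
    exact hρζ _
  have hf0 : f 0 = 1 := by
    have h1 := hreal 0
    rw [← hπ1, hx, map_one] at h1
    have h2 : inner ℂ v v = (f (π 1) : ℂ) := h1
    rw [inner_self_eq_norm_sq_to_K, hv] at h2
    rw [← hπ1]
    norm_num at h2
    exact_mod_cast h2.symm
  have hLx : L = Set.range fun a => Submodule.span ℂ {x a} := by
    rw [h.lines_eq v hl]
    apply Set.eq_of_subset_of_subset
    · rintro _ ⟨e, rfl⟩
      exact ⟨π e, by dsimp only; rw [hx]⟩
    · rintro _ ⟨a, rfl⟩
      exact ⟨ι a, rfl⟩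
  have hspan := span_range_of_lines hL.span_eq_top hLx
  -- invariance
  have hFf : ∀ s a, f (F s a) = f a := by
    intro s a
    obtain ⟨e, rfl⟩ := hsurj a
    obtain ⟨e', c, hc⟩ := h.exists_lift v hl s
    have hcn : ‖c‖ = 1 := by
      have e1 := congrArg norm hc
      rwa [LinearIsometryEquiv.norm_map, LinearIsometryEquiv.norm_map, norm_smul, hv, mul_one,
        eq_comm] at e1
    have e1 : ρ (φ s e) (ρ e' (σ s v)) = ρ e' (σ s (ρ e v)) := by
      have : ρ (φ s e) * (ρ e' * σ s) = ρ e' * σ s * ρ e := by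
        rw [← mul_assoc, ← map_mul, hE.1, map_mul, h.conj_eq]; group
      exact congrArg (fun g : V ≃ₗᵢ[ℂ] V => g v) this
    have e2 : inner ℂ (ρ e' (σ s v)) (ρ (φ s e) (ρ e' (σ s v))) = inner ℂ v (ρ e v) := by
      rw [e1, LinearIsometryEquiv.inner_map_map, LinearIsometryEquiv.inner_map_map]
    rw [hc, map_smul, inner_smul_left, inner_smul_right, ← mul_assoc, RCLike.conj_mul, hcn] at e2
    have e3 : inner ℂ v (ρ (φ s e) v) = inner ℂ v (ρ e v) := by simpa using e2
    rw [← hx, ← hx, ← hF, hreal, hreal] at e3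
    exact_mod_cast e3
  have hφζ : ∀ s, φ s ζ = ζ := by
    intro s
    apply h.injective
    refine LinearIsometryEquiv.ext fun y => ?_
    rw [h.conj_eq, LinearIsometryEquiv.coe_mul, LinearIsometryEquiv.coe_mul, Function.comp_apply,
      Function.comp_apply, hρζ, hρζ, map_neg]
    congr 1
    exact (σ s).apply_symm_apply y
  have hFz : ∀ s, F s z = z := fun s => by rw [hz, hF, hφζ]
  have htr : ∀ a b, a ≠ 0 → a ≠ z → b ≠ 0 → b ≠ z → ∃ s, F s a = b ∨ F s a = b + z := by
    intro a b ha haz hb hbz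
    obtain ⟨y, rfl⟩ := hsurj a
    obtain ⟨y', rfl⟩ := hsurj b
    have hnot : ∀ y, π y ≠ 0 → π y ≠ z → y ∉ Z := by
      intro y h1 h2 h3
      rcases (hZ y).1 h3 with rfl | rfl
      · exact h1 hπ1
      · exact h2 rfl
    obtain ⟨e, s, -, hes⟩ := h.transitive v hl y (hnot y ha haz) y' (hnot y' hb hbz)
    have h1 : e * φ s y * e⁻¹ = φ s y := by rw [hE.1 e]; group
    rw [h1, hxinv] at hes
    refine ⟨s, ?_⟩
    rw [hF]
    rcases (hZ _).1 hes with h2 | h2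
    · left
      rw [mul_eq_one_iff_inv_eq, hxinv] at h2
      rw [h2]
    · right
      rw [hz, ← h2, ← hmul]
      congr 1
      rw [← mul_assoc, hx2, one_mul]
  obtain ⟨c, hc⟩ := exists_isSignFunction hm hcA' hz0 hf0 hG hxz hspan hd1 (by rwa [← h4])
    (fun a b ha haz hb hbz => by
      obtain ⟨s, hs⟩ := htr a b ha haz hb hbz
      exact ⟨(F s).toAddEquiv, hFf s, hs⟩)
  have hm1 := hc.one_lt_exponent hm
  refine ⟨hm1, ?_⟩
  -- the quadratic exponent
  obtain ⟨s, q, hs, hq0, hqz, hq, hq3⟩ : ∃ (s : ℝ) (q : A → ZMod 2), (s = c ∨ s = -c) ∧ q 0 = 0 ∧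
      (∀ a, q (a + z) = q a + 1) ∧ (∀ a, a ≠ 0 → a ≠ z → f a = s * zsign (q a)) ∧
      ∀ a b e, q (a + b + e) + q (a + b) + q (b + e) + q (a + e) + q a + q b + q e = 0 := by
    -- For `m = 2` the action on `E/Z` need not be natural, and the numerical argument, with `s =
    -- -1/3`, replaces the one with transvections.
    rcases Nat.lt_or_ge m 3 with hm3 | hm3
    · have hm2 : m = 2 := by omega
      obtain ⟨-, rfl⟩ := hc.eq_third_of_exponent_two hm2
      obtain ⟨q, hq0, hqz, hq⟩ := hc.exists_exponent (Or.inr rfl)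
      exact ⟨_, q, Or.inr rfl, hq0, hqz, hq, hc.third_difference_of_exponent_two hm2 hq0 hqz hq⟩
    · obtain ⟨M, _, _, π', F', hsurj', hmul', hker', hF', hcM⟩ := exists_module_quotient (p := 2) φ
        Z (fun x y => by rw [hE.1 x y]; simp) (fun x => by rw [hE.2 x]; exact one_mem _)
        (fun s e he => by
          rcases (hZ e).1 he with rfl | rfl
          · rw [map_one]; exact one_mem _
          · rwa [hφζ])
      have hcM' : Nat.card M = 2 ^ (2 * m) := by
        rw [h.card_eq, hcard, pow_add, pow_one] at hcM
        exact Nat.eq_of_mul_eq_mul_left two_pos hcM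
      obtain ⟨eS⟩ := hS
      let τ : StdGroup 2 m →* S := eS.symm.toMonoidHom.comp (toSp 2 m)
      have hτ : Function.Surjective τ := eS.symm.surjective.comp toSp_surjective
      obtain ⟨α, hα⟩ := exists_equivariant_equiv hm3 hcM' (F'.comp τ) (by
        intro a b ha hb
        obtain ⟨y, rfl⟩ := hsurj' a
        obtain ⟨y', rfl⟩ := hsurj' b
        obtain ⟨e, s, -, hes⟩ := h.transitive v hl y (fun hy => ha ((hker' y).2 hy)) y'
          (fun hy => hb ((hker' y').2 hy))
        obtain ⟨g, rfl⟩ := hτ s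
        have h1 : e * φ (τ g) y * e⁻¹ = φ (τ g) y := by rw [hE.1 e]; group
        rw [h1, hxinv, ← hker', hmul'] at hes
        refine ⟨g, ?_⟩
        rw [MonoidHom.comp_apply, hF']
        exact add_eq_zero_iff_two.1 hes)
      let pr : A →ₗ[ZMod 2] Std (ZMod 2) m := (AddMonoidHom.mk' (fun a => α (π' (ι a)))
        (fun a b => by
          obtain ⟨e, rfl⟩ := hsurj a
          obtain ⟨e', rfl⟩ := hsurj b
          rw [← hmul, hιπ, hιπ, hιπ, hmul', map_add])).toZModLinearMap 2
      have hpr : ∀ e, pr (π e) = α (π' e) := fun e => by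
        change α (π' (ι (π e))) = _
        rw [hιπ]
      refine hc.exists_exponent_of_equivariant hm pr ?_ ?_ (F.comp τ) ?_ (fun g => hFf (τ g))
        (fun g => hFz (τ g))
      · intro y
        obtain ⟨y, rfl⟩ := α.surjective y
        obtain ⟨e, rfl⟩ := hsurj' y
        exact ⟨π e, hpr e⟩
      · intro a
        obtain ⟨e, rfl⟩ := hsurj a
        rw [hpr, α.map_eq_zero_iff, hker', hZ, ← hπ1, hz]
        constructor
        · rintro (rfl | rfl)
          · exact Or.inl rfl
          · exact Or.inr rfl
        · rintro (h1 | h1)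
          · exact Or.inl (hinj _ _ h1)
          · exact Or.inr (hinj _ _ h1)
      · intro g a
        obtain ⟨e, rfl⟩ := hsurj a
        rw [MonoidHom.comp_apply, hF, hpr, hpr, ← hF', ← hα]; rfl
  obtain ⟨ψ, hψs, hψ⟩ := hc.exists_coordinates hm hs hq0 hqz hq hq3
    (fun a b ha haz hb hbz => by
      obtain ⟨s, hs⟩ := htr a b ha haz hb hbz
      exact ⟨(F s).toAddEquiv, hFf s, hFz s, hs⟩)
  refine ⟨fun u => x (ψ u), s, ?_, ?_⟩
  · intro u w
    rw [hG, ← map_add]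
    by_cases huw : u = w
    · subst huw
      have h1 : u + u = 0 := ZModModule.add_self u
      rw [h1, map_zero, hf0, if_pos rfl]
      simp [zsign_zero]
    · have h1 : u + w ≠ 0 := fun h0 => huw (add_eq_zero_iff_two.1 h0).symm
      rw [hψ _ h1, if_neg huw]
      push_cast; ring
  · rw [hLx]
    apply Set.eq_of_subset_of_subset
    · rintro _ ⟨a, rfl⟩
      obtain ⟨u, rfl | rfl⟩ := hψs a
      · exact ⟨u, rfl⟩
      · refine ⟨u, ?_⟩
        dsimp only
        rw [hxz, ← neg_one_smul ℂ (x (ψ u)), Submodule.span_singleton_smul_eq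
          (isUnit_one.neg)]
    · rintro _ ⟨u, rfl⟩
      exact ⟨ψ u, rfl⟩

end OrthogonalSystem

/-! ### Real character sums over the field of two elements -/

section CharacterSums

open SymplecticSpace

variable {m : ℕ}

theorem zsign_mul_self (t : ZMod 2) : zsign t * zsign t = 1 := by
  rw [← zsign_add, ZModModule.add_self, zsign_zero]

theorem sum_zsign_linear {A : Type*} [AddCommGroup A] [Module (ZMod 2) A] [Fintype A]
    (τ : A →ₗ[ZMod 2] ZMod 2) :
    ∑ a, zsign (τ a) = if ∀ a, τ a = 0 then (Fintype.card A : ℝ) else 0 := by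
  split_ifs with h
  · simp [h, zsign_zero]
  · push Not at h
    obtain ⟨b, hb⟩ := h
    have hb1 : τ b = 1 := (zmod_two_cases _).resolve_left hb
    have h1 := Equiv.sum_comp (Equiv.addRight b) fun a => zsign (τ a)
    simp only [Equiv.coe_addRight, map_add, hb1, zsign_add, zsign_one, mul_neg, mul_one,
      Finset.sum_neg_distrib] at h1
    linarith

theorem sum_zsign_dotProduct (c : Fin m → ZMod 2) :
    ∑ y : Fin m → ZMod 2, zsign (c ⬝ᵥ y) = if c = 0 then 2 ^ m else 0 := by
  have h := sum_zsign_linear (dotProductBilin (ZMod 2) (ZMod 2) c)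
  have hc : (∀ y, c ⬝ᵥ y = 0) ↔ c = 0 :=
    ⟨fun h => dotProduct_eq_zero c h, fun h y => by rw [h, zero_dotProduct]⟩
  simpa [hc] using h

theorem sum_zsign_pairing (u : Std (ZMod 2) m) :
    ∑ v : Std (ZMod 2) m, zsign (u.1 ⬝ᵥ v.1 + u.2 ⬝ᵥ v.2) = if u = 0 then 4 ^ m else 0 := by
  simp only [Fintype.sum_prod_type, zsign_add, ← Finset.mul_sum, sum_zsign_dotProduct,
    ← Finset.sum_mul]
  have h4 : (4 : ℝ) ^ m = 2 ^ m * 2 ^ m := by rw [← mul_pow]; norm_num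
  rw [h4]
  obtain ⟨a, b⟩ := u
  by_cases ha : a = 0 <;> by_cases hb : b = 0 <;> simp [ha, hb]

/-- For a fixed first component `x`, the sum over the second one vanishes unless `x = w.2`. The sign
of the result is the Arf invariant of the form. -/
theorem sum_zsign_quadratic (w : Std (ZMod 2) m) :
    ∑ v : Std (ZMod 2) m, zsign (v.1 ⬝ᵥ v.2 + w.1 ⬝ᵥ v.1 + w.2 ⬝ᵥ v.2) =
      2 ^ m * zsign (w.1 ⬝ᵥ w.2) := by
  rw [Fintype.sum_prod_type]
  have h : ∀ x y : Fin m → ZMod 2, zsign (x ⬝ᵥ y + w.1 ⬝ᵥ x + w.2 ⬝ᵥ y) =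
      zsign (w.1 ⬝ᵥ x) * zsign ((x + w.2) ⬝ᵥ y) := fun x y => by
    rw [← zsign_add, add_dotProduct]; congr 1; ring
  simp only [h, ← Finset.mul_sum, sum_zsign_dotProduct, add_eq_zero_iff_two]
  simp only [mul_ite, mul_zero]
  rw [Finset.sum_ite_eq]
  simp [mul_comm]

end CharacterSums

/-! ### Hyperplanes of the orthogonal space and their types -/

section OrthogonalHyperplanes

open SymplecticSpace

variable {m : ℕ}

theorem orthForm_apply (e : OrthSpace m) : orthForm m e = e.1 ⬝ᵥ e.2.1 + e.2.2 * e.2.2 := by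
  simp [orthForm, dotProduct]

theorem polar_orthForm (e f : OrthSpace m) :
    QuadraticMap.polar (orthForm m) e f = e.1 ⬝ᵥ f.2.1 + f.1 ⬝ᵥ e.2.1 := by
  rw [QuadraticMap.polar, orthForm_apply, orthForm_apply, orthForm_apply]
  have h2 : (2 : ZMod 2) = 0 := by decide
  simp only [Prod.fst_add, Prod.snd_add, add_dotProduct, dotProduct_add]
  linear_combination e.2.2 * f.2.2 * h2

/-- The functional `(x, y, t) ↦ a ⬝ x + b ⬝ y + t` for `w = (a, b)`. -/
def orthFunctional (w : Std (ZMod 2) m) : OrthSpace m →ₗ[ZMod 2] ZMod 2 where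
  toFun e := w.1 ⬝ᵥ e.1 + w.2 ⬝ᵥ e.2.1 + e.2.2
  map_add' e f := by simp only [Prod.fst_add, Prod.snd_add, dotProduct_add]; ring
  map_smul' c e := by
    simp only [Prod.smul_fst, Prod.smul_snd, dotProduct_smul, smul_eq_mul, RingHom.id_apply]; ring

theorem orthFunctional_apply (w : Std (ZMod 2) m) (e : OrthSpace m) :
    orthFunctional w e = w.1 ⬝ᵥ e.1 + w.2 ⬝ᵥ e.2.1 + e.2.2 := rfl

theorem finrank_orthSpace : Module.finrank (ZMod 2) (OrthSpace m) = 2 * m + 1 := by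
  rw [Module.finrank_prod, Module.finrank_prod, Module.finrank_fin_fun, Module.finrank_self]; ring

theorem finrank_ker_orthFunctional (w : Std (ZMod 2) m) :
    Module.finrank (ZMod 2) (LinearMap.ker (orthFunctional w)) = 2 * m := by
  have h := (orthFunctional w).finrank_range_add_finrank_ker
  have hr : LinearMap.range (orthFunctional w) = ⊤ := LinearMap.range_eq_top.2 fun t =>
    ⟨(0, 0, t), by simp [orthFunctional_apply]⟩
  rw [hr, finrank_top, Module.finrank_self, finrank_orthSpace] at h
  omega

theorem orthFunctional_injective :
    Function.Injective (orthFunctional : Std (ZMod 2) m → OrthSpace m →ₗ[ZMod 2] ZMod 2) := by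
  intro w w' h
  have h1 : ∀ x y, w.1 ⬝ᵥ x + w.2 ⬝ᵥ y = w'.1 ⬝ᵥ x + w'.2 ⬝ᵥ y := fun x y => by
    simpa [orthFunctional_apply] using LinearMap.congr_fun h (x, y, 0)
  refine Prod.ext (dotProduct_eq _ _ fun x => ?_) (dotProduct_eq _ _ fun y => ?_)
  · simpa using h1 x 0
  · simpa using h1 0 y

theorem exists_orthFunctional {g : OrthSpace m →ₗ[ZMod 2] ZMod 2} (hg : g (0, 0, 1) = 1) :
    ∃ w, g = orthFunctional w := by
  refine ⟨(fun i => g (Pi.single i 1, 0, 0), fun i => g (0, Pi.single i 1, 0)), ?_⟩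
  refine LinearMap.ext fun e => ?_
  have he : e = (∑ i, e.1 i • ((Pi.single i 1, 0, 0) : OrthSpace m)) +
      (∑ i, e.2.1 i • ((0, Pi.single i 1, 0) : OrthSpace m)) +
      e.2.2 • ((0, 0, 1) : OrthSpace m) := by
    refine Prod.ext ?_ (Prod.ext ?_ ?_)
    · simp only [Prod.fst_add, Prod.fst_sum, Prod.smul_fst, smul_zero, Finset.sum_const_zero,
        add_zero]
      exact pi_eq_sum_univ' e.1
    · simp only [Prod.snd_add, Prod.fst_add, Prod.snd_sum, Prod.fst_sum, Prod.smul_snd,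
        Prod.smul_fst, smul_zero, Finset.sum_const_zero, add_zero, zero_add]
      exact pi_eq_sum_univ' e.2.1
    · simp [Prod.snd_sum]
  conv_lhs => rw [he]
  simp only [map_add, map_sum, map_smul, hg, orthFunctional_apply, dotProduct, smul_eq_mul,
    mul_one, mul_comm]

/-- On the hyperplane the last coordinate is a linear function of the others, and it equals its own
square. -/
theorem orthForm_eq_of_mem_ker {w : Std (ZMod 2) m} {e : OrthSpace m}
    (he : orthFunctional w e = 0) :
    orthForm m e = e.1 ⬝ᵥ e.2.1 + w.1 ⬝ᵥ e.1 + w.2 ⬝ᵥ e.2.1 := by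
  have h1 : e.2.2 = w.1 ⬝ᵥ e.1 + w.2 ⬝ᵥ e.2.1 := (add_eq_zero_iff_two.1 he)
  have h2 : e.2.2 * e.2.2 = e.2.2 := by
    rcases zmod_two_cases e.2.2 with h | h <;> rw [h] <;> decide
  rw [orthForm_apply, h2, h1, add_assoc]

/-- If the Arf invariant were `1`, the sum of the signs of `q` over all vectors would be `-2 ^ m`.
Summing over the translates by `T` yields a vanishing sum of nonnegative terms in which the term of
`0` is positive. -/
theorem dotProduct_eq_zero_of_singular {w : Std (ZMod 2) m} {T : Submodule (ZMod 2) (OrthSpace m)}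
    (hT : T ≤ LinearMap.ker (orthFunctional w)) (hTd : Module.finrank (ZMod 2) T = m)
    (hq : ∀ x ∈ T, orthForm m x = 0) : w.1 ⬝ᵥ w.2 = 0 := by
  classical
  by_contra hne
  have h1 := (zmod_two_cases _).resolve_left hne
  let _ : Fintype T := Fintype.ofFinite T
  have hcT : (Fintype.card T : ℝ) = 2 ^ m := by
    rw [Module.card_eq_pow_finrank (K := ZMod 2), hTd, ZMod.card]; norm_num
  let q : Std (ZMod 2) m → ZMod 2 := fun v => v.1 ⬝ᵥ v.2 + w.1 ⬝ᵥ v.1 + w.2 ⬝ᵥ v.2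
  let B : Std (ZMod 2) m → T → ZMod 2 := fun v τ => τ.1.2.1 ⬝ᵥ v.1 + τ.1.1 ⬝ᵥ v.2
  have hqT : ∀ τ : T, q (τ.1.1, τ.1.2.1) = 0 := fun τ => by
    have := orthForm_eq_of_mem_ker (hT τ.2)
    rw [hq _ τ.2] at this
    exact this.symm
  have hqB : ∀ v (τ : T), q (v + (τ.1.1, τ.1.2.1)) = q v + B v τ := fun v τ => by
    rw [← add_zero (q v + B v τ), ← hqT τ]
    simp only [q, B, Prod.fst_add, Prod.snd_add, add_dotProduct, dotProduct_add,
      dotProduct_comm τ.1.2.1 v.1]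
    ring
  have hsq : ∑ v, ∑ τ, zsign (q v) * zsign (B v τ) = -(2 ^ m * 2 ^ m) := by
    rw [Finset.sum_comm]
    simp only [← zsign_add, ← hqB]
    have h2 : ∀ τ : T, ∑ v, zsign (q (v + (τ.1.1, τ.1.2.1))) = -2 ^ m := fun τ => by
      have h3 := Equiv.sum_comp (Equiv.addRight ((τ.1.1, τ.1.2.1) : Std (ZMod 2) m))
        fun v => zsign (q v)
      rw [sum_zsign_quadratic, h1, zsign_one, mul_neg_one] at h3
      exact h3
    rw [Finset.sum_congr rfl fun τ _ => h2 τ, Finset.sum_const, Finset.card_univ, nsmul_eq_mul, hcT]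
    ring
  have hsB : ∑ v, ∑ τ, zsign (B v τ) = 2 ^ m * 2 ^ m := by
    rw [Finset.sum_comm]
    have h2 : ∀ τ : T, ∑ v, zsign (B v τ) = if τ = 0 then 4 ^ m else 0 := fun τ => by
      rw [sum_zsign_pairing (τ.1.2.1, τ.1.1)]
      congr 1
      rw [eq_iff_iff]
      constructor
      · intro h3
        have h4 := Prod.ext_iff.1 h3
        have h5 : orthFunctional w τ.1 = 0 := hT τ.2
        rw [orthFunctional_apply] at h5
        refine Subtype.ext (Prod.ext h4.2 (Prod.ext h4.1 ?_))
        have h6 : τ.1.1 = 0 := h4.2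
        have h7 : τ.1.2.1 = 0 := h4.1
        rw [h6, h7] at h5
        simpa using h5
      · rintro rfl; rfl
    rw [Finset.sum_congr rfl fun τ _ => h2 τ, Finset.sum_ite_eq' , if_pos (Finset.mem_univ _),
      ← mul_pow]
    norm_num
  have hnn : ∀ v, 0 ≤ ∑ τ, zsign (B v τ) := fun v => by
    let b : T →ₗ[ZMod 2] ZMod 2 := AddMonoidHom.toZModLinearMap 2 <|
      AddMonoidHom.mk' (fun τ => B v τ) fun τ τ' => by
        simp only [B, Submodule.coe_add, Prod.fst_add, Prod.snd_add, add_dotProduct]; ring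
    have h2 : ∑ τ, zsign (B v τ) = ∑ τ, zsign (b τ) := rfl
    rw [h2, sum_zsign_linear]
    split_ifs
    · positivity
    · exact le_rfl
  -- The inner sums are character sums over `T`, equal to `0` or `2 ^ m`; the two totals `∓4 ^ m`
  -- cancel.
  have h0 : ∑ v, (1 + zsign (q v)) * ∑ τ, zsign (B v τ) = 0 := by
    simp only [add_mul, one_mul, Finset.sum_add_distrib, Finset.mul_sum]
    rw [hsq, hsB]; ring
  have hq1 : ∀ v, 0 ≤ 1 + zsign (q v) := fun v => by
    rcases zmod_two_cases (q v) with h | h <;> rw [h]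
    · rw [zsign_zero]; norm_num
    · rw [zsign_one]; norm_num
  have h3 := (Finset.sum_eq_zero_iff_of_nonneg fun v _ => mul_nonneg (hq1 v) (hnn v)).1 h0 0
    (Finset.mem_univ _)
  have hB0 : ∀ τ, B 0 τ = 0 := fun τ => by simp [B]
  have hq0 : q 0 = 0 := by simp [q]
  simp only [hB0, hq0, zsign_zero, Finset.sum_const, Finset.card_univ, nsmul_eq_mul, hcT,
    mul_one] at h3
  have : (0 : ℝ) < 2 ^ m := by positivity
  linarith

/-- The subspace is the graph of a linear map `B` for which the restricted form `x ⬝ Bx + w.1 ⬝ x +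
w.2 ⬝ Bx` vanishes identically. -/
theorem exists_singular {w : Std (ZMod 2) m} (hw : w.1 ⬝ᵥ w.2 = 0) :
    ∃ T : Submodule (ZMod 2) (OrthSpace m), T ≤ LinearMap.ker (orthFunctional w) ∧
      Module.finrank (ZMod 2) T = m ∧ ∀ x ∈ T, orthForm m x = 0 := by
  obtain ⟨B, hB⟩ : ∃ B : (Fin m → ZMod 2) →ₗ[ZMod 2] (Fin m → ZMod 2),
      ∀ x, x ⬝ᵥ B x = w.1 ⬝ᵥ x + w.2 ⬝ᵥ B x := by
    by_cases h0 : w.2 = 0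
    · refine ⟨LinearMap.pi fun i => w.1 i • LinearMap.proj i, fun x => ?_⟩
      rw [h0, zero_dotProduct, add_zero, dotProduct, dotProduct]
      refine Finset.sum_congr rfl fun i _ => ?_
      simp only [LinearMap.pi_apply, LinearMap.smul_apply, LinearMap.proj_apply, smul_eq_mul]
      rcases zmod_two_cases (x i) with h | h <;> rw [h] <;> ring
    · obtain ⟨u, hu⟩ : ∃ u, w.2 ⬝ᵥ u ≠ 0 := by
        by_contra! h; exact h0 (dotProduct_eq_zero _ h)
      have hu1 := (zmod_two_cases _).resolve_left hu
      -- For `Bx = (u ⬝ x) w.1 + (w.1 ⬝ x) u` the product `x ⬝ Bx` vanishes, and `w.2 ⬝ Bx = w.1 ⬝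
      -- x` by `w.1 ⬝ w.2 = 0` and `w.2 ⬝ u = 1`.
      refine ⟨(dotProductBilin (ZMod 2) (ZMod 2) u).smulRight w.1 +
        (dotProductBilin (ZMod 2) (ZMod 2) w.1).smulRight u, fun x => ?_⟩
      have h2 : (2 : ZMod 2) = 0 := by decide
      simp only [LinearMap.add_apply, LinearMap.smulRight_apply, dotProductBilin_apply_apply,
        dotProduct_add, dotProduct_smul, smul_eq_mul, hu1, dotProduct_comm w.2 w.1, hw,
        dotProduct_comm x w.1, dotProduct_comm x u]
      linear_combination (u ⬝ᵥ x * w.1 ⬝ᵥ x - w.1 ⬝ᵥ x) * h2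
  let F : (Fin m → ZMod 2) →ₗ[ZMod 2] OrthSpace m :=
    LinearMap.id.prod (B.prod ((dotProductBilin (ZMod 2) (ZMod 2) w.1) +
      (dotProductBilin (ZMod 2) (ZMod 2) w.2) ∘ₗ B))
  have hF : ∀ x, F x = (x, B x, w.1 ⬝ᵥ x + w.2 ⬝ᵥ B x) := fun x => rfl
  have hk : ∀ x, orthFunctional w (F x) = 0 := fun x => by
    rw [orthFunctional_apply, hF]; exact ZModModule.add_self _
  refine ⟨LinearMap.range F, ?_, ?_, ?_⟩
  · rintro _ ⟨x, rfl⟩; exact hk x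
  · rw [LinearMap.finrank_range_of_inj, Module.finrank_fin_fun]
    intro x y hxy
    exact congrArg Prod.fst hxy
  · rintro _ ⟨x, rfl⟩
    rw [orthForm_eq_of_mem_ker (hk x), hF, hB, add_assoc]
    exact ZModModule.add_self _

theorem isHyperplaneOfType_ker_iff (ε : ℤˣ) (w : Std (ZMod 2) m) :
    IsHyperplaneOfType m ε (LinearMap.ker (orthFunctional w)) ↔
      (ε = 1 ↔ w.1 ⬝ᵥ w.2 = 0) := by
  have hiff : (∃ T : Submodule (ZMod 2) (OrthSpace m), T ≤ LinearMap.ker (orthFunctional w) ∧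
      Module.finrank (ZMod 2) T = m ∧ ∀ x ∈ T, orthForm m x = 0) ↔ w.1 ⬝ᵥ w.2 = 0 :=
    ⟨fun ⟨_, h1, h2, h3⟩ => dotProduct_eq_zero_of_singular h1 h2 h3, exists_singular⟩
  refine ⟨fun h => h.type_eq.trans hiff, fun h => ⟨finrank_ker_orthFunctional w, ?_,
    h.trans hiff.symm⟩⟩
  intro e he hpol
  have h1 : ∀ x y : Fin m → ZMod 2, e.1 ⬝ᵥ y + x ⬝ᵥ e.2.1 = 0 := fun x y => by
    rw [← hpol (x, y, w.1 ⬝ᵥ x + w.2 ⬝ᵥ y) (by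
      rw [LinearMap.mem_ker, orthFunctional_apply]; exact ZModModule.add_self _), polar_orthForm]
  have h2 : e.1 = 0 := dotProduct_eq_zero _ fun y => by simpa using h1 0 y
  have h3 : e.2.1 = 0 := dotProduct_eq_zero _ fun x => by
    rw [dotProduct_comm]; simpa using h1 x 0
  rw [LinearMap.mem_ker, orthFunctional_apply, h2, h3] at he
  exact Prod.ext h2 (Prod.ext h3 (by simpa using he))

/-- A hyperplane with nondegenerate polar form misses the radical vector `(0, 0, 1)`, so its
functional takes the value `1` there. -/
theorem IsHyperplaneOfType.exists_eq_ker {ε : ℤˣ} {M : Submodule (ZMod 2) (OrthSpace m)}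
    (h : IsHyperplaneOfType m ε M) : ∃ w, M = LinearMap.ker (orthFunctional w) := by
  have h1 : ((0, 0, 1) : OrthSpace m) ∉ M := fun hM => by
    have := h.nondegenerate _ hM fun y _ => by rw [polar_orthForm]; simp
    simp at this
  obtain ⟨g, hgM, hg1⟩ := exists_functional M h1
  obtain ⟨w, rfl⟩ := exists_orthFunctional hg1
  refine ⟨w, Submodule.eq_of_le_of_finrank_eq (fun x hx => hgM x hx) ?_⟩
  rw [h.finrank_eq, finrank_ker_orthFunctional]

/-- The hyperplanes of type `O^ε(2m, 2)` in coordinates. -/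
noncomputable def orthHyperplaneEquiv (m : ℕ) (ε : ℤˣ) :
    {w : Std (ZMod 2) m // ε = 1 ↔ w.1 ⬝ᵥ w.2 = 0} ≃ OrthHyperplane m ε :=
  Equiv.ofBijective
    (fun w => ⟨LinearMap.ker (orthFunctional w.1), (isHyperplaneOfType_ker_iff ε w.1).2 w.2⟩) <| by
    constructor
    · intro w w' h
      refine Subtype.ext (orthFunctional_injective (LinearMap.ext fun e => ?_))
      have h1 : orthFunctional w.1 e = 0 ↔ orthFunctional w'.1 e = 0 := by
        rw [← LinearMap.mem_ker, ← LinearMap.mem_ker]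
        exact (SetLike.ext_iff.1 (congrArg Subtype.val h)) e
      rcases zmod_two_cases (orthFunctional w.1 e) with h2 | h2 <;>
        rcases zmod_two_cases (orthFunctional w'.1 e) with h3 | h3 <;> simp_all
    · rintro ⟨M, hM⟩
      obtain ⟨w, rfl⟩ := hM.exists_eq_ker
      exact ⟨⟨w, (isHyperplaneOfType_ker_iff ε w).1 hM⟩, rfl⟩

end OrthogonalHyperplanes

/-! ### The orthogonal lines and their identification -/

section OrthogonalTarget

open SymplecticSpace

variable {m : ℕ} (ε : ℤˣ)

theorem orthVector_apply (e : OrthSpace m) (M : OrthHyperplane m ε)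
    {w : Std (ZMod 2) m} (hw : M.1 = LinearMap.ker (orthFunctional w)) :
    orthVector m ε e M = (zsign (orthFunctional w e) : ℂ) := by
  have h : orthVector m ε e M = if orthFunctional w e = 0 then (1 : ℂ) else -1 := by
    rw [orthVector]
    simp only [WithLp.ofLp_sum, Finset.sum_apply, PiLp.smul_apply, smul_eq_mul,
      PiLp.single_apply]
    simp [hw]
  rw [h, zsign]
  split_ifs <;> simp

/-- The vectors of the orthogonal example, one for each line. -/
noncomputable def orthLineVector (u : Std (ZMod 2) m) : EuclideanSpace ℂ (OrthHyperplane m ε) :=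
  orthVector m ε (u.1, u.2, 0)

theorem orthLineVector_apply (u : Std (ZMod 2) m)
    (w : {w : Std (ZMod 2) m // ε = 1 ↔ w.1 ⬝ᵥ w.2 = 0}) :
    orthLineVector ε u (orthHyperplaneEquiv m ε w) =
      (zsign (u.1 ⬝ᵥ w.1.1 + u.2 ⬝ᵥ w.1.2) : ℂ) := by
  rw [orthLineVector, orthVector_apply ε _ _ (w := w.1) rfl, orthFunctional_apply, add_zero,
    dotProduct_comm u.1, dotProduct_comm u.2]

/-- The radical vector acts as `-1`, so the last coordinate does not affect the line. -/
theorem orthVector_eq (e : OrthSpace m) :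
    orthVector m ε e = (zsign e.2.2 : ℂ) • orthLineVector ε (e.1, e.2.1) := by
  ext M
  obtain ⟨w, rfl⟩ := (orthHyperplaneEquiv m ε).surjective M
  rw [PiLp.smul_apply, orthLineVector, orthVector_apply ε _ _ (w := w.1) rfl,
    orthVector_apply ε _ _ (w := w.1) rfl, smul_eq_mul, ← Complex.ofReal_mul, ← zsign_add]
  congr 2
  simp only [orthFunctional_apply]; ring

theorem orthLines_eq_range :
    orthLines m ε = Set.range fun u => Submodule.span ℂ {orthLineVector ε u} := by
  apply Set.eq_of_subset_of_subset
  · rintro _ ⟨e, rfl⟩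
    refine ⟨(e.1, e.2.1), ?_⟩
    dsimp only
    rw [orthVector_eq, Submodule.span_singleton_smul_eq]
    rw [isUnit_iff_ne_zero, Complex.ofReal_ne_zero]
    exact fun h => by simpa [h] using zsign_mul_self e.2.2
  · rintro _ ⟨u, rfl⟩
    exact ⟨(u.1, u.2, 0), rfl⟩

/-- The condition on the type is the indicator function `(1 + ε zsign (w.1 ⬝ w.2)) / 2`, which
splits the sum into a linear and a quadratic character sum. -/
theorem two_mul_sum_zsign_subtype (u : Std (ZMod 2) m) :
    2 * ∑ w : {w : Std (ZMod 2) m // ε = 1 ↔ w.1 ⬝ᵥ w.2 = 0},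
        zsign (u.1 ⬝ᵥ w.1.1 + u.2 ⬝ᵥ w.1.2) =
      (if u = 0 then 4 ^ m else 0) + ((ε : ℤ) : ℝ) * (2 ^ m * zsign (u.1 ⬝ᵥ u.2)) := by
  classical
  rw [← sum_zsign_pairing, ← sum_zsign_quadratic, Finset.mul_sum, Finset.mul_sum,
    ← Finset.sum_add_distrib, ← Finset.sum_subtype
      (p := fun w : Std (ZMod 2) m => ε = 1 ↔ w.1 ⬝ᵥ w.2 = 0)
      (Finset.univ.filter fun w : Std (ZMod 2) m => ε = 1 ↔ w.1 ⬝ᵥ w.2 = 0) (by simp)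
      (fun w => 2 * zsign (u.1 ⬝ᵥ w.1 + u.2 ⬝ᵥ w.2)), Finset.sum_filter]
  refine Finset.sum_congr rfl fun w _ => ?_
  rw [add_assoc, zsign_add (w.1 ⬝ᵥ w.2)]
  have hne : (-1 : ℤˣ) ≠ 1 := by decide
  rcases zmod_two_cases (w.1 ⬝ᵥ w.2) with h | h <;>
    rcases Int.units_eq_one_or ε with rfl | rfl <;>
    simp [h, hne, zsign_zero, zsign_one] <;> ring

theorem inner_orthLineVector (u v : Std (ZMod 2) m) :
    2 * inner ℂ (orthLineVector ε u) (orthLineVector ε v) =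
      (if u = v then 4 ^ m else 0) +
        ((ε : ℤ) : ℂ) * (2 ^ m * (zsign ((u + v).1 ⬝ᵥ (u + v).2) : ℂ)) := by
  have h := congrArg (fun t : ℝ => (t : ℂ)) (two_mul_sum_zsign_subtype ε (u + v))
  have huv : u + v = 0 ↔ u = v := add_eq_zero_iff_two.trans eq_comm
  simp only [huv] at h
  push_cast at h
  rw [PiLp.inner_apply, ← Equiv.sum_comp (orthHyperplaneEquiv m ε)]
  refine Eq.trans ?_ (h.trans (by by_cases huv' : u = v <;> simp [huv']))
  congr 1
  refine Finset.sum_congr rfl fun w _ => ?_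
  rw [orthLineVector_apply, orthLineVector_apply, RCLike.inner_apply, Complex.conj_ofReal,
    ← Complex.ofReal_mul, ← zsign_add]
  congr 2
  simp only [Prod.fst_add, Prod.snd_add, add_dotProduct]; ring

/-- By Fourier inversion, averaging the vectors against the character of one hyperplane isolates its
basis vector. -/
theorem span_orthLineVector :
    Submodule.span ℂ (Set.range (orthLineVector (m := m) ε)) = ⊤ := by
  classical
  rw [eq_top_iff, ← (EuclideanSpace.basisFun (OrthHyperplane m ε) ℂ).toBasis.span_eq,
    Submodule.span_le]
  rintro _ ⟨M, rfl⟩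
  obtain ⟨w, rfl⟩ := (orthHyperplaneEquiv m ε).surjective M
  have h4 : (4 : ℂ) ^ m ≠ 0 := pow_ne_zero _ (by norm_num)
  have h : ((EuclideanSpace.basisFun (OrthHyperplane m ε) ℂ).toBasis (orthHyperplaneEquiv m ε w)) =
      ((4 : ℂ) ^ m)⁻¹ • ∑ u, (zsign (w.1.1 ⬝ᵥ u.1 + w.1.2 ⬝ᵥ u.2) : ℂ) • orthLineVector ε u := by
    ext M
    obtain ⟨w', rfl⟩ := (orthHyperplaneEquiv m ε).surjective M
    have hs : ∑ u : Std (ZMod 2) m, ((zsign (w.1.1 ⬝ᵥ u.1 + w.1.2 ⬝ᵥ u.2) : ℂ) *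
        orthLineVector ε u (orthHyperplaneEquiv m ε w')) = if w' = w then 4 ^ m else 0 := by
      have h := congrArg (fun t : ℝ => (t : ℂ)) (sum_zsign_pairing (w.1 + w'.1))
      have hww : w.1 + w'.1 = 0 ↔ w' = w := add_eq_zero_iff_two.trans Subtype.ext_iff.symm
      simp only [hww] at h
      push_cast at h
      refine Eq.trans ?_ (h.trans (by by_cases hw : w' = w <;> simp [hw]))
      refine Finset.sum_congr rfl fun u _ => ?_
      rw [orthLineVector_apply, ← Complex.ofReal_mul, ← zsign_add, dotProduct_comm u.1,
        dotProduct_comm u.2]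
      congr 2
      simp only [Prod.fst_add, Prod.snd_add, add_dotProduct]; ring
    rw [PiLp.smul_apply, WithLp.ofLp_sum, Finset.sum_apply]
    simp only [PiLp.smul_apply, smul_eq_mul]
    rw [hs]
    by_cases hw : w' = w
    · simp [hw, h4]
    · simp [hw, (orthHyperplaneEquiv m ε).injective.eq_iff]
  rw [SetLike.mem_coe, h]
  exact Submodule.smul_mem _ _ (Submodule.sum_mem _ fun u _ => Submodule.smul_mem _ _
    (Submodule.subset_span ⟨u, rfl⟩))

/-- After translation by `u`, the product of the two quadratic characters is a sign times a linear
character in `w`, which is trivial only for `u = v`. -/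
theorem sum_zsign_mul_zsign (u v : Std (ZMod 2) m) :
    ∑ w : Std (ZMod 2) m, zsign ((u + w).1 ⬝ᵥ (u + w).2) * zsign ((w + v).1 ⬝ᵥ (w + v).2) =
      if u = v then (2 ^ m) ^ 2 else 0 := by
  rw [← Equiv.sum_comp (Equiv.addRight u)]
  have h2 : (2 : ZMod 2) = 0 := by decide
  have h : ∀ w : Std (ZMod 2) m, zsign ((u + (w + u)).1 ⬝ᵥ (u + (w + u)).2) *
      zsign ((w + u + v).1 ⬝ᵥ (w + u + v).2) = zsign ((u + v).1 ⬝ᵥ (u + v).2) *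
        zsign ((u + v).2 ⬝ᵥ w.1 + (u + v).1 ⬝ᵥ w.2) := fun w => by
    have e1 : u + (w + u) = w := by rw [add_comm w, ← add_assoc, ZModModule.add_self, zero_add]
    rw [e1, add_assoc, ← zsign_add, ← zsign_add]
    congr 1
    simp only [Prod.fst_add w, Prod.snd_add w, add_dotProduct w.1, dotProduct_add _ w.2,
      dotProduct_comm w.1 (u + v).2]
    linear_combination w.1 ⬝ᵥ w.2 * h2
  simp only [Equiv.coe_addRight, h, ← Finset.mul_sum]
  rw [sum_zsign_pairing ((u + v).2, (u + v).1)]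
  have h4 : (4 : ℝ) ^ m = (2 ^ m) ^ 2 := by rw [← pow_mul, mul_comm, pow_mul]; norm_num
  by_cases huv : u = v
  · subst huv
    have e : u + u = 0 := ZModModule.add_self u
    rw [e, h4]
    simp [zsign_zero]
  · have : ((u + v).2, (u + v).1) ≠ (0 : Std (ZMod 2) m) := fun h0 => by
      have h1 := Prod.ext_iff.1 h0
      exact huv (add_eq_zero_iff_two.1 (Prod.ext h1.2 h1.1)).symm
    rw [if_neg this, if_neg huv, mul_zero]

-- As for the Weil lines: dependence leaves two values of `s`, one for each type `ε`, and the model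
-- vectors have the proportional Gram matrix.
open Classical in
theorem lineSetEquivalent_orthLines {V : Type*} [NormedAddCommGroup V] [InnerProductSpace ℂ V]
    [FiniteDimensional ℂ V] (hm : 0 < m) {L : Set (Submodule ℂ V)} (hL : sSup L = ⊤)
    (hd : Module.finrank ℂ V < 2 ^ (2 * m)) {x : Std (ZMod 2) m → V} {s : ℝ}
    (hx : ∀ u w, inner ℂ (x u) (x w) = (1 - s) * (if u = w then 1 else 0) +
      s * zsign ((u + w).1 ⬝ᵥ (u + w).2))
    (hLx : L = Set.range fun u => Submodule.span ℂ {x u}) :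
    ∃ ε : ℤˣ, LineSetEquivalent L (orthLines m ε) := by
  obtain ⟨ε, hε⟩ := exists_sign_of_gram x (by
    rwa [← Nat.card_eq_fintype_card, natCard_std]) ((2 : ℂ) ^ m) s
    (fun u w => (zsign ((u + w).1 ⬝ᵥ (u + w).2) : ℂ)) hx (fun u v => by
      have := congrArg (fun t : ℝ => (t : ℂ)) (sum_zsign_mul_zsign u v)
      push_cast at this
      refine this.trans ?_
      by_cases huv : u = v <;> simp [huv])
  refine ⟨ε, ?_⟩
  rw [hLx, orthLines_eq_range]
  have h1 : (1 : ℝ) < 2 ^ m := one_lt_pow₀ one_lt_two hm.ne'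
  -- This factor is the number of hyperplanes of type `ε`, the squared length of the model vectors.
  have hC : (0 : ℝ) < ((2 : ℝ) ^ m + ((ε : ℤ) : ℝ)) * 2 ^ m / 2 := by
    rcases Int.units_eq_one_or ε with rfl | rfl
    · push_cast; nlinarith
    · push_cast; nlinarith
  refine lineSetEquivalent_of_gram _ _ hC ?_ (span_range_of_lines hL hLx) (span_orthLineVector ε)
  intro u w
  have h2 := inner_orthLineVector ε u w
  have h4 : (4 : ℂ) ^ m = 2 ^ m * 2 ^ m := by rw [← mul_pow]; norm_num
  rw [h4] at h2
  rw [hx]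
  push_cast
  by_cases h : u = w
  · simp only [h, if_true] at h2 ⊢
    have e : w + w = 0 := ZModModule.add_self w
    simp only [e, Prod.fst_zero, zero_dotProduct, zsign_zero] at h2 ⊢
    push_cast at h2 ⊢
    linear_combination h2 / 2
  · simp only [h, if_false] at h2 ⊢
    linear_combination h2 / 2 - (2 ^ m / 2 * (zsign ((u + w).1 ⬝ᵥ (u + w).2) : ℂ)) * hε

end OrthogonalTarget

/-! ### From the semidirect product to a line configuration -/

section Main

variable {V : Type*} [NormedAddCommGroup V] [InnerProductSpace ℂ V] [FiniteDimensional ℂ V]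

theorem exists_isLineConfiguration_of_mulEquiv {p m : ℕ} (hp : 1 < p) (hm : 0 < m)
    {L : Set (Submodule ℂ V)} (hL : IsEquiangularLineSet L) (hn : L.ncard = p ^ (2 * m))
    (hd : 0 < Module.finrank ℂ V) (hd2 : 2 * Module.finrank ℂ V ≤ p ^ (2 * m))
    {G : Subgroup (V ≃ₗᵢ[ℂ] V)} (hGL : ActsByAutomorphisms G L) (hG2 : IsTwoTransitiveOn G L)
    {E S : Type*} [Group E] [Group S] {φ : S →* MulAut E} (ψ : G ≃* E ⋊[φ] S)
    (hcard : Nat.card E = p ^ (1 + 2 * m))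
    (hE : IsElementaryAbelian p E ∧ p = 2 ∨
      Nat.card (Subgroup.center E) = p ∧ Subgroup.center E ≠ ⊤) :
    ∃ (ρ : E →* (V ≃ₗᵢ[ℂ] V)) (σ : S →* (V ≃ₗᵢ[ℂ] V)) (Z : Subgroup E),
      IsLineConfiguration p L ρ σ φ Z ∧
      (Nat.card (Subgroup.center E) = p → Z = Subgroup.center E) := by
  let κ : E ⋊[φ] S →* (V ≃ₗᵢ[ℂ] V) := G.subtype.comp ψ.symm.toMonoidHom
  have hκ : Function.Injective κ := Subtype.val_injective.comp ψ.symm.injective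
  have hinj : Function.Injective (κ.comp SemidirectProduct.inl) :=
    hκ.comp SemidirectProduct.inl_injective
  refine ⟨κ.comp SemidirectProduct.inl, κ.comp SemidirectProduct.inr, ?_⟩
  refine exists_isLineConfiguration hp hm hL hn hd2 hGL hG2 hcard _ _ ?_ hinj ?_ ?_
    (hE.imp (fun h => h.1.1) fun h => h.1)
  · intro s e
    simp only [MonoidHom.comp_apply, SemidirectProduct.inl_aut, map_mul, map_inv]
  · intro g
    constructor
    · intro hg
      refine ⟨(ψ ⟨g, hg⟩).left, (ψ ⟨g, hg⟩).right, ?_⟩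
      have h := congrArg κ (SemidirectProduct.inl_left_mul_inr_right (ψ ⟨g, hg⟩))
      rw [map_mul] at h
      exact (h.trans (congrArg Subtype.val (ψ.symm_apply_apply ⟨g, hg⟩))).symm
    · rintro ⟨e, s, rfl⟩
      exact mul_mem (Subtype.prop _) (Subtype.prop _)
  -- If `E` were scalar, it would embed into the multiplicative group of the complex numbers. Then
  -- it would be abelian, and in the elementary abelian case of order at most `2`.
  · by_contra! hall
    choose c hc using hall
    have : Nontrivial V := Module.finrank_pos_iff.1 hd
    obtain ⟨v, hv⟩ := exists_ne (0 : V)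
    have hcinj : Function.Injective c := fun e e' h => hinj <| LinearIsometryEquiv.ext fun x => by
      rw [hc, hc, h]
    have hcm : ∀ e e', c (e * e') = c e * c e' := fun e e' => by
      have h1 : c (e * e') • v = (c e * c e') • v := by
        rw [← hc, map_mul, LinearIsometryEquiv.coe_mul, Function.comp_apply, hc, hc, smul_smul]
      exact smul_left_injective ℂ hv h1
    have hcomm : ∀ e e' : E, e * e' = e' * e := fun e e' => hcinj (by
      rw [hcm, hcm, mul_comm])
    rcases hE with ⟨h, rfl⟩ | ⟨-, h⟩
    · have hc1 : c 1 = 1 := by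
        have h1 : c 1 • v = (1 : ℂ) • v := by rw [← hc, map_one, one_smul]; rfl
        exact smul_left_injective ℂ hv h1
      have hcs : ∀ e, c e = 1 ∨ c e = -1 := fun e => by
        rw [← mul_self_eq_one_iff, ← hcm, ← pow_two, h.2, hc1]
      have hle : Nat.card E ≤ Nat.card ({1, -1} : Finset ℂ) :=
        Nat.card_le_card_of_injective (fun e => (⟨c e, by simpa using hcs e⟩ : ({1, -1} : Finset ℂ)))
          fun e e' h => hcinj (congrArg Subtype.val h)
      rw [hcard, Nat.card_eq_fintype_card, Fintype.card_coe] at hle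
      have h2 := hle.trans Finset.card_le_two
      have h3 : 2 ^ 2 ≤ 2 ^ (1 + 2 * m) := Nat.pow_le_pow_right two_pos (by omega)
      omega
    · apply h
      rw [eq_top_iff]
      exact fun e _ => Subgroup.mem_center_iff.2 fun e' => hcomm e' e

theorem IsExtraspecial.center_ne_top {p : ℕ} (hp : 1 < p) {E : Type*} [Group E]
    (h : IsExtraspecial p E) : Subgroup.center E ≠ ⊤ := by
  intro hc
  have h1 : commutator E = ⊥ := by
    rw [commutator_eq_bot_iff_center_eq_top]; exact hc
  have h2 := h.card_center
  rw [← h.commutator_eq_center, h1, Subgroup.card_bot] at h2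
  omega

end Main

theorem lemma3p3 (p m : ℕ) [Fact p.Prime]
    {V : Type*} [NormedAddCommGroup V] [InnerProductSpace ℂ V] [FiniteDimensional ℂ V]
    (L : Set (Submodule ℂ V)) (hL : IsEquiangularLineSet L)
    (hn : L.ncard = p ^ (2 * m))
    (hd1 : 1 < Module.finrank ℂ V) (hd2 : 2 * Module.finrank ℂ V ≤ p ^ (2 * m))
    (G : Subgroup (V ≃ₗᵢ[ℂ] V)) (hGL : ActsByAutomorphisms G L) (hG2 : IsTwoTransitiveOn G L)
    {E S : Type*} [Group E] [Group S] (φ : S →* MulAut E)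
    (hG : Nonempty (G ≃* E ⋊[φ] S)) (hS : Nonempty (S ≃* Sp m p))
    (hcard : Nat.card E = p ^ (1 + 2 * m))
    (hE2 : p = 2 → IsElementaryAbelian 2 E) (hEp : 2 < p → IsExtraspecial p E) :
    (p = 2 ∧ 1 < m ∧ ∃ ε : ℤˣ, LineSetEquivalent L (orthLines m ε)) ∨
      (2 < p ∧ 1 ≤ m ∧ ∃ ε : ℤˣ, LineSetEquivalent (V' := WeilTensor p m ε) L (weilLines p m ε)) := by
  have hpp := Fact.out (p := p.Prime)
  have hm : 0 < m := by
    rcases Nat.eq_zero_or_pos m with rfl | hm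
    · rw [mul_zero, pow_zero] at hd2; omega
    · exact hm
  obtain ⟨ψ⟩ := hG
  rcases hpp.two_le.eq_or_lt with h2 | h2
  · subst h2
    obtain ⟨ρ, σ, Z, h, -⟩ := exists_isLineConfiguration_of_mulEquiv one_lt_two hm hL hn
      (by omega) hd2 hGL hG2 ψ hcard (Or.inl ⟨hE2 rfl, rfl⟩)
    obtain ⟨hm1, x, s, hx, hLx⟩ := exists_orthogonal_system hm hL hn hd1 hd2 hcard h (hE2 rfl) hS
    exact Or.inl ⟨rfl, hm1, lineSetEquivalent_orthLines hm hL.span_eq_top (by omega) hx hLx⟩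
  · have hE := hEp h2
    obtain ⟨ρ, σ, Z, h, hZ⟩ := exists_isLineConfiguration_of_mulEquiv hpp.one_lt hm hL hn
      (by omega) hd2 hGL hG2 ψ hcard (Or.inr ⟨hE.card_center, hE.center_ne_top hpp.one_lt⟩)
    obtain rfl := hZ hE.card_center
    obtain ⟨v, D, c, hv, hD0, hD, hLD, hc⟩ := exists_weyl_system h2.ne' hm hL hn hcard h hE hS
    exact Or.inr ⟨h2, hm, lineSetEquivalent_weilLines h2.ne' hm hL.span_eq_top (by omega) hv hD0 hD
      hLD hc⟩
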